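/- \textbf{Setting.} Let $\mathbb{K}$ be an algebraically closed field of characteristic $p>0$ and $G$ a connected reductive algebraic group over $\mathbb{K}$ with maximal torus $T$ and a Borel subgroup containing $T$; let $X=X(T)$ and $Y=Y(T)$ be the character and cocharacter lattices, $R\subset X$ the roots, $R^+$ the positive roots, $\Pi$ the simple roots, $\mathfrak g=\mathrm{Lie}(G)$, $\mathfrak h=\mathrm{Lie}(T)=\mathbb{K}\otimes_{\mathbb Z}Y$, and let $e_\alpha$ ($\alpha\in R$) be the root vectors of a Chevalley basis, so that $h_\alpha:=[e_\alpha,e_{-\alpha}]=1\otimes\alpha^\vee$. For $\mu\in X$ let $d\mu\in\mathfrak h^*$ be its differential. Assume that the derived subgroup of $G$ is simply connected, that $p$ is good for $G$, and that $\mathfrak g$ has a non-degenerate $G$-invariant bilinear form. Let $\chi\in\mathfrak g^*$ be in standard Levi form with associated subset $I\subseteq\Pi$: $\chi$ vanishes on $\mathfrak h$ and on $e_\alpha$ for $\alpha\in R^+$, and for $\alpha\in R^+$ one has $\chi(e_{-\alpha})=1$ if $\alpha\in I$ and $\chi(e_{-\alpha})=0$ otherwise. Put $R_I=R\cap\mathbb{Z}I$.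 For a subset $S\subseteq R$ for which $\mathfrak h$ and the $e_\alpha$, $\alpha\in S$, span a Lie subalgebra $\mathfrak g_S$ of $\mathfrak g$, put $U_S=U(\mathfrak g_S)/\langle e_\alpha^p-\chi(e_\alpha)^p\mid\alpha\in S\rangle$, and write $U_\chi=U_R$. \textbf{The categories.} Let $A$ be a commutative Noetherian algebra over $U(\mathfrak h)=S(\mathfrak h)$ with structure map $\pi$. The category $\mathcal C_A^S$ has as objects the $U_S\otimes_{\mathbb K} A$-modules $M$, finitely generated over $A$, with a decomposition into $A$-submodules $M=\bigoplus M_{\lambda+\mathbb{Z}I}^{d\mu}$ over all pairs $(\lambda+\mathbb{Z}I,d\mu)$ with $\lambda\in X$ and $\mu\in\lambda+\mathbb{Z}I+pX$, such that $hm=(\pi(h)+d\mu(h))m$ for $h\in\mathfrak h$, $m\in M_{\lambda+\mathbb{Z}I}^{d\mu}$, and $e_\alpha M_{\lambda+\mathbb{Z}I}^{d\mu}\subseteq M_{\lambda+\alpha+\mathbb{Z}I}^{d(\mu+\alpha)}$ for $\alpha\in S$; morphisms are the $U_S\otimes A$-linear maps that preserve the decompositions. This is an abelian category. Write $\mathcal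 C_A=\mathcal C_A^R$. For an $A$-algebra $A'$ (commutative and Noetherian) the functor $-\otimes_AA':\mathcal C_A^S\to\mathcal C_{A'}^S$ is extension of scalars. \textbf{The modules $Q^I_{A,\chi}(\lambda)$.} Suppose that $\pi(h_\alpha)=0$ for all $\alpha\in R_I$, and let $\lambda\in X$. Regard $\mathbb K$ as an $S(\mathfrak h)$-algebra with $\mathfrak h\mapsto 0$. Let $\mathbb{K}^\lambda\in\mathcal C_{\mathbb K}^{R_I\cap R^+}$ be $\mathbb K$ placed in weight $(\lambda+\mathbb{Z}I,d\lambda)$ with $e_\alpha$ acting by $0$, let $Z(\lambda)=U_{R_I}\otimes_{U_{R_I\cap R^+}}\mathbb{K}^\lambda\in\mathcal C_{\mathbb K}^{R_I}$, and let $Q(\lambda)$ be the projective cover of $Z(\lambda)$ in $\mathcal C_{\mathbb K}^{R_I}$. Let $Q_{A,I,\chi}(\lambda)\in\mathcal C_A^{R_I}$ be $Q(\lambda)\otimes_{\mathbb K}A$ with the same decomposition and the same action of the $e_\alpha$, $\alpha\in R_I$, and with $h\in\mathfrak h$ acting by $\pi(h)+d\mu(h)$ on the piece of index $(\nu+\mathbb{Z}I,d\mu)$.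 View it as an object of $\mathcal C_A^{R_I\cup R^+}$ by letting $e_\alpha$ act by $0$ for $\alpha\in R^+\setminus R_I$, and put $Q_{A,\chi}^I(\lambda)=U_\chi\otimes_{U_{R_I\cup R^+}}Q_{A,I,\chi}(\lambda)\in\mathcal C_A$, with the induced decomposition. An object of $\mathcal C_A$ has a \emph{$Q$-filtration} if it has a finite filtration in $\mathcal C_A$ all of whose sections are isomorphic to objects $Q_{A,\chi}^I(\lambda)$, $\lambda\in X$. \textbf{Proposition.} Let $\pi(h_\alpha)=0$ for all $\alpha\in R_I$. Let $M\in\mathcal C_A$ have a $Q$-filtration and let $N\in\mathcal C_A$ be projective as an $A$-module. Suppose that for all maximal ideals $\mathfrak m$ of $A$ and all $i>0$ $$\mathrm{Ext}^i_{\mathcal C_{A/\mathfrak m}}(M\otimes_AA/\mathfrak m,\;N\otimes_AA/\mathfrak m)=0.$$ Then: (1) $\mathrm{Hom}_{\mathcal C_A}(M,N)$ is projective as an $A$-module. (2) For all commutative Noetherian $A$-algebras $A'$ and all $i>0$, $\mathrm{Ext}^i_{\mathcal C_{A'}}(M\otimes_AA',N\otimes_AA')=0$. (3) For all commutative Noetherian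 $A$-algebras $A'$ the canonical map $\mathrm{Hom}_{\mathcal C_A}(M,N)\otimes_AA'\to\mathrm{Hom}_{\mathcal C_{A'}}(M\otimes_AA',N\otimes_AA')$, $f\otimes a\mapsto a\,(f\otimes\mathrm{id}_{A'})$, is an isomorphism. -/

import Mathlib

open CategoryTheory
open scoped TensorProduct

universe u

noncomputable section

/-! ### Gradings of modules through projections -/

namespace WGrading

variable {J A M N : Type*} [CommRing A] [AddCommGroup M] [Module A M] [AddCommGroup N] [Module A N]

theorem exists_proj (P : J → Submodule A M) (hi : iSupIndep P) (hs : ⨆ w, P w = ⊤) :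
    ∃ q : J → M →ₗ[A] M, (∀ w x, q w x ∈ P w) ∧ (∀ w, ∀ x ∈ P w, q w x = x) ∧
      (∀ v w, v ≠ w → ∀ x ∈ P v, q w x = 0) ∧
      (∀ x, ∃ s : Finset J, x = ∑ w ∈ s, q w x) := by
  classical
  have hint : DirectSum.IsInternal P :=
    (DirectSum.isInternal_submodule_iff_iSupIndep_and_iSup_eq_top P).2 ⟨hi, hs⟩
  let _ := hint.chooseDecomposition
  refine ⟨fun w => (P w).subtype ∘ₗ DirectSum.component A J (fun i => P i) w ∘ₗ
    (DirectSum.decomposeLinearEquiv P).toLinearMap, ?_, ?_, ?_, ?_⟩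
  · intro w x
    simp
  · intro w x hx
    exact DirectSum.decompose_of_mem_same P hx
  · intro v w hvw x hx
    exact DirectSum.decompose_of_mem_ne P hx hvw
  · intro x
    exact ⟨_, (DirectSum.sum_support_decompose P x).symm⟩

theorem indep_of_proj (P : J → Submodule A M) (q : J → M →ₗ[A] M)
    (h1 : ∀ w, ∀ x ∈ P w, q w x = x) (h2 : ∀ v w, v ≠ w → ∀ x ∈ P v, q w x = 0) :
    iSupIndep P := by
  intro w
  rw [Submodule.disjoint_def]
  intro x hx hx'
  rw [← h1 w x hx]
  have : (⨆ j, ⨆ (_ : j ≠ w), P j) ≤ LinearMap.ker (q w) :=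
    iSup_le fun j => iSup_le fun hj y hy => h2 j w hj y hy
  exact this hx'

theorem pow_comm (f : M →ₗ[A] N) (a : Module.End A M) (b : Module.End A N)
    (h : ∀ m, f (a m) = b (f m)) (n : ℕ) (m : M) : f ((a ^ n) m) = (b ^ n) (f m) := by
  induction n generalizing m with
  | zero => rfl
  | succ n ih => rw [pow_succ, pow_succ, Module.End.mul_apply, Module.End.mul_apply, ih, h]

end WGrading

/-! ### Lie algebras of connected reductive groups -/

/-- The Lie algebra `𝔥 = K ⊗ Y` of a torus with cocharacter lattice `Y`. -/
abbrev CartanAlg (K Y : Type*) [Field K] [AddCommGroup Y] : Type _ := K ⊗[ℤ] Y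

/-- The Lie algebra `𝔤` of a connected reductive group over `K` with a chosen maximal torus `T` and
Borel subgroup: `P` is the (reduced) root datum of the group with character lattice `X = X(T)` and
cocharacter lattice `Y = Y(T)`, `b` is the base given by the Borel subgroup, `h` is the inclusion of
`Lie T = K ⊗ Y`, and the `e α` are root vectors which form a Chevalley basis together with a basis
of `Y`. (`q = P.chainBotCoeff α β` is the largest `q` such that `β - q α` is a root.)
The Lie algebra of the reductive group with root datum `P` is the one with these relations. -/
structure ReductiveLie (K ι X Y 𝔤 : Type*) [Field K] [Finite ι] [AddCommGroup X] [AddCommGroup Y]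
    [LieRing 𝔤] [LieAlgebra K 𝔤] where
  P : RootPairing ι ℤ X Y
  isReduced : P.IsReduced
  b : P.Base
  h : CartanAlg K Y →ₗ[K] 𝔤
  e : ι → 𝔤
  bijective : Function.Bijective
    (LinearMap.coprod h (Finsupp.linearCombination K e) : CartanAlg K Y × (ι →₀ K) →ₗ[K] 𝔤)
  lie_h_h : ∀ x y, ⁅h x, h y⁆ = 0
  lie_h_e : ∀ (y : Y) (α : ι), ⁅h (1 ⊗ₜ y), e α⁆ = P.toLinearMap (P.root α) y • e α
  lie_e_neg : ∀ α β, P.root β = -P.root α → ⁅e α, e β⁆ = h (1 ⊗ₜ P.coroot α)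
  lie_e_e : ∀ α β γ, P.root α + P.root β = P.root γ →
    ⁅e α, e β⁆ = (P.chainBotCoeff α β + 1) • e γ ∨ ⁅e α, e β⁆ = -((P.chainBotCoeff α β + 1) • e γ)
  lie_e_e_zero : ∀ α β, P.root α + P.root β ≠ 0 → P.root α + P.root β ∉ Set.range P.root →
    ⁅e α, e β⁆ = 0

namespace ReductiveLie

variable {K ι X Y 𝔤 : Type*} [Field K] [Finite ι] [AddCommGroup X] [AddCommGroup Y]
  [LieRing 𝔤] [LieAlgebra K 𝔤] (D : ReductiveLie K ι X Y 𝔤)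

/-- The differential `dμ ∈ 𝔥*` of a character `μ`, with `dμ (c ⊗ y) = c ⟨μ, y⟩`. -/
def diff : X →+ Module.Dual K (CartanAlg K Y) where
  toFun μ := (TensorProduct.AlgebraTensorModule.rid ℤ K K).toLinearMap ∘ₗ
    (D.P.toLinearMap μ).baseChange K
  map_zero' := by ext; simp
  map_add' μ ν := by ext; simp

/-- The derived subgroup is simply connected: the coroot lattice is saturated in `Y`. -/
def SimplyConnectedDerived : Prop :=
  ∀ (y : Y) (n : ℤ), n ≠ 0 → n • y ∈ AddSubgroup.closure (Set.range D.P.coroot) →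
    y ∈ AddSubgroup.closure (Set.range D.P.coroot)

/-- `p` is good for the root system: it divides no non-zero coefficient of a root with respect to
the simple roots (equivalently, no coefficient of the highest root of a component). -/
def IsGoodPrime (p : ℕ) : Prop :=
  ∀ (α : ι) (c : ι → ℤ), D.P.root α = ∑ i ∈ D.b.support, c i • D.P.root i →
    ∀ i ∈ D.b.support, c i ≠ 0 → ¬ (p : ℤ) ∣ c i

/-- There is a non-degenerate invariant bilinear form on `𝔤`. Of the invariance under the group we
only ask the invariance under its maximal torus (first two conditions: weight spaces
whose weights do not add up to zero are orthogonal) and under its Lie algebra (last condition). -/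
def HasInvariantForm : Prop :=
  ∃ B : LinearMap.BilinForm K 𝔤, B.Nondegenerate ∧
    (∀ x α, B (D.h x) (D.e α) = 0 ∧ B (D.e α) (D.h x) = 0) ∧
    (∀ α β, D.P.root α + D.P.root β ≠ 0 → B (D.e α) (D.e β) = 0) ∧
    (∀ x y z, B ⁅x, y⁆ z = B x ⁅y, z⁆)

end ReductiveLie

/-- A linear form `χ` on `𝔤` in standard Levi form, with its set `I` of simple roots. -/
structure StdLevi {K ι X Y 𝔤 : Type*} [Field K] [Finite ι] [AddCommGroup X] [AddCommGroup Y]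
    [LieRing 𝔤] [LieAlgebra K 𝔤] (D : ReductiveLie K ι X Y 𝔤) where
  I : Set ι
  I_subset : I ⊆ D.b.support
  χ : Module.Dual K 𝔤
  χ_h : ∀ x, χ (D.h x) = 0
  χ_pos : ∀ α, D.b.IsPos α → χ (D.e α) = 0
  χ_neg_mem : ∀ α β, D.b.IsPos α → D.P.root β = -D.P.root α → α ∈ I → χ (D.e β) = 1
  χ_neg_not_mem : ∀ α β, D.b.IsPos α → D.P.root β = -D.P.root α → α ∉ I → χ (D.e β) = 0

namespace StdLevi

variable {K ι X Y 𝔤 : Type*} [Field K] [Finite ι] [AddCommGroup X] [AddCommGroup Y]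
  [LieRing 𝔤] [LieAlgebra K 𝔤] {D : ReductiveLie K ι X Y 𝔤} (L : StdLevi D)

/-- The subgroup `ℤI` of `X`. -/
def ZI : AddSubgroup X := AddSubgroup.closure (D.P.root '' L.I)

/-- `R_I = R ∩ ℤI`. -/
def RI : Set ι := {α | D.P.root α ∈ L.ZI}

/-- `R_I⁺ = R⁺ ∩ ℤI`; the corresponding subalgebra of `U_χ` is the algebra `U⁰U⁺` of `𝔤_I`. -/
def RIpos : Set ι := {α | D.P.root α ∈ L.ZI ∧ D.b.IsPos α}

/-- `R_I ∪ R⁺`, the roots of the parabolic subalgebra `𝔭 = 𝔤_I ⊕ 𝔲⁺`. -/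
def RP : Set ι := {α | D.P.root α ∈ L.ZI ∨ D.b.IsPos α}

theorem RIpos_subset_RI : L.RIpos ⊆ L.RI := fun _ h => h.1

theorem RI_subset_RP : L.RI ⊆ L.RP := fun _ h => Or.inl h

/-- `μ ↦ (μ + ℤI, dμ)`. -/
def wtHom : X →+ (X ⧸ L.ZI) × Module.Dual K (CartanAlg K Y) :=
  (QuotientAddGroup.mk' L.ZI).prod D.diff

/-- The pairs `(λ + ℤI, dμ)` with `μ ∈ λ + ℤI + pX`. As `d` kills `pX`, these are the pairs
`(γ + ℤI, dγ)` with `γ ∈ X`. -/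
abbrev Wt : Type _ := L.wtHom.range

/-- The pair `(μ + ℤI, dμ)`. -/
def wt : X →+ L.Wt := L.wtHom.rangeRestrict

/-- The Lie subalgebra `𝔤_S` of `𝔤` generated by `𝔥` and the `e α` with `α ∈ S`. Thus it is `𝔤`,
`𝔤_I`, `𝔭` and the Borel subalgebra of `𝔤_I` for `S` the set of all roots, `R_I`, `R_I ∪ R⁺` and
`R_I⁺` respectively. -/
def gS (_L : StdLevi D) (S : Set ι) : LieSubalgebra K 𝔤 :=
  LieSubalgebra.lieSpan K 𝔤 (Set.range D.h ∪ D.e '' S)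

theorem gS_mono {S T : Set ι} (hST : S ⊆ T) : L.gS S ≤ L.gS T :=
  LieSubalgebra.lieSpan_mono (Set.union_subset_union_right _ (Set.image_mono hST))

/-- The elements of `𝔥` in `𝔤_S`. -/
def hS (S : Set ι) (x : CartanAlg K Y) : L.gS S :=
  ⟨D.h x, LieSubalgebra.subset_lieSpan (Or.inl ⟨x, rfl⟩)⟩

/-- The root vectors in `𝔤_S`. -/
def eS {S : Set ι} (α : ι) (hα : α ∈ S) : L.gS S :=
  ⟨D.e α, LieSubalgebra.subset_lieSpan (Or.inr ⟨α, hα, rfl⟩)⟩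

attribute [local instance] LieRing.ofAssociativeRing

/-- The relations `e_α ^ p = χ(e_α) ^ p`, `α ∈ S`. -/
inductive URel (p : ℕ) (S : Set ι) :
    UniversalEnvelopingAlgebra K (L.gS S) → UniversalEnvelopingAlgebra K (L.gS S) → Prop
  | pow (α : ι) (hα : α ∈ S) : URel p S
      (UniversalEnvelopingAlgebra.ι K (L.eS α hα) ^ p)
      (algebraMap K _ (L.χ (D.e α) ^ p))

/-- The algebra `U(𝔤_S) / ⟨e_α ^ p - χ(e_α) ^ p | α ∈ S⟩`: it is `U_χ` when `S` is the set of all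
roots, `U^I` when `S = R_I` and `U^I U_I⁺` when `S = R_I ∪ R⁺`. -/
abbrev US (p : ℕ) (S : Set ι) : Type _ := RingQuot (L.URel p S)

/-- The canonical map `𝔤_S → U_S`. -/
def toUS (p : ℕ) (S : Set ι) (x : L.gS S) : L.US p S :=
  RingQuot.mkAlgHom K (L.URel p S) (UniversalEnvelopingAlgebra.ι K x)

/-- The canonical homomorphism `U_S → U_T` for `S ⊆ T`. -/
def inclUS (p : ℕ) {S T : Set ι} (hST : S ⊆ T) : L.US p S →ₐ[K] L.US p T :=
  RingQuot.liftAlgHom K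
    ⟨(RingQuot.mkAlgHom K (L.URel p T)).comp
      (UniversalEnvelopingAlgebra.lift K
        ((UniversalEnvelopingAlgebra.ι K).comp (LieSubalgebra.inclusion (L.gS_mono hST)))), by
      rintro _ _ ⟨α, hα⟩
      have := RingQuot.mkAlgHom_rel K (URel.pow (L := L) (p := p) α (hST hα))
      rw [map_pow, AlgHom.commutes] at this ⊢
      rw [AlgHom.comp_apply, UniversalEnvelopingAlgebra.lift_ι_apply]
      exact this⟩

end StdLevi

/-! ### The categories -/

section Cat

variable {K : Type u} {ι X Y 𝔤 : Type*} [Field K] [Finite ι] [AddCommGroup X] [AddCommGroup Y]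
  [LieRing 𝔤] [LieAlgebra K 𝔤] {D : ReductiveLie K ι X Y 𝔤}

/-- The objects of the category `𝒞_A` of `U_S ⊗ A`-modules, for the commutative algebra `A` over
`U⁰ = S(𝔥)` given by the linear map `π : 𝔥 → A`. A `U_S ⊗ A`-module is an `A`-module with an
`A`-linear representation `ρ` of `𝔤_S` for which `ρ (e_α) ^ p = χ (e_α) ^ p` if `α ∈ S`. The graded
pieces `M_{λ+ℤI}^{dμ}` are `piece w` with `w = (λ + ℤI, dμ)`, and `M_{λ+ℤI}` is the sum of the pieces
whose first component is `λ + ℤI`. Finite generation of `M` says that only finitely many of the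
`M_{λ+ℤI}` are non-zero and that each of these is finitely generated. -/
structure CMod (p : ℕ) (L : StdLevi D) (S : Set ι) (A : Type u) [CommRing A] [Algebra K A]
    (π : CartanAlg K Y →ₗ[K] A) where
  carrier : Type u
  [addCommGroup : AddCommGroup carrier]
  [module : Module A carrier]
  ρ : L.gS S →ₛₗ[algebraMap K A] Module.End A carrier
  ρ_lie : ∀ x y, ρ ⁅x, y⁆ = ρ x * ρ y - ρ y * ρ x
  ρ_pow : ∀ α (hα : α ∈ S) m, (ρ (L.eS α hα) ^ p) m = algebraMap K A (L.χ (D.e α) ^ p) • m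
  finite : Module.Finite A carrier
  piece : L.Wt → Submodule A carrier
  piece_indep : iSupIndep piece
  piece_span : ⨆ w, piece w = ⊤
  h_act : ∀ w, ∀ m ∈ piece w, ∀ x,
    ρ (L.hS S x) m = (π x + algebraMap K A (w.1.2 x)) • m
  e_act : ∀ α (hα : α ∈ S), ∀ w, ∀ m ∈ piece w,
    ρ (L.eS α hα) m ∈ piece (w + L.wt (D.P.root α))

namespace CMod

variable {p : ℕ} {L : StdLevi D} {S : Set ι} {A : Type u} [CommRing A] [Algebra K A]
  {π : CartanAlg K Y →ₗ[K] A}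

instance : CoeSort (CMod p L S A π) (Type u) := ⟨CMod.carrier⟩

instance (M : CMod p L S A π) : AddCommGroup M := M.addCommGroup

instance (M : CMod p L S A π) : Module A M := M.module

instance (M : CMod p L S A π) : Module.Finite A M := M.finite

/-- The morphisms `M → N`: the homomorphisms of `U_S ⊗ A`-modules that preserve the pieces. -/
def homs (M N : CMod p L S A π) : Submodule A (M →ₗ[A] N) where
  carrier := {f | (∀ x m, f (M.ρ x m) = N.ρ x (f m)) ∧ ∀ w, ∀ m ∈ M.piece w, f m ∈ N.piece w}
  zero_mem' := ⟨by simp, by simp⟩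
  add_mem' hf hg := ⟨fun x m => by simp [hf.1, hg.1],
    fun w m hm => add_mem (hf.2 w m hm) (hg.2 w m hm)⟩
  smul_mem' a f hf := ⟨fun x m => by simp [hf.1],
    fun w m hm => Submodule.smul_mem _ _ (hf.2 w m hm)⟩

instance : Category (CMod p L S A π) where
  Hom M N := homs M N
  id M := ⟨LinearMap.id, fun _ _ => rfl, fun _ _ h => h⟩
  comp f g := ⟨g.1 ∘ₗ f.1, fun x m => by simp [f.2.1, g.2.1],
    fun w m hm => g.2.2 w _ (f.2.2 w m hm)⟩

/-- The underlying linear map of a morphism. -/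
def lin {M N : CMod p L S A π} (f : M ⟶ N) : M →ₗ[A] N := Subtype.val f

/-- Constructor for morphisms. -/
def mkHom {M N : CMod p L S A π} (f : M →ₗ[A] N) (h1 : ∀ x m, f (M.ρ x m) = N.ρ x (f m))
    (h2 : ∀ w, ∀ m ∈ M.piece w, f m ∈ N.piece w) : M ⟶ N := ⟨f, h1, h2⟩

@[simp] theorem lin_mkHom {M N : CMod p L S A π} (f : M →ₗ[A] N) (h1 h2) :
    lin (mkHom f h1 h2 : M ⟶ N) = f := rfl

@[simp] theorem lin_id (M : CMod p L S A π) : lin (𝟙 M) = LinearMap.id := rfl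

@[simp] theorem lin_comp {M N Q : CMod p L S A π} (f : M ⟶ N) (g : N ⟶ Q) :
    lin (f ≫ g) = lin g ∘ₗ lin f := rfl

@[ext] theorem hom_ext {M N : CMod p L S A π} {f g : M ⟶ N} (h : ∀ m, lin f m = lin g m) :
    f = g := Subtype.ext (LinearMap.ext h)

theorem lin_ρ {M N : CMod p L S A π} (f : M ⟶ N) (x) (m : M) :
    lin f (M.ρ x m) = N.ρ x (lin f m) := f.2.1 x m

theorem lin_piece {M N : CMod p L S A π} (f : M ⟶ N) (w) (m : M) (hm : m ∈ M.piece w) :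
    lin f m ∈ N.piece w := f.2.2 w m hm

instance (M N : CMod p L S A π) : AddCommGroup (M ⟶ N) :=
  inferInstanceAs (AddCommGroup (homs M N))

instance (M N : CMod p L S A π) : Module A (M ⟶ N) := inferInstanceAs (Module A (homs M N))

@[simp] theorem lin_add {M N : CMod p L S A π} (f g : M ⟶ N) : lin (f + g) = lin f + lin g := rfl

@[simp] theorem lin_zero {M N : CMod p L S A π} : lin (0 : M ⟶ N) = 0 := rfl

@[simp] theorem lin_smul {M N : CMod p L S A π} (a : A) (f : M ⟶ N) :
    lin (a • f) = a • lin f := rfl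

instance : Preadditive (CMod p L S A π) where
  add_comp _ _ _ f f' g := by ext; simp
  comp_add _ _ _ f g g' := by ext; simp

instance : Linear A (CMod p L S A π) where
  smul_comp _ _ _ a f g := by ext; simp
  comp_smul _ _ _ f a g := by ext; simp

/-! #### Projections onto the pieces -/

/-- The projection onto a piece. -/
def proj (M : CMod p L S A π) : L.Wt → M →ₗ[A] M :=
  (WGrading.exists_proj M.piece M.piece_indep M.piece_span).choose

theorem proj_mem (M : CMod p L S A π) (w) (m : M) : M.proj w m ∈ M.piece w :=
  (WGrading.exists_proj M.piece M.piece_indep M.piece_span).choose_spec.1 w m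

theorem proj_same (M : CMod p L S A π) (w) (m : M) (h : m ∈ M.piece w) : M.proj w m = m :=
  (WGrading.exists_proj M.piece M.piece_indep M.piece_span).choose_spec.2.1 w m h

theorem proj_ne (M : CMod p L S A π) (v w) (hvw : v ≠ w) (m : M) (h : m ∈ M.piece v) :
    M.proj w m = 0 :=
  (WGrading.exists_proj M.piece M.piece_indep M.piece_span).choose_spec.2.2.1 v w hvw m h

theorem proj_sum (M : CMod p L S A π) (m : M) : ∃ s : Finset L.Wt, m = ∑ w ∈ s, M.proj w m :=
  (WGrading.exists_proj M.piece M.piece_indep M.piece_span).choose_spec.2.2.2 m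

theorem lin_proj {M N : CMod p L S A π} (f : M ⟶ N) (w) (m : M) :
    lin f (M.proj w m) = N.proj w (lin f m) := by
  have hm : m ∈ ⨆ w, M.piece w := by rw [M.piece_span]; trivial
  induction hm using Submodule.iSup_induction' with
  | mem v x hx =>
    by_cases hvw : v = w
    · subst hvw
      rw [proj_same _ _ _ hx, proj_same _ _ _ (lin_piece f _ _ hx)]
    · rw [proj_ne _ v w hvw _ hx, proj_ne _ v w hvw _ (lin_piece f _ _ hx), map_zero]
  | zero => simp
  | add x y _ _ hx hy => simp [hx, hy]

/-! #### Subobjects, quotients, sums -/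

/-- The object on a stable graded submodule. -/
def sub [IsNoetherianRing A] (M : CMod p L S A π) (N : Submodule A M)
    (hρ : ∀ x, ∀ m ∈ N, M.ρ x m ∈ N) (hp : ∀ w, ∀ m ∈ N, M.proj w m ∈ N) : CMod p L S A π where
  carrier := N
  ρ :=
    { toFun := fun x => (M.ρ x).restrict (hρ x)
      map_add' := fun x y => by ext; simp
      map_smul' := fun c x => by ext; simp }
  ρ_lie x y := by ext m; simp [M.ρ_lie]
  ρ_pow α hα m := Subtype.ext (by
    have := WGrading.pow_comm N.subtype ((M.ρ (L.eS α hα)).restrict (hρ _)) (M.ρ (L.eS α hα))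
      (fun _ => rfl) p m
    exact this.trans (M.ρ_pow α hα m))
  finite := inferInstance
  piece w := (M.piece w).comap N.subtype
  piece_indep := by
    refine WGrading.indep_of_proj _ (fun w => (M.proj w).restrict (hp w)) ?_ ?_
    · intro w x hx
      exact Subtype.ext (M.proj_same w x hx)
    · intro v w hvw x hx
      exact Subtype.ext (M.proj_ne v w hvw x hx)
  piece_span := by
    rw [eq_top_iff]
    intro x _
    obtain ⟨s, hs⟩ := M.proj_sum (x : M)
    have : x = ∑ w ∈ s, (M.proj w).restrict (hp w) x := Subtype.ext (by simpa using hs)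
    rw [this]
    exact Submodule.sum_mem _ fun w _ => Submodule.mem_iSup_of_mem w (M.proj_mem w x)
  h_act w m hm x := Subtype.ext (M.h_act w m hm x)
  e_act α hα w m hm := M.e_act α hα w m hm

/-- The object on the quotient by a stable graded submodule. -/
def quot (M : CMod p L S A π) (N : Submodule A M)
    (hρ : ∀ x, ∀ m ∈ N, M.ρ x m ∈ N) (hp : ∀ w, ∀ m ∈ N, M.proj w m ∈ N) : CMod p L S A π where
  carrier := M ⧸ N
  ρ :=
    { toFun := fun x => N.mapQ N (M.ρ x) (hρ x)
      map_add' := fun x y => by ext; simp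
      map_smul' := fun c x => by ext; simp }
  ρ_lie x y := by ext m; simp [M.ρ_lie]
  ρ_pow α hα := by
    intro m
    obtain ⟨m, rfl⟩ := N.mkQ_surjective m
    have := WGrading.pow_comm N.mkQ (M.ρ (L.eS α hα)) (N.mapQ N (M.ρ (L.eS α hα)) (hρ _))
      (fun _ => rfl) p m
    refine this.symm.trans ?_
    rw [M.ρ_pow α hα m, map_smul]
  finite := inferInstance
  piece w := (M.piece w).map N.mkQ
  piece_indep := by
    refine WGrading.indep_of_proj _ (fun w => N.mapQ N (M.proj w) (hp w)) ?_ ?_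
    · rintro w _ ⟨x, hx, rfl⟩
      simp [M.proj_same w x hx]
    · rintro v w hvw _ ⟨x, hx, rfl⟩
      simp [M.proj_ne v w hvw x hx]
  piece_span := by
    rw [← Submodule.map_iSup, M.piece_span, Submodule.map_top, Submodule.range_mkQ]
  h_act := by
    rintro w _ ⟨m, hm, rfl⟩ x
    simp [M.h_act w m hm x]
  e_act := by
    rintro α hα w _ ⟨m, hm, rfl⟩
    exact ⟨_, M.e_act α hα w m hm, by simp⟩

/-- The zero object. -/
def zeroObj : CMod p L S A π where
  carrier := PUnit
  ρ := 0
  ρ_lie x y := by ext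
  ρ_pow α hα m := rfl
  finite := inferInstance
  piece w := ⊤
  piece_indep := fun w => by rw [Submodule.disjoint_def]; intros; rfl
  piece_span := Subsingleton.elim _ _
  h_act w m hm x := rfl
  e_act α hα w m hm := trivial

/-- The direct sum of two objects. -/
def prod (M N : CMod p L S A π) : CMod p L S A π where
  carrier := M × N
  ρ :=
    { toFun := fun x => (M.ρ x).prodMap (N.ρ x)
      map_add' := fun x y => by ext <;> simp
      map_smul' := fun c x => by ext <;> simp }
  ρ_lie x y := by ext m <;> simp [M.ρ_lie, N.ρ_lie]
  ρ_pow α hα m := by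
    have h1 := WGrading.pow_comm (LinearMap.fst A M N)
      ((M.ρ (L.eS α hα)).prodMap (N.ρ (L.eS α hα))) (M.ρ (L.eS α hα)) (fun _ => rfl) p m
    have h2 := WGrading.pow_comm (LinearMap.snd A M N)
      ((M.ρ (L.eS α hα)).prodMap (N.ρ (L.eS α hα))) (N.ρ (L.eS α hα)) (fun _ => rfl) p m
    exact Prod.ext (h1.trans (M.ρ_pow α hα m.1)) (h2.trans (N.ρ_pow α hα m.2))
  finite := inferInstance
  piece w := (M.piece w).prod (N.piece w)
  piece_indep := by
    refine WGrading.indep_of_proj _ (fun w => (M.proj w).prodMap (N.proj w)) ?_ ?_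
    · rintro w ⟨x, y⟩ ⟨hx, hy⟩
      simp [M.proj_same w x hx, N.proj_same w y hy]
    · rintro v w hvw ⟨x, y⟩ ⟨hx, hy⟩
      simp [M.proj_ne v w hvw x hx, N.proj_ne v w hvw y hy]
  piece_span := by
    rw [eq_top_iff]
    rintro ⟨x, y⟩ -
    have hx : (x, (0 : N)) ∈ ⨆ w, (M.piece w).prod (N.piece w) := by
      obtain ⟨s, hs⟩ := M.proj_sum x
      have : (x, (0 : N)) = ∑ w ∈ s, (M.proj w x, (0 : N)) := by
        ext <;> simp [Prod.fst_sum, Prod.snd_sum, ← hs]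
      rw [this]
      exact Submodule.sum_mem _ fun w _ => Submodule.mem_iSup_of_mem w ⟨M.proj_mem w x, zero_mem _⟩
    have hy : ((0 : M), y) ∈ ⨆ w, (M.piece w).prod (N.piece w) := by
      obtain ⟨s, hs⟩ := N.proj_sum y
      have : ((0 : M), y) = ∑ w ∈ s, ((0 : M), N.proj w y) := by
        ext <;> simp [Prod.fst_sum, Prod.snd_sum, ← hs]
      rw [this]
      exact Submodule.sum_mem _ fun w _ => Submodule.mem_iSup_of_mem w ⟨zero_mem _, N.proj_mem w y⟩
    simpa using add_mem hx hy
  h_act := by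
    rintro w ⟨m, n⟩ ⟨hm, hn⟩ x
    exact Prod.ext (M.h_act w m hm x) (N.h_act w n hn x)
  e_act := by
    rintro α hα w ⟨m, n⟩ ⟨hm, hn⟩
    exact ⟨M.e_act α hα w m hm, N.e_act α hα w n hn⟩

/-! #### The category is abelian -/

section Abelian

open Limits

theorem mono_of_inj {M N : CMod p L S A π} (f : M ⟶ N) (h : Function.Injective (lin f)) :
    Mono f := ⟨fun g g' hg => by
  ext m
  exact h (congrArg (fun k => lin k m) hg)⟩

theorem epi_of_surj {M N : CMod p L S A π} (f : M ⟶ N) (h : Function.Surjective (lin f)) :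
    Epi f := ⟨fun g g' hg => by
  ext m
  obtain ⟨m, rfl⟩ := h m
  exact congrArg (fun k => lin k m) hg⟩

/-- The kernel of a morphism. -/
def ker [IsNoetherianRing A] {M N : CMod p L S A π} (f : M ⟶ N) : CMod p L S A π :=
  M.sub (LinearMap.ker (lin f))
    (fun x m hm => by
      rw [LinearMap.mem_ker] at hm ⊢
      rw [lin_ρ, hm, map_zero])
    (fun w m hm => by
      rw [LinearMap.mem_ker] at hm ⊢
      rw [lin_proj, hm, map_zero])

/-- The inclusion of the kernel. -/
def kerι [IsNoetherianRing A] {M N : CMod p L S A π} (f : M ⟶ N) : ker f ⟶ M :=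
  mkHom (LinearMap.ker (lin f)).subtype (fun _ _ => rfl) (fun _ _ h => h)

theorem kerι_comp [IsNoetherianRing A] {M N : CMod p L S A π} (f : M ⟶ N) : kerι f ≫ f = 0 := by
  ext m
  exact m.2

/-- The universal property of the kernel. -/
def kerIsLimit [IsNoetherianRing A] {M N : CMod p L S A π} (f : M ⟶ N) :
    IsLimit (KernelFork.ofι (kerι f) (kerι_comp f)) :=
  KernelFork.IsLimit.ofι _ _
    (fun {W} g hg => mkHom ((lin g).codRestrict _ fun m => congrArg (fun k => lin k m) hg)
      (fun x m => Subtype.ext (lin_ρ g x m)) (fun w m hm => lin_piece g w m hm))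
    (fun _ _ => rfl)
    (fun g hg k hk => by
      ext m
      exact Subtype.ext (congrArg (fun k => lin k m) hk))

/-- The cokernel of a morphism. -/
def coker {M N : CMod p L S A π} (f : M ⟶ N) : CMod p L S A π :=
  N.quot (LinearMap.range (lin f))
    (by rintro x _ ⟨m, rfl⟩; exact ⟨_, lin_ρ f x m⟩)
    (by rintro w _ ⟨m, rfl⟩; exact ⟨_, lin_proj f w m⟩)

/-- The projection to the cokernel. -/
def cokerπ {M N : CMod p L S A π} (f : M ⟶ N) : N ⟶ coker f :=
  mkHom (LinearMap.range (lin f)).mkQ (fun _ _ => rfl) (fun _ m h => ⟨m, h, rfl⟩)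

theorem comp_cokerπ {M N : CMod p L S A π} (f : M ⟶ N) : f ≫ cokerπ f = 0 := by
  ext m
  exact (Submodule.Quotient.mk_eq_zero _).2 ⟨m, rfl⟩

/-- The universal property of the cokernel. -/
def cokerIsColimit {M N : CMod p L S A π} (f : M ⟶ N) :
    IsColimit (CokernelCofork.ofπ (cokerπ f) (comp_cokerπ f)) :=
  CokernelCofork.IsColimit.ofπ _ _
    (fun {W} g hg => mkHom ((LinearMap.range (lin f)).liftQ (lin g)
        (by rintro _ ⟨m, rfl⟩; exact congrArg (fun k => lin k m) hg))
      (by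
        intro x m
        obtain ⟨m, rfl⟩ := (LinearMap.range (lin f)).mkQ_surjective m
        exact lin_ρ g x m)
      (by
        rintro w _ ⟨m, hm, rfl⟩
        exact lin_piece g w m hm))
    (fun _ _ => rfl)
    (fun g hg k hk => by
      ext m
      obtain ⟨m, rfl⟩ := (LinearMap.range (lin f)).mkQ_surjective m
      exact congrArg (fun k => lin k m) hk)

theorem inj_of_mono [IsNoetherianRing A] {M N : CMod p L S A π} (f : M ⟶ N) [Mono f] :
    Function.Injective (lin f) := by
  rw [injective_iff_map_eq_zero]
  intro m hm
  have h0 : kerι f = 0 := (cancel_mono f).1 (by rw [kerι_comp, zero_comp])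
  exact congrArg (fun k : ker f ⟶ M => lin k ⟨m, hm⟩) h0

theorem surj_of_epi {M N : CMod p L S A π} (f : M ⟶ N) [Epi f] :
    Function.Surjective (lin f) := by
  intro n
  have h0 : cokerπ f = 0 := (cancel_epi f).1 (by rw [comp_cokerπ, comp_zero])
  have : (LinearMap.range (lin f)).mkQ n = 0 := congrArg (fun k : N ⟶ coker f => lin k n) h0
  exact (Submodule.Quotient.mk_eq_zero _).1 this

/-- A monomorphism is the kernel of its cokernel. -/
@[reducible] def normalMono [IsNoetherianRing A] {M N : CMod p L S A π} (f : M ⟶ N) [Mono f] :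
    NormalMono f where
  Z := coker f
  g := cokerπ f
  w := comp_cokerπ f
  isLimit :=
    let φ : M ≃ₗ[A] LinearMap.range (lin f) := LinearEquiv.ofInjective (lin f) (inj_of_mono f)
    have hφ : ∀ y, lin f (φ.symm y) = y := fun y => congrArg Subtype.val (φ.apply_symm_apply y)
    KernelFork.IsLimit.ofι _ _
      (fun {W} g hg => mkHom
        (φ.symm.toLinearMap ∘ₗ (lin g).codRestrict (LinearMap.range (lin f)) (fun m =>
          (Submodule.Quotient.mk_eq_zero _).1 (congrArg (fun k => lin k m) hg)))
        (fun x m => inj_of_mono f (by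
          rw [lin_ρ]
          simp only [LinearMap.coe_comp, LinearEquiv.coe_coe, Function.comp_apply, hφ]
          exact lin_ρ g x m))
        (fun w m hm => by
          have h1 : lin f (φ.symm ((lin g).codRestrict (LinearMap.range (lin f)) (fun m =>
            (Submodule.Quotient.mk_eq_zero _).1 (congrArg (fun k => lin k m) hg)) m)) = lin g m :=
            hφ _
          have h2 := lin_proj f w (φ.symm ((lin g).codRestrict (LinearMap.range (lin f)) (fun m =>
            (Submodule.Quotient.mk_eq_zero _).1 (congrArg (fun k => lin k m) hg)) m))
          rw [h1, proj_same _ _ _ (lin_piece g w m hm), ← h1] at h2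
          have h3 := inj_of_mono f h2
          change φ.symm _ ∈ _
          rw [← h3]
          exact proj_mem _ _ _))
      (fun g hg => by
        ext m
        exact hφ _)
      (fun g hg k hk => (cancel_mono f).1 (by
        rw [hk]
        ext m
        refine Eq.symm ?_
        exact hφ _))

/-- An epimorphism is the cokernel of its kernel. -/
@[reducible] def normalEpi [IsNoetherianRing A] {M N : CMod p L S A π} (f : M ⟶ N) [Epi f] :
    NormalEpi f where
  W := ker f
  g := kerι f
  w := kerι_comp f
  isColimit :=
    have hf := surj_of_epi f
    let φ : (M ⧸ LinearMap.ker (lin f)) ≃ₗ[A] N :=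
      LinearMap.quotKerEquivOfSurjective (lin f) hf
    have hφ : ∀ m, φ.symm (lin f m) = (LinearMap.ker (lin f)).mkQ m := fun m => by
      rw [LinearEquiv.symm_apply_eq]
      rfl
    CokernelCofork.IsColimit.ofπ _ _
      (fun {W} g hg =>
        have hg' : LinearMap.ker (lin f) ≤ LinearMap.ker (lin g) :=
          fun m hm => congrArg (fun k : ker f ⟶ W => lin k ⟨m, hm⟩) hg
        have key : ∀ m, ((LinearMap.ker (lin f)).liftQ (lin g) hg' ∘ₗ φ.symm.toLinearMap)
            (lin f m) = lin g m := fun m => by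
          simp only [LinearMap.coe_comp, LinearEquiv.coe_coe, Function.comp_apply, hφ]
          rfl
        mkHom ((LinearMap.ker (lin f)).liftQ (lin g) hg' ∘ₗ φ.symm.toLinearMap)
          (fun x n => by
            obtain ⟨m, rfl⟩ := hf n
            rw [← lin_ρ, key, key, lin_ρ])
          (fun w n hn => by
            obtain ⟨m, rfl⟩ := hf n
            rw [← proj_same _ _ _ hn, ← lin_proj, key]
            exact lin_piece g w _ (proj_mem _ _ _)))
      (fun g hg => by
        ext m
        simp only [lin_comp, lin_mkHom, LinearMap.coe_comp, LinearEquiv.coe_coe,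
          Function.comp_apply, hφ]
        rfl)
      (fun g hg k hk => (cancel_epi f).1 (by
        rw [hk]
        ext m
        simp only [lin_comp, lin_mkHom, LinearMap.coe_comp, LinearEquiv.coe_coe,
          Function.comp_apply, hφ]
        rfl))

theorem zeroObj_isZero : IsZero (zeroObj : CMod p L S A π) := by
  rw [IsZero.iff_id_eq_zero]
  ext
  rfl

instance : HasZeroObject (CMod p L S A π) := ⟨⟨zeroObj, zeroObj_isZero⟩⟩

/-- The direct sum as a bicone. -/
def prodBicone (M N : CMod p L S A π) : BinaryBicone M N where
  pt := M.prod N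
  fst := mkHom (LinearMap.fst A M N) (fun _ _ => rfl) (fun _ _ h => h.1)
  snd := mkHom (LinearMap.snd A M N) (fun _ _ => rfl) (fun _ _ h => h.2)
  inl := mkHom (LinearMap.inl A M N) (fun x _ => Prod.ext rfl (map_zero (N.ρ x)).symm)
    (fun _ _ h => ⟨h, zero_mem _⟩)
  inr := mkHom (LinearMap.inr A M N) (fun x _ => Prod.ext (map_zero (M.ρ x)).symm rfl)
    (fun _ _ h => ⟨zero_mem _, h⟩)
  inl_fst := rfl
  inl_snd := rfl
  inr_fst := rfl
  inr_snd := rfl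

instance : HasBinaryBiproducts (CMod p L S A π) where
  has_binary_biproduct M N := HasBinaryBiproduct.mk
    ⟨prodBicone M N, isBinaryBilimitOfTotal _ (by
      ext m
      exact Prod.ext (add_zero (Prod.fst (α := M) (β := N) m))
        (zero_add (Prod.snd (α := M) (β := N) m)))⟩

instance : HasFiniteProducts (CMod p L S A π) :=
  hasFiniteProducts_of_has_binary_and_terminal

instance [IsNoetherianRing A] : HasKernels (CMod p L S A π) :=
  ⟨fun f => ⟨⟨⟨_, kerIsLimit f⟩⟩⟩⟩

instance : HasCokernels (CMod p L S A π) :=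
  ⟨fun f => ⟨⟨⟨_, cokerIsColimit f⟩⟩⟩⟩

instance [IsNoetherianRing A] : CategoryTheory.Abelian (CMod p L S A π) where
  normalMonoOfMono f _ := ⟨normalMono f⟩
  normalEpiOfEpi f _ := ⟨normalEpi f⟩

end Abelian

/-- `Ext^i(M, N) = 0` in the abelian category of objects. -/
def ExtVanishes [IsNoetherianRing A] (M N : CMod p L S A π) (i : ℕ) : Prop :=
  haveI := HasExt.standard (CMod p L S A π)
  Subsingleton (Abelian.Ext M N i)

/-! #### Restriction, extension of scalars, induction -/

/-- The restriction of an object to a smaller set of roots. -/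
def res {T : Set ι} (hST : S ⊆ T) (M : CMod p L T A π) : CMod p L S A π where
  carrier := M
  ρ := M.ρ.comp (LieSubalgebra.inclusion (L.gS_mono hST) : L.gS S →ₗ[K] L.gS T)
  ρ_lie x y := M.ρ_lie (LieSubalgebra.inclusion (L.gS_mono hST) x)
    (LieSubalgebra.inclusion (L.gS_mono hST) y)
  ρ_pow α hα := M.ρ_pow α (hST hα)
  finite := M.finite
  piece := M.piece
  piece_indep := M.piece_indep
  piece_span := M.piece_span
  h_act w m hm x := M.h_act w m hm x
  e_act α hα := M.e_act α (hST hα)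

/-- The structure map `𝔥 → A → A'` of an `A`-algebra `A'`. -/
def bcπ (A' : Type u) [CommRing A'] [Algebra K A'] [Algebra A A'] [IsScalarTower K A A']
    (π : CartanAlg K Y →ₗ[K] A) : CartanAlg K Y →ₗ[K] A' :=
  (IsScalarTower.toAlgHom K A A').toLinearMap ∘ₗ π

section BaseChange

variable (A' : Type u) [CommRing A'] [Algebra K A'] [Algebra A A'] [IsScalarTower K A A']

/-- Extension of scalars `M ⊗_A A'`. -/
def baseChange (M : CMod p L S A π) : CMod p L S A' (bcπ A' π) where
  carrier := A' ⊗[A] M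
  ρ :=
    { toFun := fun x => (M.ρ x).baseChange A'
      map_add' := fun x y => by rw [map_add, LinearMap.baseChange_add]
      map_smul' := fun c x => by
        ext m
        simp [IsScalarTower.algebraMap_apply K A A', TensorProduct.smul_tmul', Algebra.smul_def] }
  ρ_lie x y := by
    ext m
    simp [M.ρ_lie]
  ρ_pow α hα m := by
    simp only [LinearMap.coe_mk, AddHom.coe_mk, ← LinearMap.baseChange_pow]
    induction m with
    | zero => simp
    | add x y hx hy => simp only [map_add, smul_add, hx, hy]
    | tmul a m =>
      rw [LinearMap.baseChange_tmul, M.ρ_pow, IsScalarTower.algebraMap_apply K A A',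
        algebraMap_smul A', TensorProduct.tmul_smul]
  finite := inferInstance
  piece w := (M.piece w).baseChange A'
  piece_indep := by
    refine WGrading.indep_of_proj _ (fun w => (M.proj w).baseChange A') ?_ ?_
    · intro w x hx
      rw [Submodule.baseChange_eq_span] at hx
      induction hx using Submodule.span_induction with
      | mem x hx =>
        obtain ⟨m, hm, rfl⟩ := hx
        simp [M.proj_same w m hm]
      | zero => simp
      | add x y _ _ hx hy => rw [map_add, hx, hy]
      | smul a x _ hx => rw [map_smul, hx]
    · intro v w hvw x hx
      rw [Submodule.baseChange_eq_span] at hx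
      induction hx using Submodule.span_induction with
      | mem x hx =>
        obtain ⟨m, hm, rfl⟩ := hx
        simp [M.proj_ne v w hvw m hm]
      | zero => simp
      | add x y _ _ hx hy => rw [map_add, hx, hy, add_zero]
      | smul a x _ hx => rw [map_smul, hx, smul_zero]
  piece_span := by
    rw [eq_top_iff]
    intro x _
    induction x with
    | zero => exact zero_mem _
    | add x y hx hy => exact add_mem (hx trivial) (hy trivial)
    | tmul a m =>
      obtain ⟨s, hs⟩ := M.proj_sum m
      rw [hs, TensorProduct.tmul_sum]
      exact Submodule.sum_mem _ fun w _ => Submodule.mem_iSup_of_mem w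
        (Submodule.tmul_mem_baseChange_of_mem a (M.proj_mem w m))
  h_act w m hm x := by
    rw [Submodule.baseChange_eq_span] at hm
    induction hm using Submodule.span_induction with
    | mem y hy =>
      obtain ⟨m, hm, rfl⟩ := hy
      simp only [LinearMap.coe_mk, AddHom.coe_mk, TensorProduct.mk_apply,
        LinearMap.baseChange_tmul, M.h_act w m hm x]
      rw [TensorProduct.tmul_smul, ← algebraMap_smul A', map_add,
        ← IsScalarTower.algebraMap_apply]
      rfl
    | zero => simp
    | add y z _ _ hy hz => rw [map_add, hy, hz, smul_add]
    | smul a y _ hy => rw [map_smul, hy, smul_comm]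
  e_act α hα w m hm := by
    rw [Submodule.baseChange_eq_span] at hm
    induction hm using Submodule.span_induction with
    | mem y hy =>
      obtain ⟨m, hm, rfl⟩ := hy
      exact Submodule.tmul_mem_baseChange_of_mem 1 (M.e_act α hα w m hm)
    | zero => rw [map_zero]; exact zero_mem _
    | add y z _ _ hy hz => rw [map_add]; exact add_mem hy hz
    | smul a y _ hy => rw [map_smul]; exact Submodule.smul_mem _ _ hy

theorem baseChange_ρ {M N : CMod p L S A π} (f : M ⟶ N) (x) (m : A' ⊗[A] M) :
    (lin f).baseChange A' ((M.ρ x).baseChange A' m) =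
      (N.ρ x).baseChange A' ((lin f).baseChange A' m) := by
  induction m with
  | zero => simp
  | add y z hy hz => simp only [map_add, hy, hz]
  | tmul a m => simp [lin_ρ]

theorem baseChange_piece {M N : CMod p L S A π} (f : M ⟶ N) (w) (m : A' ⊗[A] M)
    (hm : m ∈ (M.piece w).baseChange A') :
    (lin f).baseChange A' m ∈ (N.piece w).baseChange A' := by
  rw [Submodule.baseChange_eq_span] at hm
  induction hm using Submodule.span_induction with
  | mem y hy =>
    obtain ⟨m, hm, rfl⟩ := hy
    exact Submodule.tmul_mem_baseChange_of_mem 1 (lin_piece f w m hm)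
  | zero => rw [map_zero]; exact zero_mem _
  | add y z _ _ hy hz => rw [map_add]; exact add_mem hy hz
  | smul a y _ hy => rw [map_smul]; exact Submodule.smul_mem _ _ hy

/-- Extension of scalars on morphisms, `f ↦ f ⊗ id`. -/
def baseChangeMap {M N : CMod p L S A π} (f : M ⟶ N) : M.baseChange A' ⟶ N.baseChange A' :=
  mkHom ((lin f).baseChange A') (baseChange_ρ A' f) (baseChange_piece A' f)

end BaseChange

attribute [local instance] LieRing.ofAssociativeRing in
/-- The action of `U_S` on an object. -/
def act (M : CMod p L S A π) : L.US p S →+* Module.End A M :=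
  letI : Algebra K (Module.End A M) :=
    ((algebraMap A (Module.End A M)).comp (algebraMap K A)).toAlgebra' fun c f => by
      ext m; simp
  (RingQuot.liftAlgHom K
    ⟨UniversalEnvelopingAlgebra.lift K
      { toFun := M.ρ
        map_add' := map_add _
        map_smul' := fun c x => by
          rw [LinearMap.map_smulₛₗ, Algebra.smul_def, Algebra.smul_def]; rfl
        map_lie' := fun {x y} => M.ρ_lie x y }, by
      rintro _ _ ⟨α, hα⟩
      ext m
      rw [map_pow, UniversalEnvelopingAlgebra.lift_ι_apply, AlgHom.commutes]
      exact M.ρ_pow α hα m⟩ : L.US p S →ₐ[K] Module.End A M).toRingHom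

/-- The map `U_T ⊗_ℤ M → G`, `u ⊗ m ↦ u • i m`. -/
def indMap {T : Set ι} (hST : S ⊆ T) {M : CMod p L S A π} {G : CMod p L T A π}
    (i : M ⟶ G.res hST) : L.US p T ⊗[ℤ] M →ₗ[ℤ] G :=
  TensorProduct.lift (LinearMap.mk₂ ℤ (fun u m => G.act u (show G from lin i m))
    (fun u v m => by rw [map_add]; rfl)
    (fun n u m => by rw [map_zsmul]; rfl)
    (fun u m m' => by rw [map_add]; exact map_add (G.act u) _ _)
    (fun n u m => by rw [map_zsmul]; exact map_zsmul (G.act u) _ _))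

/-- For `S ⊆ T`, `M` an object for `S` and `G` an object for `T`: the object `G` is the induced object
`U_T ⊗_{U_S} M`. That is, there is a morphism `i` from `M` to the restriction of `G` such that
`u ⊗ m ↦ u • i m` induces a bijection with `G` of `U_T ⊗_{U_S} M`, the quotient of `U_T ⊗_ℤ M` by
the elements `u b ⊗ m - u ⊗ b m` with `b ∈ U_S`. (As `i` respects the pieces, the piece of `G` of
weight `w` is then the sum of the images of the `(U_T)_v ⊗ M_{w - v}`.) -/
def IsInduced {T : Set ι} (hST : S ⊆ T) (M : CMod p L S A π) (G : CMod p L T A π) : Prop :=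
  ∃ i : M ⟶ G.res hST, Function.Surjective (indMap hST i) ∧
    LinearMap.ker (indMap hST i) = Submodule.span ℤ
      {t | ∃ (u : L.US p T) (b : L.US p S) (m : M),
        t = (u * L.inclUS p hST b) ⊗ₜ[ℤ] m - u ⊗ₜ[ℤ] (M.act b m)}

/-- `N` is isomorphic to `A^μ`: it is free of rank one over `A`, is concentrated in
weight `(μ + ℤI, dμ)`, and the root vectors act on it by zero. -/
def IsCharacter (μ : X) (N : CMod p L S A π) : Prop :=
  ∃ v ∈ N.piece (L.wt μ), Function.Bijective (fun a : A => a • v) ∧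
    ∀ α (hα : α ∈ S), N.ρ (L.eS α hα) v = 0

/-- `Z` is isomorphic to the baby Verma module `Z_{A,I,χ}(μ)` for `𝔤_I`, which is induced
from `A^μ`. -/
def IsBabyVermaI (μ : X) (Z : CMod p L L.RI A π) : Prop :=
  ∃ N : CMod p L L.RIpos A π, N.IsCharacter μ ∧ IsInduced L.RIpos_subset_RI N Z

/-- `N` is isomorphic to `Θ(M)`: it has the same `A`-module structure, the same pieces and the same
action of the root vectors as `M`, while `𝔥` acts in the way required by the other structure map. -/
def IsTheta {π' : CartanAlg K Y →ₗ[K] A} (M : CMod p L S A π') (N : CMod p L S A π) : Prop :=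
  ∃ φ : M ≃ₗ[A] N, (∀ w m, m ∈ M.piece w ↔ φ m ∈ N.piece w) ∧
    ∀ α (hα : α ∈ S) m, φ (M.ρ (L.eS α hα) m) = N.ρ (L.eS α hα) (φ m)

/-- The object `N` for `𝔭 = 𝔤_I ⊕ 𝔲⁺` is the object `M` for `𝔤_I` on which `𝔲⁺` acts by zero. -/
def IsInflation (M : CMod p L L.RI A π) (N : CMod p L L.RP A π) : Prop :=
  Nonempty (N.res L.RI_subset_RP ≅ M) ∧
    ∀ α (hα : α ∈ L.RP), α ∉ L.RI → ∀ n, N.ρ (L.eS α hα) n = 0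

end CMod

/-- A projective cover: an epimorphism from a projective object that is essential. -/
structure IsProjectiveCover {C : Type*} [Category C] {Q Z : C} (f : Q ⟶ Z) : Prop where
  projective : Projective Q
  epi : Epi f
  essential : ∀ {W : C} (g : W ⟶ Q), Epi (g ≫ f) → Epi g

namespace CMod

variable {p : ℕ} {L : StdLevi D} {A : Type u} [CommRing A] [Algebra K A]
  {π : CartanAlg K Y →ₗ[K] A}

/-- `N` is isomorphic to `Q_{A,I,χ}(μ) = Θ_A(Q ⊗_K A)`, where `Q` is the projective cover of the baby
Verma module `Z_{K,I,χ}(μ)` for `𝔤_I` over `K` (with structure map zero on `𝔥`). -/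
def IsQLevi (μ : X) (N : CMod p L L.RI A π) : Prop :=
  ∃ (Z Q : CMod p L L.RI K 0) (f : Q ⟶ Z),
    Z.IsBabyVermaI μ ∧ IsProjectiveCover f ∧ (Q.baseChange A).IsTheta N

/-- `G` is isomorphic to `Q_{A,χ}^I(μ) = Γ_{A,χ}(Q_{A,I,χ}(μ)) = U_χ ⊗_{U^I U_I⁺} Q_{A,I,χ}(μ)`. -/
def IsQI (μ : X) (G : CMod p L Set.univ A π) : Prop :=
  ∃ (N : CMod p L L.RI A π) (N' : CMod p L L.RP A π),
    N.IsQLevi μ ∧ N.IsInflation N' ∧ IsInduced (Set.subset_univ L.RP) N' G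

/-- `M` has a finite filtration in `𝒞_A` whose sections are of the form `Q_{A,χ}^I(μ)`. -/
inductive HasQFiltration : CMod p L Set.univ A π → Prop
  | zero (M) (hM : Limits.IsZero M) : HasQFiltration M
  | step (T : ShortComplex (CMod p L Set.univ A π)) (hT : T.ShortExact)
      (h₁ : HasQFiltration T.X₁) (μ : X) (h₃ : T.X₃.IsQI μ) : HasQFiltration T.X₂

end CMod
end Cat
end

/-! The filtration enters through one consequence: `M` is projective over `A`. Each section is
induced from an `A`-module that is extended from the field `K`, and `U_χ` is a free right module of
finite rank over the algebra of the parabolic. So a section is, over `A`, a finite direct sum of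
copies of a projective module (`projective_of_isInduced`, `projective_of_hasQFiltration`). The
freeness is a Poincaré–Birkhoff–Witt statement: ordered monomials form a basis of the enveloping
algebra, `(ad e_α)^p = 0` makes `e_α^p` central, and hence the exponents of the root vectors can be
truncated below `p` (`linearIndependent_truncated`, `exists_free_US`).

The same basis over `U(𝔥)` yields enough projectives. Inducing a rank one module of weight `w` from
`𝔥` gives an object `P`, free over `A`, with `Hom(P, N) = N_w` (`IsFreeOn.homEquiv`). A piece is a
direct summand of `N`, so `Hom(P, N)` is projective over `A` and commutes with every extension of
scalars (`IsFreeOn.bijective_homBaseChange`). That `P` has pieces at all requires a weight grading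
of `U_χ`; it exists because `p • wt(α) = 0` whenever `χ(e_α) ≠ 0` (`nsmul_wt_eq_zero`).

Now resolve `M` by free objects `P₂ → P₁ → P₀ → M`. As `M` is projective over `A`, the kernels are
`A`-direct summands and the resolution stays exact over every `A'`. With the finite projective
modules `Cᵢ = Hom(Pᵢ, N)`, the vanishing of `Ext¹` over `A'` means exactness of `C ⊗ A'` at `C₁`
(`extVanishes_one_iff_exact`). Exactness modulo all maximal ideals forces a contraction of `C` at
`C₁`, by the residue field criterion for split injections (`exists_contraction`). A contraction
consists of linear maps, so it survives any extension of scalars. It gives `Ext¹ = 0` over `A'`,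
makes `Hom(M, N) = ker(C₀ → C₁)` a direct summand of `C₀`, and shows that this kernel commutes with
base change (`hom_of_extVanishes_one`). Higher degrees follow by dimension shifting, since the
kernel of a free cover of `M` is again projective over `A` (`extVanishes_baseChange`). -/

noncomputable section

set_option linter.unusedSectionVars false

/-! ### The Poincaré–Birkhoff–Witt theorem -/

namespace PBW

section Operators

variable {k 𝔩 I : Type*} [CommRing k] [LieRing 𝔩] [LieAlgebra k 𝔩] [LinearOrder I]

/-- The monomial of a multiset in the symmetric algebra, as a basis vector of a free module. -/
abbrev sym (k : Type*) [CommRing k] {I : Type*} (s : Multiset I) : Multiset I →₀ k :=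
  Finsupp.single s 1

/-- The span of the monomials of degree at most `n`. -/
def degLE (k I : Type*) [CommRing k] (n : ℕ) : Submodule k (Multiset I →₀ k) :=
  Submodule.span k (sym k '' {s | s.card ≤ n})

theorem sym_mem_degLE {s : Multiset I} {n : ℕ} (h : s.card ≤ n) : sym k s ∈ degLE k I n :=
  Submodule.subset_span ⟨s, h, rfl⟩

theorem degLE_mono {m n : ℕ} (h : m ≤ n) : degLE k I m ≤ degLE k I n :=
  Submodule.span_mono (Set.image_mono fun _ hs => le_trans hs h)

theorem map_mem_of_mem_degLE {M : Type*} [AddCommGroup M] [Module k M] {n : ℕ}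
    (T : (Multiset I →₀ k) →ₗ[k] M) (W : Submodule k M)
    (h : ∀ s : Multiset I, s.card ≤ n → T (sym k s) ∈ W) {v} (hv : v ∈ degLE k I n) : T v ∈ W := by
  have : degLE k I n ≤ W.comap T := Submodule.span_le.2 (by rintro _ ⟨s, hs, rfl⟩; exact h s hs)
  exact this hv

theorem map_eq_of_mem_degLE {M : Type*} [AddCommGroup M] [Module k M] {n : ℕ}
    (T T' : (Multiset I →₀ k) →ₗ[k] M)
    (h : ∀ s : Multiset I, s.card ≤ n → T (sym k s) = T' (sym k s)) {v} (hv : v ∈ degLE k I n) :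
    T v = T' v := by
  have := map_mem_of_mem_degLE (T - T') ⊥ (fun s hs => by simp [h s hs]) hv
  simpa [sub_eq_zero] using this

variable (b : Module.Basis I k 𝔩)

/-- Improves operators that are correct in degrees below `n` to degree `n`. -/
def step (T : I → (Multiset I →₀ k) →ₗ[k] (Multiset I →₀ k)) (i : I) :
    (Multiset I →₀ k) →ₗ[k] (Multiset I →₀ k) :=
  Finsupp.linearCombination k fun s =>
    match s.sort with
    | [] => sym k (i ::ₘ s)
    | j :: t => if i ≤ j then sym k (i ::ₘ s) else
        -- Forced by `x_i x_j z_t = x_j x_i z_t + [x_i, x_j] z_t`. Since `j` is minimal, the leading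
        -- term `z_{it}` of `x_i z_t` contributes `z_{ijt}`; only the remainder, of degree at most
        -- that of `t`, is passed to `T j`.
        sym k (i ::ₘ s) + T j (T i (sym k (t : Multiset I)) - sym k (i ::ₘ (t : Multiset I))) +
          b.constr k T ⁅b i, b j⁆ (sym k (t : Multiset I))

/-- Approximations to the operators of left multiplication by the basis vectors. -/
def ops : ℕ → I → (Multiset I →₀ k) →ₗ[k] (Multiset I →₀ k)
  | 0 => fun i => Finsupp.linearCombination k fun s => sym k (i ::ₘ s)
  | n + 1 => step b (ops n)

/-- The operators of left multiplication by the basis vectors. -/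
def leftMul (i : I) : (Multiset I →₀ k) →ₗ[k] (Multiset I →₀ k) :=
  Finsupp.linearCombination k fun s => ops b s.card i (sym k s)

theorem step_of_le (T : I → (Multiset I →₀ k) →ₗ[k] (Multiset I →₀ k)) {i : I} {s : Multiset I}
    (h : ∀ j ∈ s, i ≤ j) : step b T i (sym k s) = sym k (i ::ₘ s) := by
  simp only [step, Finsupp.linearCombination_single, one_smul]
  split
  · rfl
  · rename_i j t hs
    rw [if_pos (h j (by rw [← Multiset.mem_sort (· ≤ ·), hs]; simp))]

theorem step_of_lt (T : I → (Multiset I →₀ k) →ₗ[k] (Multiset I →₀ k)) {i j : I} {t : Multiset I}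
    (h : ∀ l ∈ t, j ≤ l) (hij : j < i) : step b T i (sym k (j ::ₘ t)) =
      sym k (i ::ₘ j ::ₘ t) + T j (T i (sym k t) - sym k (i ::ₘ t)) +
        b.constr k T ⁅b i, b j⁆ (sym k t) := by
  simp only [step, Finsupp.linearCombination_single, one_smul, Multiset.sort_cons j t (· ≤ ·) h,
    if_neg hij.not_ge, Multiset.sort_eq]

/-- The case distinction behind every recursion below: if `i` cannot be put in front of `s`, then
the least element of `s` is split off. -/
theorem eq_cons_or_forall_le (i : I) (s : Multiset I) :
    (∀ j ∈ s, i ≤ j) ∨ ∃ j t, s = j ::ₘ t ∧ (∀ l ∈ t, j ≤ l) ∧ j < i := by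
  by_cases h : ∀ j ∈ s, i ≤ j
  · exact Or.inl h
  · right
    push Not at h
    obtain ⟨j, hj, hji⟩ := h
    have hp := Multiset.pairwise_sort s (· ≤ ·)
    have he := Multiset.sort_eq s (· ≤ ·)
    cases hs : s.sort (· ≤ ·) with
    | nil => rw [hs] at he; rw [← he] at hj; simp at hj
    | cons l t =>
      rw [hs] at hp he
      rw [List.pairwise_cons] at hp
      refine ⟨l, t, by rw [← he]; rfl, fun m hm => hp.1 m hm, ?_⟩
      rw [← he] at hj
      rcases List.mem_cons.1 hj with rfl | hj
      · exact hji
      · exact lt_of_le_of_lt (hp.1 j hj) hji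

theorem constr_mem {M : Type*} [AddCommGroup M] [Module k M] (T : I → M →ₗ[k] M)
    (W : Submodule k M) (v : M) (h : ∀ i, T i v ∈ W) (x : 𝔩) : b.constr k T x v ∈ W := by
  rw [Module.Basis.constr_apply, Finsupp.sum, LinearMap.sum_apply]
  exact Submodule.sum_mem _ fun i _ => Submodule.smul_mem _ _ (h i)

theorem constr_congr {M : Type*} [AddCommGroup M] [Module k M] (T T' : I → M →ₗ[k] M)
    (v : M) (h : ∀ i, T i v = T' i v) (x : 𝔩) : b.constr k T x v = b.constr k T' x v := by
  simp only [Module.Basis.constr_apply, Finsupp.sum, LinearMap.sum_apply, LinearMap.smul_apply, h]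

/-- Left multiplication agrees with multiplication in the symmetric algebra up to terms of lower
degree. This keeps the argument of `T j` in `step` within the degrees where `T j` is already
correct. -/
theorem ops_sub_mem (n : ℕ) (i : I) (s : Multiset I) :
    ops b n i (sym k s) - sym k (i ::ₘ s) ∈ degLE k I s.card := by
  induction n generalizing i s with
  | zero => simp [ops]
  | succ n ih =>
    rcases eq_cons_or_forall_le i s with h | ⟨j, t, rfl, h, hij⟩
    · rw [ops, step_of_le b _ h, sub_self]; exact zero_mem _
    · have key : ∀ l, ∀ m, ∀ v ∈ degLE k I m, ops b n l v ∈ degLE k I (m + 1) := by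
        intro l m v hv
        refine map_mem_of_mem_degLE _ _ (fun s hs => ?_) hv
        rw [← sub_add_cancel (ops b n l (sym k s)) (sym k (l ::ₘ s))]
        refine add_mem (degLE_mono (by omega) (ih l s)) (sym_mem_degLE (by simpa using hs))
      rw [ops, step_of_lt b _ h hij, add_assoc, add_sub_cancel_left, Multiset.card_cons]
      exact add_mem (key _ _ _ (ih i t)) (constr_mem b _ _ _
        (fun l => key l _ _ (sym_mem_degLE le_rfl)) _)

/-- On a monomial of degree `d`, the recursion consults the previous operators only in degrees below
`d`, so the approximations become stationary from index `d` on. -/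
theorem ops_succ_eq (n : ℕ) (i : I) (s : Multiset I) (hs : s.card ≤ n) :
    ops b (n + 1) i (sym k s) = ops b n i (sym k s) := by
  induction n generalizing i s with
  | zero =>
    obtain rfl : s = 0 := by simpa using hs
    rw [ops.eq_2, step_of_le b _ (by simp)]
    simp [ops]
  | succ n ih =>
    rcases eq_cons_or_forall_le i s with h | ⟨j, t, rfl, h, hij⟩
    · rw [ops, step_of_le b _ h, ops, step_of_le b _ h]
    · have ht : t.card ≤ n := by simpa using hs
      rw [ops, step_of_lt b _ h hij, ops, step_of_lt b _ h hij, ← ops, ih i t ht,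
        map_eq_of_mem_degLE (n := n) _ _ (fun s hs => ih j s hs)
          (degLE_mono ht (ops_sub_mem b n i t)),
        constr_congr b _ _ _ fun l => ih l t ht]

theorem leftMul_eq_ops {n : ℕ} (i : I) (s : Multiset I) (hs : s.card ≤ n) :
    leftMul b i (sym k s) = ops b n i (sym k s) := by
  induction n, hs using Nat.le_induction with
  | base => simp [leftMul]
  | succ n hn ih => rw [ih, ops_succ_eq b n i s hn]

theorem leftMul_of_le {i : I} {s : Multiset I} (h : ∀ j ∈ s, i ≤ j) :
    leftMul b i (sym k s) = sym k (i ::ₘ s) := by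
  rw [leftMul_eq_ops b i s (Nat.le_succ _), ops, step_of_le b _ h]

theorem leftMul_sub_mem (i : I) (s : Multiset I) :
    leftMul b i (sym k s) - sym k (i ::ₘ s) ∈ degLE k I s.card := by
  rw [leftMul_eq_ops b i s le_rfl]
  exact ops_sub_mem b _ _ _

theorem leftMul_of_lt {i j : I} {t : Multiset I} (h : ∀ l ∈ t, j ≤ l) (hij : j < i) :
    leftMul b i (sym k (j ::ₘ t)) = leftMul b j (leftMul b i (sym k t)) +
      b.constr k (leftMul b) ⁅b i, b j⁆ (sym k t) := by
  have h1 : leftMul b j (sym k (i ::ₘ t)) = sym k (i ::ₘ j ::ₘ t) := by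
    rw [leftMul_of_le, Multiset.cons_swap]
    simpa using ⟨hij.le, h⟩
  rw [leftMul_eq_ops b i _ (n := t.card + 1) (by simp), ops, step_of_lt b _ h hij, ← h1,
    constr_congr b (leftMul b) (ops b t.card) _ fun l => leftMul_eq_ops b l t le_rfl,
    ← leftMul_eq_ops b i t le_rfl,
    ← map_eq_of_mem_degLE (n := t.card) _ _ (fun s hs => leftMul_eq_ops b j s hs)
      (leftMul_sub_mem b i t), map_sub]
  abel

/-- The representation of the Lie algebra on the symmetric algebra. -/
def rep : 𝔩 →ₗ[k] Module.End k (Multiset I →₀ k) := b.constr k (leftMul b)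

theorem rep_basis (i : I) : rep b (b i) = leftMul b i := b.constr_basis k _ i

/-- Both sides are bilinear in the two Lie algebra elements, so basis vectors suffice. -/
theorem rep_lie_of_basis (v : Multiset I →₀ k) (h : ∀ i j, leftMul b i (leftMul b j v) =
    leftMul b j (leftMul b i v) + rep b ⁅b i, b j⁆ v) (x y : 𝔩) :
    rep b x (rep b y v) = rep b y (rep b x v) + rep b ⁅x, y⁆ v := by
  let F : 𝔩 →ₗ[k] 𝔩 →ₗ[k] (Multiset I →₀ k) := LinearMap.mk₂ k
    (fun x y => rep b x (rep b y v)) (by simp) (by simp) (by simp) (by simp)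
  let G : 𝔩 →ₗ[k] 𝔩 →ₗ[k] (Multiset I →₀ k) := LinearMap.mk₂ k
    (fun x y => rep b y (rep b x v) + rep b ⁅x, y⁆ v) (fun _ _ _ => by simp; abel)
    (by simp) (fun _ _ _ => by simp; abel) (by simp)
  have : F = G := b.ext fun i => b.ext fun j => by
    simpa [F, G, rep_basis] using h i j
  exact congrArg (fun F => F x y) this

/-- The heart of the Poincaré–Birkhoff–Witt theorem. If `j < i` and `j` is at most every element of
`s`, this is the defining recursion. Otherwise the least element `l` of `s` is smaller than both;
moving it to the left by induction reduces the claim to the Jacobi identity. -/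
theorem leftMul_comm_of_degree (n : ℕ) (s : Multiset I) (hs : s.card ≤ n) (i j : I) :
    leftMul b i (leftMul b j (sym k s)) =
      leftMul b j (leftMul b i (sym k s)) + rep b ⁅b i, b j⁆ (sym k s) := by
  induction n generalizing s i j with
  | zero =>
    obtain rfl : s = 0 := by simpa using hs
    rcases lt_trichotomy i j with h | rfl | h
    · rw [leftMul_of_le b (i := i) (s := 0) (by simp), leftMul_of_lt b (by simp) h,
        ← lie_skew (b i), map_neg]
      simp [rep]
    · simp
    · rw [leftMul_of_le b (i := j) (s := 0) (by simp), leftMul_of_lt b (by simp) h]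
      simp [rep]
  | succ n ih =>
    have IH : ∀ x y : 𝔩, ∀ v ∈ degLE k I n, rep b x (rep b y v) =
        rep b y (rep b x v) + rep b ⁅x, y⁆ v := fun x y v hv =>
      map_eq_of_mem_degLE (rep b x ∘ₗ rep b y) (rep b y ∘ₗ rep b x + rep b ⁅x, y⁆)
        (fun s hs => rep_lie_of_basis b _ (fun i j => ih s hs i j) x y) hv
    wlog hij : j < i generalizing i j
    · rcases (not_lt.1 hij).lt_or_eq with h | rfl
      · rw [this j i h, ← lie_skew (b i), map_neg]
        simp
      · simp
    rcases eq_cons_or_forall_le j s with h | ⟨l, t, rfl, h, hlj⟩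
    · rw [leftMul_of_le b h, leftMul_of_lt b h hij, rep]
    · have ht : t.card ≤ n := by simpa using hs
      have htm : sym k t ∈ degLE k I n := sym_mem_degLE ht
      -- The vector `b_m z_t` may have degree `n + 1`, out of reach of the induction. Its leading
      -- monomial `z_{mt}` still has all elements at least `l`, so there the recursion applies; the
      -- remainder has degree at most that of `t`, so there `IH` applies.
      have hl : ∀ m, l < m → ∀ x, l < x → rep b (b x) (rep b (b l) (leftMul b m (sym k t))) =
          rep b (b l) (rep b (b x) (leftMul b m (sym k t))) +
            rep b ⁅b x, b l⁆ (leftMul b m (sym k t)) := by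
        intro m hm x hx
        have hc : ∀ q ∈ m ::ₘ t, l ≤ q := by simpa using ⟨hm.le, h⟩
        have e1 : rep b (b x) (rep b (b l) (sym k (m ::ₘ t))) =
            rep b (b l) (rep b (b x) (sym k (m ::ₘ t))) + rep b ⁅b x, b l⁆ (sym k (m ::ₘ t)) := by
          simp only [rep_basis]
          rw [leftMul_of_le b hc, leftMul_of_lt b hc hx, rep]
        have e2 := IH (b x) (b l) _ (degLE_mono ht (leftMul_sub_mem b m t))
        simp only [map_sub] at e2
        rw [e1] at e2
        rw [← sub_eq_zero] at e2 ⊢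
        rw [← e2]
        abel
      have hs' : sym k (l ::ₘ t) = rep b (b l) (sym k t) := by rw [rep_basis, leftMul_of_le b h]
      -- The first and last terms record the order of `x` and `y`; the two middle ones are exchanged
      -- when `x` and `y` are. In the difference of the two orders the middle terms cancel and
      -- Jacobi combines the rest.
      have key : ∀ x y, l < x → l < y → leftMul b x (leftMul b y (sym k (l ::ₘ t))) =
          rep b (b l) (rep b (b x) (rep b (b y) (sym k t))) +
            rep b ⁅b x, b l⁆ (rep b (b y) (sym k t)) + (rep b ⁅b y, b l⁆ (rep b (b x) (sym k t)) +
              rep b ⁅b x, ⁅b y, b l⁆⁆ (sym k t)) := by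
        intro x y hx hy
        rw [leftMul_of_lt b h hy, map_add, ← IH _ _ _ htm]
        have := hl y hy x hx
        simp only [rep_basis] at this ⊢
        rw [this]
        rfl
      rw [key i j (hlj.trans hij) hlj, key j i hlj (hlj.trans hij), IH (b i) (b j) _ htm, hs',
        IH _ (b l) _ htm, map_add, leibniz_lie (b i) (b j) (b l), map_add, LinearMap.add_apply]
      abel

theorem rep_lie (x y : 𝔩) : rep b ⁅x, y⁆ = rep b x * rep b y - rep b y * rep b x := by
  refine Finsupp.lhom_ext' fun s => LinearMap.ext_ring ?_
  have := rep_lie_of_basis b (sym k s) (fun i j => leftMul_comm_of_degree b _ s le_rfl i j) x y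
  simp only [LinearMap.coe_comp, Function.comp_apply, Finsupp.lsingle_apply, LinearMap.sub_apply,
    Module.End.mul_apply]
  rw [this]
  abel

attribute [local instance] LieRing.ofAssociativeRing

/-- The representation of the enveloping algebra on the symmetric algebra. -/
def envRep : UniversalEnvelopingAlgebra k 𝔩 →ₐ[k] Module.End k (Multiset I →₀ k) :=
  UniversalEnvelopingAlgebra.lift k { rep b with map_lie' := fun {x y} => rep_lie b x y }

theorem envRep_ι (x : 𝔩) : envRep b (UniversalEnvelopingAlgebra.ι k x) = rep b x :=
  UniversalEnvelopingAlgebra.lift_ι_apply k _ x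

theorem envRep_pow {i : I} {s : Multiset I} (h : ∀ j ∈ s, i ≤ j) (n : ℕ) :
    envRep b (UniversalEnvelopingAlgebra.ι k (b i) ^ n) (sym k s) =
      sym k (Multiset.replicate n i + s) := by
  induction n with
  | zero => simp
  | succ n ih =>
    rw [pow_succ', map_mul, Module.End.mul_apply, ih, envRep_ι, rep_basis, leftMul_of_le,
      Multiset.replicate_succ, Multiset.cons_add]
    intro j hj
    rcases Multiset.mem_add.1 hj with hj | hj
    · exact (Multiset.eq_of_mem_replicate hj).ge
    · exact h j hj

end Operators

/-- The monomial with exponents `f`, the factors being ordered as in the list `l`. -/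
def mon {R I : Type*} [Monoid R] (x : I → R) (l : List I) (f : I → ℕ) : R :=
  (l.map fun i => x i ^ f i).prod

/-! ### Linear independence of ordered monomials -/

section Independence

variable {k 𝔩 I : Type*} [CommRing k] [LieRing 𝔩] [LieAlgebra k 𝔩]

/-- Applied to the vector `1`, an ordered monomial produces the corresponding basis vector of the
symmetric algebra: each factor acts on a monomial all of whose indices come later, so no commutators
appear. -/
theorem envRep_mon [LinearOrder I] (b : Module.Basis I k 𝔩) (l : List I) (hl : l.Pairwise (· < ·))
    (f : I → ℕ) : envRep b (mon (fun i => UniversalEnvelopingAlgebra.ι k (b i)) l f) (sym k 0) =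
      sym k (l.map fun i => Multiset.replicate (f i) i).sum := by
  induction l with
  | nil => simp [mon]
  | cons i l ih =>
    rw [List.pairwise_cons] at hl
    have := ih hl.2
    simp only [mon, List.map_cons, List.prod_cons, List.sum_cons, map_mul,
      Module.End.mul_apply] at this ⊢
    rw [this, envRep_pow]
    intro j hj
    have : ∀ l : List I, j ∈ (l.map fun i => Multiset.replicate (f i) i).sum → j ∈ l := by
      intro l
      induction l with
      | nil => simp
      | cons a l ih =>
        intro h
        rw [List.map_cons, List.sum_cons, Multiset.mem_add] at h
        rcases h with h | h
        · rw [Multiset.eq_of_mem_replicate h]; simp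
        · exact List.mem_cons_of_mem _ (ih h)
    exact (hl.1 j (this l hj)).le

theorem count_sum_replicate [DecidableEq I] (l : List I) (hl : l.Nodup) (f : I → ℕ) (i : I)
    (hi : i ∈ l) : (l.map fun i => Multiset.replicate (f i) i).sum.count i = f i := by
  have h0 : ∀ l : List I, i ∉ l → (l.map fun i => Multiset.replicate (f i) i).sum.count i = 0 := by
    intro l
    induction l with
    | nil => simp
    | cons a l ih =>
      intro h
      rw [List.mem_cons, not_or] at h
      rw [List.map_cons, List.sum_cons, Multiset.count_add, ih h.2, Multiset.count_replicate,
        if_neg (Ne.symm h.1)]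
  induction l with
  | nil => simp at hi
  | cons a l ih =>
    rw [List.nodup_cons] at hl
    rw [List.map_cons, List.sum_cons, Multiset.count_add, Multiset.count_replicate]
    rcases List.mem_cons.1 hi with rfl | hi
    · rw [if_pos rfl, h0 l hl.1, add_zero]
    · rw [if_neg (by rintro rfl; exact hl.1 hi), ih hl.2 hi, zero_add]

/-- The ordered monomials are linearly independent in the enveloping algebra. -/
theorem linearIndependent_mon (b : Module.Basis I k 𝔩) (l : List I) (hl : l.Nodup)
    (hmem : ∀ i, i ∈ l) :
    LinearIndependent k (mon (fun i => UniversalEnvelopingAlgebra.ι k (b i)) l) := by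
  classical
  -- The order on the index set is chosen as the position in `l`, so that the prescribed order of
  -- the factors becomes increasing.
  obtain ⟨φ, hφ, hφl⟩ : ∃ φ : I → ℕ, Function.Injective φ ∧ l.Pairwise (fun i j => φ i < φ j) := by
    refine ⟨fun i => l.idxOf i, fun i j h => (List.idxOf_inj (hmem i)).1 h, ?_⟩
    rw [List.pairwise_iff_getElem]
    intro i j hi hj hij
    beta_reduce
    rwa [hl.idxOf_getElem, hl.idxOf_getElem]
  let _ : LinearOrder I := LinearOrder.lift' φ hφ
  have hp : l.Pairwise (· < ·) := hφl
  have h1 : LinearIndependent k (fun s : Multiset I => sym k s) :=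
    Finsupp.linearIndependent_single_one k (Multiset I)
  have h2 := h1.comp (fun f : I → ℕ => (l.map fun i => Multiset.replicate (f i) i).sum)
    (fun f g h => funext fun i => by
      rw [← count_sum_replicate l hl f i (hmem i), ← count_sum_replicate l hl g i (hmem i)]
      exact congrArg _ h)
  refine LinearIndependent.of_comp
    ((LinearMap.applyₗ (sym k 0)).comp (envRep b).toLinearMap) ?_
  convert h2 using 1
  funext f
  exact envRep_mon b l hp f

end Independence

end PBW

/-! ### Spanning by ordered monomials -/

namespace PBW

section Span

variable {k R I : Type*} [CommRing k] [Ring R] [Algebra k R] (x : I → R)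

/-- The span of the products of at most `n` generators. -/
def wordsLE (k : Type*) [CommRing k] [Algebra k R] (x : I → R) (n : ℕ) : Submodule k R :=
  Submodule.span k ((fun m : List I => (m.map x).prod) '' {m | m.length ≤ n})

theorem word_mem_wordsLE {m : List I} {n : ℕ} (h : m.length ≤ n) :
    (m.map x).prod ∈ wordsLE k x n := Submodule.subset_span ⟨m, h, rfl⟩

theorem mul_mem_wordsLE (i : I) {n : ℕ} {v : R} (hv : v ∈ wordsLE k x n) :
    x i * v ∈ wordsLE k x (n + 1) := by
  have : wordsLE k x n ≤ (wordsLE k x (n + 1)).comap (LinearMap.mulLeft k (x i)) :=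
    Submodule.span_le.2 (by
      rintro _ ⟨m, hm, rfl⟩
      have := word_mem_wordsLE (k := k) x (m := i :: m) (n := n + 1) (by simpa using hm)
      simpa using this)
  exact this hv

/-- Swapping two adjacent letters changes a word by a commutator, which is linear in the generators
and therefore costs one letter. -/
theorem sub_mem_wordsLE_of_perm
    (hx : ∀ i j, x i * x j - x j * x i ∈ Submodule.span k (Set.range x)) {m m' : List I}
    (h : m.Perm m') (n : ℕ) (hn : m.length ≤ n + 1) :
    (m.map x).prod - (m'.map x).prod ∈ wordsLE k x n := by
  induction h generalizing n with
  | nil => simp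
  | cons a h ih =>
    rw [List.map_cons, List.map_cons, List.prod_cons, List.prod_cons, ← mul_sub]
    cases n with
    | zero =>
      rename_i m m'
      obtain rfl : m = [] := by simpa using hn
      rw [List.nil_perm.1 h, sub_self, mul_zero]
      exact zero_mem _
    | succ n => exact mul_mem_wordsLE x a (ih n (by simpa using hn))
  | swap a a' m =>
    obtain ⟨n, rfl⟩ : ∃ n', n = n' + 1 := ⟨n - 1, by simp at hn; omega⟩
    have hm : m.length ≤ n := by simpa using hn
    simp only [List.map_cons, List.prod_cons, ← mul_assoc, ← sub_mul]
    have : Submodule.span k (Set.range x) ≤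
        (wordsLE k x (n + 1)).comap (LinearMap.mulRight k (m.map x).prod) :=
      Submodule.span_le.2 (by
        rintro _ ⟨i, rfl⟩
        exact mul_mem_wordsLE x i (word_mem_wordsLE x hm))
    exact this (hx a' a)
  | trans h1 h2 ih1 ih2 =>
    rw [← sub_add_sub_cancel]
    exact add_mem (ih1 n hn) (ih2 n (by rwa [← h1.length_eq]))

theorem mon_eq_word (l : List I) (f : I → ℕ) :
    mon x l f = (((l.map fun i => List.replicate (f i) i).flatten).map x).prod := by
  induction l with
  | nil => simp [mon]
  | cons i l ih =>
    simp only [mon, List.map_cons, List.prod_cons, List.flatten_cons, List.map_append,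
      List.prod_append, List.map_replicate, List.prod_replicate] at ih ⊢
    rw [ih]

/-- If the commutators of the generators are linear combinations of generators, then the ordered
monomials span the algebra. -/
theorem span_mon_eq_top
    (hx : ∀ i j, x i * x j - x j * x i ∈ Submodule.span k (Set.range x))
    (hgen : Algebra.adjoin k (Set.range x) = ⊤) (l : List I) (hl : l.Nodup) (hmem : ∀ i, i ∈ l) :
    Submodule.span k (Set.range (mon x l)) = ⊤ := by
  classical
  have key : ∀ n, wordsLE k x n ≤ Submodule.span k (Set.range (mon x l)) := by
    intro n
    induction n with
    | zero =>
      refine Submodule.span_le.2 ?_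
      rintro _ ⟨m, hm, rfl⟩
      obtain rfl : m = [] := by simpa using hm
      exact Submodule.subset_span ⟨0, by simp [mon]⟩
    | succ n ih =>
      refine Submodule.span_le.2 ?_
      rintro _ ⟨m, hm, rfl⟩
      -- Sorting the word according to `l` yields an ordered monomial; the error consists of shorter
      -- words, which the induction covers.
      have hp : m.Perm (l.map fun i => List.replicate (m.count i) i).flatten := by
        rw [List.perm_iff_count]
        intro a
        have := count_sum_replicate l hl (fun i => m.count i) a (hmem a)
        have h2 : ∀ l : List I, (l.map fun i => List.replicate (m.count i) i).flatten.count a =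
            (l.map fun i => Multiset.replicate (m.count i) i).sum.count a := by
          intro l
          induction l with
          | nil => simp
          | cons i l ih => simp [ih, List.count_append, List.count_replicate,
              Multiset.count_replicate]
        rw [h2, this]
      have h1 := ih (sub_mem_wordsLE_of_perm x hx hp n hm)
      rw [← mon_eq_word] at h1
      have h2 : mon x l (fun i => m.count i) ∈ Submodule.span k (Set.range (mon x l)) :=
        Submodule.subset_span ⟨_, rfl⟩
      simpa using add_mem h1 h2
  rw [eq_top_iff, ← Algebra.top_toSubmodule, ← hgen, Algebra.adjoin_eq_span]
  refine Submodule.span_le.2 fun y hy => ?_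
  obtain ⟨m, hm, rfl⟩ := Submonoid.exists_list_of_mem_closure hy
  have : ∃ m' : List I, m'.map x = m := by
    induction m with
    | nil => exact ⟨[], rfl⟩
    | cons a m ih =>
      obtain ⟨m', h'⟩ := ih (fun z hz => hm z (List.mem_cons_of_mem _ hz))
        (Submonoid.list_prod_mem _ fun z hz =>
          Submonoid.subset_closure (hm z (List.mem_cons_of_mem _ hz)))
      obtain ⟨i, hi⟩ := hm a (by simp)
      exact ⟨i :: m', by simp [h', hi]⟩
  obtain ⟨m', rfl⟩ := this
  exact key _ (word_mem_wordsLE x le_rfl)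

end Span

/-! ### Truncation of exponents modulo `p` -/

section Trunc

variable {k I : Type*} [CommRing k] (p : ℕ) (T : Set I) (c : I → k)

open scoped Classical in
/-- Reduction modulo `p` of the exponents in `T`. -/
def red (f : I → ℕ) (i : I) : ℕ := if i ∈ T then f i % p else f i

open scoped Classical in
/-- The scalar by which a monomial and its reduction differ. -/
def cof (l : List I) (f : I → ℕ) : k := (l.map fun i => if i ∈ T then c i ^ (f i / p) else 1).prod

/-- The exponents which are smaller than `p` on `T`. -/
abbrev TExp := {f : I → ℕ // ∀ i ∈ T, f i < p}

/-- The reduced exponents. -/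
def redT [NeZero p] (f : I → ℕ) : TExp p T :=
  ⟨red p T f, fun i hi => by rw [red, if_pos hi]; exact Nat.mod_lt _ (NeZero.pos p)⟩

theorem redT_val [NeZero p] (f : TExp p T) : redT p T f.1 = f :=
  Subtype.ext (funext fun i => by
    by_cases hi : i ∈ T
    · simp [redT, red, hi, Nat.mod_eq_of_lt (f.2 i hi)]
    · simp [redT, red, hi])

theorem cof_val (l : List I) (f : TExp p T) : cof p T c l f.1 = 1 := by
  refine List.prod_eq_one fun y hy => ?_
  obtain ⟨i, _, rfl⟩ := List.mem_map.1 hy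
  split_ifs with hi
  · simp [Nat.div_eq_of_lt (f.2 i hi)]
  · rfl

theorem mon_eq_cof_smul {R : Type*} [Ring R] [Algebra k R] (x : I → R)
    (hx : ∀ i ∈ T, x i ^ p = algebraMap k R (c i)) (l : List I) (f : I → ℕ) :
    mon x l f = cof p T c l f • mon x l (red p T f) := by
  induction l with
  | nil => simp [mon, cof]
  | cons i l ih =>
    have h : x i ^ f i = (open Classical in if i ∈ T then c i ^ (f i / p) else 1) •
        x i ^ red p T f i := by
      by_cases hi : i ∈ T
      · simp only [red, if_pos hi]
        conv_lhs => rw [← Nat.div_add_mod (f i) p, pow_add, pow_mul, hx i hi, ← map_pow,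
          ← Algebra.smul_def]
      · simp [red, if_neg hi]
    simp only [mon, cof, List.map_cons, List.prod_cons] at ih ⊢
    rw [ih, h, smul_mul_smul_comm]

theorem mon_congr {R : Type*} [Monoid R] (x : I → R) (l : List I) {f g : I → ℕ}
    (h : ∀ i ∈ l, f i = g i) : mon x l f = mon x l g := by
  rw [mon, mon, List.map_congr_left fun i hi => by rw [h i hi]]

/-- As `x i ^ p` commutes with all generators, it can be moved through the ordered product to the
factor with index `i`. -/
theorem pow_mul_mon [DecidableEq I] {R : Type*} [Monoid R] (x : I → R) (l : List I) (hl : l.Nodup)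
    (i : I) (hi : i ∈ l) (hc : ∀ j, Commute (x i ^ p) (x j)) (f : I → ℕ) :
    x i ^ p * mon x l f = mon x l (Function.update f i (f i + p)) := by
  induction l with
  | nil => simp at hi
  | cons a l ih =>
    rw [List.nodup_cons] at hl
    rw [mon, mon, List.map_cons, List.map_cons, List.prod_cons, List.prod_cons, ← mon, ← mon]
    by_cases h : a = i
    · subst h
      rw [← mul_assoc, ← pow_add, Function.update_self, add_comm,
        mon_congr x l (g := Function.update f a (f a + p)) fun j hj => ?_]
      rw [Function.update_of_ne]
      rintro rfl
      exact hl.1 hj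
    · rw [Function.update_of_ne h, ← mul_assoc, ((hc a).pow_right _).eq, mul_assoc,
        ih hl.2 ((List.mem_cons.1 hi).resolve_left (Ne.symm h))]

theorem cof_update [NeZero p] [DecidableEq I] (l : List I) (hl : l.Nodup) (i : I) (hi : i ∈ l)
    (hT : i ∈ T) (f : I → ℕ) :
    cof p T c l (Function.update f i (f i + p)) = c i * cof p T c l f := by
  classical
  induction l with
  | nil => simp at hi
  | cons a l ih =>
    rw [List.nodup_cons] at hl
    rw [cof, cof, List.map_cons, List.map_cons, List.prod_cons, List.prod_cons, ← cof, ← cof]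
    by_cases h : a = i
    · subst h
      have : cof p T c l (Function.update f a (f a + p)) = cof p T c l f := by
        rw [cof, cof, List.map_congr_left]
        intro j hj
        rw [Function.update_of_ne]
        rintro rfl
        exact hl.1 hj
      rw [this, Function.update_self, if_pos hT, if_pos hT, Nat.add_div_right _ (NeZero.pos p),
        pow_succ', mul_assoc]
    · rw [Function.update_of_ne h, ih hl.2 ((List.mem_cons.1 hi).resolve_left (Ne.symm h))]
      ring

theorem redT_update [NeZero p] [DecidableEq I] (i : I) (hT : i ∈ T) (f : I → ℕ) :
    redT p T (Function.update f i (f i + p)) = redT p T f :=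
  Subtype.ext (funext fun j => by
    by_cases h : j = i
    · subst h
      simp [redT, red, hT]
    · simp [redT, red, Function.update_of_ne h])

end Trunc

/-! ### Bases of enveloping algebras and of their reduced quotients -/

section Env

attribute [local instance] LieRing.ofAssociativeRing

variable {k 𝔩 I : Type*} [Field k] [LieRing 𝔩] [LieAlgebra k 𝔩]

theorem ι_mem_span (y : I → 𝔩) (hy : Submodule.span k (Set.range y) = ⊤) (z : 𝔩) :
    UniversalEnvelopingAlgebra.ι k z ∈
      Submodule.span k (Set.range fun i => UniversalEnvelopingAlgebra.ι k (y i)) := by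
  have hz : z ∈ Submodule.span k (Set.range y) := hy ▸ Submodule.mem_top
  have := Submodule.mem_map_of_mem (f := (UniversalEnvelopingAlgebra.ι k :
    𝔩 →ₗ⁅k⁆ UniversalEnvelopingAlgebra k 𝔩).toLinearMap) hz
  rw [Submodule.map_span, ← Set.range_comp] at this
  exact this

theorem commutator_mem_span (y : I → 𝔩) (hy : Submodule.span k (Set.range y) = ⊤) (i j : I) :
    UniversalEnvelopingAlgebra.ι k (y i) * UniversalEnvelopingAlgebra.ι k (y j) -
      UniversalEnvelopingAlgebra.ι k (y j) * UniversalEnvelopingAlgebra.ι k (y i) ∈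
      Submodule.span k (Set.range fun i => UniversalEnvelopingAlgebra.ι k (y i)) := by
  have h : UniversalEnvelopingAlgebra.ι k (y i) * UniversalEnvelopingAlgebra.ι k (y j) -
      UniversalEnvelopingAlgebra.ι k (y j) * UniversalEnvelopingAlgebra.ι k (y i) =
      UniversalEnvelopingAlgebra.ι k ⁅y i, y j⁆ := by
    rw [LieHom.map_lie, LieRing.of_associative_ring_bracket]
  rw [h]
  exact ι_mem_span y hy _

/-- The enveloping algebra is generated by the Lie algebra. -/
theorem adjoin_range_ι :
    Algebra.adjoin k (Set.range (UniversalEnvelopingAlgebra.ι k : 𝔩 →ₗ⁅k⁆ _)) = ⊤ := by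
  set W := Algebra.adjoin k (Set.range (UniversalEnvelopingAlgebra.ι k : 𝔩 →ₗ⁅k⁆ _))
  let F : 𝔩 →ₗ⁅k⁆ W :=
    { toFun := fun y => ⟨UniversalEnvelopingAlgebra.ι k y, Algebra.subset_adjoin ⟨y, rfl⟩⟩
      map_add' := fun y z => Subtype.ext (LinearMap.map_add
        (UniversalEnvelopingAlgebra.ι k : 𝔩 →ₗ⁅k⁆ _).toLinearMap y z)
      map_smul' := fun a y => Subtype.ext (LinearMap.map_smul
        (UniversalEnvelopingAlgebra.ι k : 𝔩 →ₗ⁅k⁆ _).toLinearMap a y)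
      map_lie' := fun {y z} => Subtype.ext (LieHom.map_lie _ y z) }
  have h : W.val.comp (UniversalEnvelopingAlgebra.lift k F) = AlgHom.id k _ := by
    refine UniversalEnvelopingAlgebra.hom_ext k ?_
    ext y
    simp only [LieHom.comp_apply, AlgHom.coe_toLieHom, AlgHom.comp_apply, AlgHom.id_apply,
      UniversalEnvelopingAlgebra.lift_ι_apply]
    rfl
  rw [eq_top_iff]
  intro u _
  have := DFunLike.congr_fun h u
  simp only [AlgHom.comp_apply, AlgHom.id_apply] at this
  rw [← this]
  exact (UniversalEnvelopingAlgebra.lift k F u).2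

theorem adjoin_range_of_span (y : I → 𝔩) (hy : Submodule.span k (Set.range y) = ⊤) :
    Algebra.adjoin k (Set.range fun i => UniversalEnvelopingAlgebra.ι k (y i)) = ⊤ := by
  rw [eq_top_iff, ← adjoin_range_ι, Algebra.adjoin_le_iff]
  rintro _ ⟨z, rfl⟩
  exact Algebra.span_le_adjoin k _ (ι_mem_span y hy z)

theorem span_mon_env (y : I → 𝔩) (hy : Submodule.span k (Set.range y) = ⊤) (l : List I)
    (hl : l.Nodup) (hmem : ∀ i, i ∈ l) :
    Submodule.span k (Set.range (mon (fun i => UniversalEnvelopingAlgebra.ι k (y i)) l)) = ⊤ :=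
  span_mon_eq_top _ (commutator_mem_span y hy) (adjoin_range_of_span y hy) l hl hmem

theorem map_mon {R R' F : Type*} [Monoid R] [Monoid R'] [FunLike F R R'] [MonoidHomClass F R R']
    (φ : F) (x : I → R) (l : List I) (f : I → ℕ) :
    φ (mon x l f) = mon (fun i => φ (x i)) l f := by
  rw [mon, mon, map_list_prod, List.map_map]
  congr 2
  funext i
  simp

/-- The basis of ordered monomials of the enveloping algebra. -/
def monBasis (b : Module.Basis I k 𝔩) (l : List I) (hl : l.Nodup) (hmem : ∀ i, i ∈ l) :
    Module.Basis (I → ℕ) k (UniversalEnvelopingAlgebra k 𝔩) :=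
  Module.Basis.mk (linearIndependent_mon b l hl hmem)
    (span_mon_env b b.span_eq l hl hmem).ge

theorem nontrivial_env (b : Module.Basis I k 𝔩) (l : List I) (hl : l.Nodup) (hmem : ∀ i, i ∈ l) :
    Nontrivial (UniversalEnvelopingAlgebra k 𝔩) :=
  ⟨_, 0, (monBasis b l hl hmem).ne_zero 0⟩

/-- In characteristic `p` the commuting operators of left and right multiplication satisfy `(L -
R)^p = L^p - R^p`, while `L - R` restricts to `ad x` on the Lie algebra. Nontriviality of the
enveloping algebra ensures that its endomorphism ring has characteristic `p`. -/
theorem commute_pow_ι {p : ℕ} [Fact p.Prime] [CharP k p] [Nontrivial (UniversalEnvelopingAlgebra k 𝔩)]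
    (x : 𝔩) (hx : ∀ y, ((LieAlgebra.ad k 𝔩 x) ^ p) y = 0) (y : 𝔩) :
    Commute (UniversalEnvelopingAlgebra.ι k x ^ p) (UniversalEnvelopingAlgebra.ι k y) := by
  set X := UniversalEnvelopingAlgebra.ι k x
  have _ : CharP (Module.End k (UniversalEnvelopingAlgebra k 𝔩)) p :=
    charP_of_injective_algebraMap
      (algebraMap k (Module.End k (UniversalEnvelopingAlgebra k 𝔩))).injective p
  have h1 : ∀ n : ℕ, ((LinearMap.mulLeft k X - LinearMap.mulRight k X) ^ n)
      (UniversalEnvelopingAlgebra.ι k y) =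
      UniversalEnvelopingAlgebra.ι k (((LieAlgebra.ad k 𝔩 x) ^ n) y) := by
    intro n
    induction n with
    | zero => simp
    | succ n ih =>
      rw [pow_succ', Module.End.mul_apply, ih, pow_succ', Module.End.mul_apply,
        LieAlgebra.ad_apply, LieHom.map_lie]
      rfl
  have h2 := h1 p
  rw [hx, map_zero, sub_pow_char_of_commute p (LinearMap.commute_mulLeft_right X X),
    LinearMap.pow_mulLeft, LinearMap.pow_mulRight] at h2
  exact sub_eq_zero.1 h2

/-- A criterion for a merely linear map to descend to a `RingQuot`, whose universal property
concerns algebra maps. Carrying arbitrary factors on both sides makes the induction over the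
generated congruence work. -/
theorem map_eq_of_mkAlgHom_eq {R V : Type*} [Ring R] [Algebra k R] [AddCommGroup V] [Module k V]
    (r : R → R → Prop) (τ : R →ₗ[k] V) (h : ∀ u v, r u v → ∀ a b, τ (a * u * b) = τ (a * v * b))
    {u v : R} (huv : RingQuot.mkAlgHom k r u = RingQuot.mkAlgHom k r v) : τ u = τ v := by
  have h1 : ∀ u v, RingQuot.Rel r u v → ∀ a b, τ (a * u * b) = τ (a * v * b) := by
    intro u v huv
    induction huv with
    | of huv => exact h _ _ huv
    | add_left _ ih => intro a b; simp only [mul_add, add_mul, map_add, ih]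
    | mul_left _ ih => intro a b; simpa only [mul_assoc] using ih a _
    | mul_right _ ih => intro a b; simpa only [mul_assoc] using ih (a * _) b
  have h2 : Quot.mk (RingQuot.Rel r) u = Quot.mk (RingQuot.Rel r) v := by
    simp only [RingQuot.mkAlgHom, RingQuot.mkRingHom] at huv
    exact congrArg RingQuot.toQuot huv
  have h3 := Quot.eqvGen_exact h2
  clear h2 huv
  induction h3 with
  | rel u v huv => simpa using h1 u v huv 1 1
  | refl => rfl
  | symm _ _ _ ih => exact ih.symm
  | trans _ _ _ _ _ ih1 ih2 => exact ih1.trans ih2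

/-- The ordered monomials with truncated exponents are linearly independent in a reduced
enveloping algebra. -/
theorem linearIndependent_truncated (p : ℕ) [Fact p.Prime] [CharP k p] (b : Module.Basis I k 𝔩)
    (l : List I) (hl : l.Nodup) (hmem : ∀ i, i ∈ l) (T : Set I) (c : I → k)
    (had : ∀ i ∈ T, ∀ y, ((LieAlgebra.ad k 𝔩 (b i)) ^ p) y = 0)
    (r : UniversalEnvelopingAlgebra k 𝔩 → UniversalEnvelopingAlgebra k 𝔩 → Prop)
    (hr : ∀ u v, r u v → ∃ i ∈ T, u = UniversalEnvelopingAlgebra.ι k (b i) ^ p ∧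
      v = algebraMap k _ (c i)) :
    LinearIndependent k fun f : TExp p T =>
      mon (fun i => RingQuot.mkAlgHom k r (UniversalEnvelopingAlgebra.ι k (b i))) l f.1 := by
  classical
  have _ : NeZero p := ⟨(Fact.out : p.Prime).ne_zero⟩
  have _ := nontrivial_env b l hl hmem
  let B := monBasis b l hl hmem
  -- The linear map reducing each basis monomial by `x_i ^ p = c_i` for `i ∈ T`. It descends to the
  -- quotient because `x_i ^ p` is central, and it sends the truncated monomials to distinct basis
  -- vectors, which proves their independence.
  let τ : UniversalEnvelopingAlgebra k 𝔩 →ₗ[k] (TExp p T →₀ k) :=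
    B.constr k fun f => cof p T c l f • Finsupp.single (redT p T f) 1
  have hB : ∀ f, B f = mon (fun i => UniversalEnvelopingAlgebra.ι k (b i)) l f := fun f => by
    simp [B, monBasis]
  have hτB : ∀ f, τ (B f) = cof p T c l f • Finsupp.single (redT p T f) 1 := fun f =>
    B.constr_basis k _ f
  have hcomm : ∀ i ∈ T, ∀ u, Commute (UniversalEnvelopingAlgebra.ι k (b i) ^ p) u := by
    intro i hi u
    have hu : u ∈ Algebra.adjoin k (Set.range (UniversalEnvelopingAlgebra.ι k : 𝔩 →ₗ⁅k⁆ _)) := by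
      rw [adjoin_range_ι]; trivial
    induction hu using Algebra.adjoin_induction with
    | mem y hy =>
      obtain ⟨y, rfl⟩ := hy
      exact commute_pow_ι _ (had i hi) y
    | algebraMap a => exact Algebra.commute_algebraMap_right _ _
    | add y z _ _ hy hz => exact hy.add_right hz
    | mul y z _ _ hy hz => exact hy.mul_right hz
  have hτ : ∀ i ∈ T, ∀ u, τ (UniversalEnvelopingAlgebra.ι k (b i) ^ p * u) = c i • τ u := by
    intro i hi u
    have : τ ∘ₗ LinearMap.mulLeft k (UniversalEnvelopingAlgebra.ι k (b i) ^ p) = c i • τ := by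
      refine B.ext fun f => ?_
      rw [LinearMap.comp_apply, LinearMap.mulLeft_apply, hB,
        pow_mul_mon p (fun i => UniversalEnvelopingAlgebra.ι k (b i)) l hl i (hmem i)
          (fun j => hcomm i hi _), ← hB, ← hB, hτB, LinearMap.smul_apply, hτB,
        cof_update p T c l hl i (hmem i) hi, redT_update p T i hi, mul_smul]
    exact DFunLike.congr_fun this u
  have key : ∀ u v, r u v → ∀ a b, τ (a * u * b) = τ (a * v * b) := by
    intro u v huv a d
    obtain ⟨i, hi, rfl, rfl⟩ := hr u v huv
    rw [← (hcomm i hi a).eq, mul_assoc, hτ i hi, ← Algebra.commutes, mul_assoc,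
      ← Algebra.smul_def, map_smul]
  have hker : ∀ u, RingQuot.mkAlgHom k r u = 0 → τ u = 0 := fun u hu => by
    rw [map_eq_of_mkAlgHom_eq r τ key (hu.trans (map_zero _).symm), map_zero]
  have hmon : ∀ f, mon (fun i => RingQuot.mkAlgHom k r (UniversalEnvelopingAlgebra.ι k (b i))) l f
      = RingQuot.mkAlgHom k r (B f) := by
    intro f
    rw [hB, map_mon]
  rw [linearIndependent_iff]
  intro g hg
  have h1 : RingQuot.mkAlgHom k r (Finsupp.linearCombination k (fun f : TExp p T => B f.1) g) = 0 := by
    rw [← hg, Finsupp.linearCombination_apply, Finsupp.linearCombination_apply, Finsupp.sum,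
      Finsupp.sum, map_sum]
    simp only [map_smul, hmon]
  have h2 := hker _ h1
  rw [Finsupp.linearCombination_apply, Finsupp.sum, map_sum] at h2
  simp only [map_smul, hτB, cof_val, redT_val, one_smul] at h2
  rw [← h2]
  simpa [Finsupp.sum] using (Finsupp.sum_single g).symm

/-- The ordered monomials with truncated exponents span a reduced enveloping algebra. -/
theorem span_truncated (p : ℕ) [NeZero p] (y : I → 𝔩) (hy : Submodule.span k (Set.range y) = ⊤)
    (l : List I) (hl : l.Nodup) (hmem : ∀ i, i ∈ l) (T : Set I) (c : I → k)
    (r : UniversalEnvelopingAlgebra k 𝔩 → UniversalEnvelopingAlgebra k 𝔩 → Prop)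
    (hr : ∀ i ∈ T, RingQuot.mkAlgHom k r (UniversalEnvelopingAlgebra.ι k (y i)) ^ p =
      algebraMap k _ (c i)) :
    Submodule.span k (Set.range fun f : TExp p T =>
      mon (fun i => RingQuot.mkAlgHom k r (UniversalEnvelopingAlgebra.ι k (y i))) l f.1) = ⊤ := by
  have htop : LinearMap.range (RingQuot.mkAlgHom k r).toLinearMap = ⊤ :=
    LinearMap.range_eq_top.2 (RingQuot.mkAlgHom_surjective k r)
  rw [eq_top_iff, ← htop, LinearMap.range_eq_map, ← span_mon_env y hy l hl hmem,
    Submodule.map_span, Submodule.span_le]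
  rintro _ ⟨_, ⟨f, rfl⟩, rfl⟩
  rw [AlgHom.toLinearMap_apply, map_mon, mon_eq_cof_smul p T c _ hr]
  exact Submodule.smul_mem _ _ (Submodule.subset_span ⟨redT p T f, rfl⟩)

end Env

end PBW

/-! ### Root vectors and subalgebras of the Lie algebra -/

namespace ReductiveLie

variable {K ι X Y 𝔤 : Type*} [Field K] [Finite ι] [AddCommGroup X] [AddCommGroup Y]
  [LieRing 𝔤] [LieAlgebra K 𝔤] (D : ReductiveLie K ι X Y 𝔤)

theorem diff_tmul (μ : X) (c : K) (y : Y) :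
    D.diff μ (c ⊗ₜ y) = c * (D.P.toLinearMap μ y : K) := by
  simp [diff, mul_comm]

theorem lie_h_e_eq_diff (x : CartanAlg K Y) (α : ι) :
    ⁅D.h x, D.e α⁆ = D.diff (D.P.root α) x • D.e α := by
  induction x using TensorProduct.induction_on with
  | zero => simp
  | add x y hx hy => rw [map_add, add_lie, hx, hy, map_add, add_smul]
  | tmul c y =>
    have : (c ⊗ₜ[ℤ] y : CartanAlg K Y) = c • (1 ⊗ₜ y) := by simp [TensorProduct.smul_tmul']
    rw [this, map_smul, smul_lie, D.lie_h_e, map_smul, D.diff_tmul, smul_eq_mul, one_mul, mul_smul,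
      Int.cast_smul_eq_zsmul]

theorem span_eq_top :
    Submodule.span K (Set.range D.h ∪ Set.range D.e) = ⊤ := by
  rw [eq_top_iff]
  intro z _
  obtain ⟨⟨x, f⟩, rfl⟩ := D.bijective.2 z
  rw [LinearMap.coprod_apply]
  refine add_mem (Submodule.subset_span (Or.inl ⟨x, rfl⟩)) ?_
  exact Submodule.span_mono Set.subset_union_right
    (by rw [← Finsupp.range_linearCombination]; exact ⟨f, rfl⟩)

section

attribute [local instance] LieRing.ofAssociativeRing

/-- Roots on the `α`-line through `β` form an unbroken string, so moving up by `n` steps adds `n` to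
the distance from the bottom. -/
theorem chainBotCoeff_of_root_eq [D.P.IsReduced] {α β γ : ι}
    (hli : LinearIndependent ℤ ![D.P.root α, D.P.root β])
    (n : ℕ) (hγ : D.P.root γ = D.P.root β + n • D.P.root α) :
    D.P.chainBotCoeff α γ = D.P.chainBotCoeff α β + n := by
  have hli' : LinearIndependent ℤ ![D.P.root α, D.P.root γ] := by
    rw [LinearIndependent.pair_iff] at hli ⊢
    intro s t h
    have := hli (s + t * n) t (by rw [← h, hγ]; simp only [← natCast_zsmul]; module)
    refine ⟨?_, this.2⟩
    simpa [this.2] using this.1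
  have htop : n ≤ D.P.chainTopCoeff α β := by
    rw [← RootPairing.root_add_nsmul_mem_range_iff_le_chainTopCoeff hli, ← hγ]
    exact ⟨γ, rfl⟩
  refine eq_of_forall_le_iff fun m => ?_
  rw [← RootPairing.root_sub_nsmul_mem_range_iff_le_chainBotCoeff hli', hγ]
  have : D.P.root β + n • D.P.root α - m • D.P.root α =
      D.P.root β + ((n : ℤ) - m) • D.P.root α := by
    simp only [← natCast_zsmul]; module
  rw [this, RootPairing.root_add_zsmul_mem_range_iff hli, Set.mem_Icc]
  omega

/-- Along the `α`-string the structure constants are, up to sign, `q + 1, q + 2, …` with `q` the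
distance of `β` from the bottom. Their product is the rising factorial, and `z` collects the signs.
-/
theorem ad_pow_e (α β : ι) (hli : LinearIndependent ℤ ![D.P.root α, D.P.root β]) (n : ℕ) :
    ((LieAlgebra.ad K 𝔤 (D.e α)) ^ n) (D.e β) = 0 ∨ ∃ (γ : ι) (z : ℤ),
      D.P.root γ = D.P.root β + n • D.P.root α ∧
      ((LieAlgebra.ad K 𝔤 (D.e α)) ^ n) (D.e β) =
        (z * ((D.P.chainBotCoeff α β + 1).ascFactorial n : ℤ)) • D.e γ := by
  have _ := D.isReduced
  induction n with
  | zero => exact Or.inr ⟨β, 1, by simp, by simp⟩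
  | succ n ih =>
    rw [pow_succ', Module.End.mul_apply]
    rcases ih with h | ⟨γ, z, hγ, h⟩
    · left; rw [h, map_zero]
    · rw [h, map_zsmul, LieAlgebra.ad_apply]
      have hsum : D.P.root α + D.P.root γ = D.P.root β + (n + 1) • D.P.root α := by
        rw [hγ]; module
      by_cases hr : D.P.root α + D.P.root γ ∈ Set.range D.P.root
      · right
        obtain ⟨δ, hδ⟩ := hr
        have hc := D.chainBotCoeff_of_root_eq hli n hγ
        have hasc : ((D.P.chainBotCoeff α β + 1).ascFactorial (n + 1) : ℤ) =
            (D.P.chainBotCoeff α γ + 1) * ((D.P.chainBotCoeff α β + 1).ascFactorial n : ℤ) := by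
          rw [Nat.ascFactorial_succ, hc]; push_cast; ring
        rcases D.lie_e_e α γ δ hδ.symm with h' | h'
        · refine ⟨δ, z, hδ.trans hsum, ?_⟩
          rw [h', ← natCast_zsmul, smul_smul, hasc]
          congr 1; push_cast; ring
        · refine ⟨δ, -z, hδ.trans hsum, ?_⟩
          rw [h', ← natCast_zsmul, ← neg_smul, smul_smul, hasc]
          congr 1; push_cast; ring
      · left
        rw [D.lie_e_e_zero α γ ?_ hr, smul_zero]
        rw [hsum]
        intro h0
        rw [LinearIndependent.pair_iff] at hli
        have := hli (n + 1) 1 (by rw [← h0]; module)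
        simp at this

/-- The `p`-th power of the adjoint action of a root vector vanishes in characteristic `p`. -/
theorem ad_e_pow_char (p : ℕ) [Fact p.Prime] [CharP K p] (α : ι) (z : 𝔤) :
    ((LieAlgebra.ad K 𝔤 (D.e α)) ^ p) z = 0 := by
  have _ := D.isReduced
  have hp2 : 2 ≤ p := (Fact.out : p.Prime).two_le
  have hz : z ∈ Submodule.span K (Set.range D.h ∪ Set.range D.e) := by
    rw [D.span_eq_top]; trivial
  have hge : ∀ m y, m ≤ p → ((LieAlgebra.ad K 𝔤 (D.e α)) ^ m) y = 0 →
      ((LieAlgebra.ad K 𝔤 (D.e α)) ^ p) y = 0 := by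
    intro m y hm h
    rw [← Nat.sub_add_cancel hm, pow_add, Module.End.mul_apply, h, map_zero]
  have hh : ∀ x, ⁅D.e α, D.h x⁆ = -(D.diff (D.P.root α) x • D.e α) := fun x => by
    rw [← lie_skew, D.lie_h_e_eq_diff]
  induction hz using Submodule.span_induction with
  | zero => simp
  | add x y _ _ hx hy => rw [map_add, hx, hy, add_zero]
  | smul a x _ hx => rw [map_smul, hx, smul_zero]
  | mem y hy =>
    rcases hy with ⟨x, rfl⟩ | ⟨β, rfl⟩
    · refine hge 2 _ hp2 ?_
      rw [pow_two, Module.End.mul_apply, LieAlgebra.ad_apply, LieAlgebra.ad_apply, hh, lie_neg,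
        lie_smul, lie_self, smul_zero, neg_zero]
    · by_cases h1 : α = β
      · subst h1
        refine hge 1 _ (by omega) ?_
        rw [pow_one, LieAlgebra.ad_apply, lie_self]
      by_cases h2 : D.P.root α = -D.P.root β
      · have h2' : D.P.root β = -D.P.root α := by rw [h2, neg_neg]
        have e2 : ((LieAlgebra.ad K 𝔤 (D.e α)) ^ 2) (D.e β) = -((2 : K) • D.e α) := by
          rw [pow_two, Module.End.mul_apply, LieAlgebra.ad_apply, LieAlgebra.ad_apply,
            D.lie_e_neg α β h2', hh, D.diff_tmul]
          have : D.P.toLinearMap (D.P.root α) (D.P.coroot α) = 2 := D.P.root_coroot_two α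
          rw [this]
          norm_num
        rcases hp2.eq_or_lt with h | h
        · refine hge 2 _ hp2 ?_
          -- For `p = 2` the square of `ad e_α` on `e_{-α}` is `-2 e_α`, which vanishes only because
          -- of the characteristic; for `p ≥ 3` the cube is already zero.
          have : (2 : K) = 0 := by
            have := CharP.cast_eq_zero K p
            rw [← h] at this
            exact_mod_cast this
          rw [e2, this, zero_smul, neg_zero]
        · refine hge 3 _ h ?_
          rw [pow_succ', Module.End.mul_apply, e2, LieAlgebra.ad_apply, lie_neg, lie_smul, lie_self,
            smul_zero, neg_zero]
      · have hli := RootPairing.IsReduced.linearIndependent D.P h1 h2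
        rcases D.ad_pow_e α β hli p with h | ⟨γ, z, -, h⟩
        · exact h
        · have hd : p ∣ (D.P.chainBotCoeff α β + 1).ascFactorial p :=
            (Nat.dvd_factorial (by omega) le_rfl).trans (Nat.factorial_dvd_ascFactorial _ _)
          rw [h, ← Int.cast_smul_eq_zsmul K, Int.cast_mul, Int.cast_natCast,
            (CharP.cast_eq_zero_iff K p _).2 hd, mul_zero, zero_smul]

end

end ReductiveLie

namespace StdLevi

variable {K ι X Y 𝔤 : Type*} [Field K] [Finite ι] [AddCommGroup X] [AddCommGroup Y]
  [LieRing 𝔤] [LieAlgebra K 𝔤] {D : ReductiveLie K ι X Y 𝔤} (L : StdLevi D)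

/-- A set of roots which is closed under addition. -/
def IsClosedSet (D : ReductiveLie K ι X Y 𝔤) (S : Set ι) : Prop :=
  ∀ α ∈ S, ∀ β ∈ S, ∀ γ, D.P.root α + D.P.root β = D.P.root γ → γ ∈ S

theorem isClosedSet_empty : IsClosedSet D ∅ := fun _ h => h.elim

theorem isClosedSet_univ : IsClosedSet D Set.univ := fun _ _ _ _ _ _ => trivial

theorem exists_coeff_of_mem_ZI {x : X} (hx : x ∈ L.ZI) :
    ∃ a : ι → ℤ, (∀ i ∉ L.I, a i = 0) ∧ x = ∑ i ∈ D.b.support, a i • D.P.root i := by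
  classical
  induction hx using AddSubgroup.closure_induction with
  | mem x hx =>
    obtain ⟨i, hi, rfl⟩ := hx
    refine ⟨Pi.single i 1, fun j hj => Pi.single_eq_of_ne (by rintro rfl; exact hj hi) _, ?_⟩
    rw [Finset.sum_eq_single_of_mem i (L.I_subset hi)]
    · simp
    · intro j _ hj
      simp [Pi.single_eq_of_ne hj]
  | zero => exact ⟨0, by simp, by simp⟩
  | add x y _ _ hx hy =>
    obtain ⟨a, ha, rfl⟩ := hx
    obtain ⟨c, hc, rfl⟩ := hy
    exact ⟨a + c, fun i hi => by simp [ha i hi, hc i hi], by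
      simp [add_smul, Finset.sum_add_distrib]⟩
  | neg x _ hx =>
    obtain ⟨a, ha, rfl⟩ := hx
    exact ⟨-a, fun i hi => by simp [ha i hi], by simp⟩

/-- The essential case is a root of `ℤI` plus a positive root with negative sum. A simple root
outside `I` then has a coefficient in the sum that is both nonnegative and nonpositive, hence zero,
so the sum lies in `ℤI`. -/
theorem isClosedSet_RP : IsClosedSet D L.RP := by
  have key : ∀ α β γ, D.P.root α ∈ L.ZI → D.b.IsPos β → D.P.root α + D.P.root β = D.P.root γ →
      γ ∈ L.RP := by
    intro α β γ hα hβ h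
    by_contra hγ
    simp only [RP, Set.mem_ofPred_eq, not_or] at hγ
    obtain ⟨a, ha, hαa⟩ := L.exists_coeff_of_mem_ZI hα
    obtain ⟨f, -, hf, hβf⟩ := D.b.exists_root_eq_sum_int β
    obtain ⟨g, -, hg, hγg⟩ := D.b.exists_root_eq_sum_int γ
    have hf0 : 0 ≤ f := by
      rcases hf with hf | hf
      · exact hf.le
      · rw [RootPairing.Base.isPos_iff, RootPairing.Base.height_eq_sum hβf] at hβ
        exact absurd hβ (not_lt.2 (Finset.sum_nonpos fun i _ => hf.le i))
    have hg0 : g ≤ 0 := by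
      rcases hg with hg | hg
      · refine absurd ?_ hγ.2
        rw [RootPairing.Base.isPos_iff', RootPairing.Base.height_eq_sum hγg]
        exact Finset.sum_nonneg fun i _ => hg.le i
      · exact hg.le
    have hli := linearIndepOn_finset_iff.1 D.b.linearIndepOn_root (fun i => a i + f i - g i) (by
      simp only [sub_smul, add_smul, Finset.sum_sub_distrib, Finset.sum_add_distrib]
      rw [← hαa, ← hβf, ← hγg, h, sub_self])
    refine hγ.1 ?_
    rw [hγg]
    refine AddSubgroup.sum_mem _ fun i hi => ?_
    by_cases hI : i ∈ L.I
    · have : D.P.root i ∈ L.ZI := AddSubgroup.subset_closure ⟨i, hI, rfl⟩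
      exact AddSubgroup.zsmul_mem _ this _
    · have h1 := hli i hi
      have h2 := hf0 i
      have h3 := hg0 i
      simp only [ha i hI, Pi.zero_apply] at h1 h2 h3
      rw [show g i = 0 by omega, zero_smul]
      exact zero_mem _
  rintro α (hα | hα) β (hβ | hβ) γ h
  · exact Or.inl (by rw [← h]; exact add_mem hα hβ)
  · exact key α β γ hα hβ h
  · exact key β α γ hβ hα (by rw [add_comm, h])
  · exact Or.inr (RootPairing.Base.IsPos.add hα hβ h.symm)

/-- For a closed set of roots the Lie subalgebra generated by `𝔥` and its root vectors is just their
linear span, which gives `𝔤_S` an explicit basis. -/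
theorem lie_mem_span_of_closed {S : Set ι} (hS : IsClosedSet D S) {x y : 𝔤}
    (hx : x ∈ Submodule.span K (Set.range D.h ∪ D.e '' S))
    (hy : y ∈ Submodule.span K (Set.range D.h ∪ D.e '' S)) :
    ⁅x, y⁆ ∈ Submodule.span K (Set.range D.h ∪ D.e '' S) := by
  have hh : ∀ x, ∀ α ∈ S, ⁅D.h x, D.e α⁆ ∈ Submodule.span K (Set.range D.h ∪ D.e '' S) :=
    fun x α hα => by
      rw [D.lie_h_e_eq_diff]
      exact Submodule.smul_mem _ _ (Submodule.subset_span (Or.inr ⟨α, hα, rfl⟩))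
  induction hx, hy using Submodule.span_induction₂ with
  | zero_left => rw [zero_lie]; exact zero_mem _
  | zero_right => rw [lie_zero]; exact zero_mem _
  | add_left _ _ _ _ _ _ h1 h2 => rw [add_lie]; exact add_mem h1 h2
  | add_right _ _ _ _ _ _ h1 h2 => rw [lie_add]; exact add_mem h1 h2
  | smul_left _ _ _ _ _ h => rw [smul_lie]; exact Submodule.smul_mem _ _ h
  | smul_right _ _ _ _ _ h => rw [lie_smul]; exact Submodule.smul_mem _ _ h
  | mem_mem x y hx hy =>
    rcases hx with ⟨x, rfl⟩ | ⟨α, hα, rfl⟩ <;> rcases hy with ⟨y, rfl⟩ | ⟨β, hβ, rfl⟩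
    · rw [D.lie_h_h]; exact zero_mem _
    · exact hh _ _ hβ
    · rw [← lie_skew]; exact neg_mem (hh _ _ hα)
    · by_cases h0 : D.P.root α + D.P.root β = 0
      · rw [D.lie_e_neg α β (eq_neg_of_add_eq_zero_right h0)]
        exact Submodule.subset_span (Or.inl ⟨_, rfl⟩)
      · by_cases hr : D.P.root α + D.P.root β ∈ Set.range D.P.root
        · obtain ⟨γ, hγ⟩ := hr
          have hm : D.e γ ∈ Submodule.span K (Set.range D.h ∪ D.e '' S) :=
            Submodule.subset_span (Or.inr ⟨γ, hS α hα β hβ γ hγ.symm, rfl⟩)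
          rcases D.lie_e_e α β γ hγ.symm with h | h
          · rw [h]; exact nsmul_mem hm _
          · rw [h]; exact neg_mem (nsmul_mem hm _)
        · rw [D.lie_e_e_zero α β h0 hr]; exact zero_mem _

theorem mem_span_of_mem_gS {S : Set ι} (hS : IsClosedSet D S) {x : 𝔤} (hx : x ∈ L.gS S) :
    x ∈ Submodule.span K (Set.range D.h ∪ D.e '' S) := by
  let W : LieSubalgebra K 𝔤 :=
    { Submodule.span K (Set.range D.h ∪ D.e '' S) with
      lie_mem' := fun hx hy => lie_mem_span_of_closed hS hx hy }
  have : L.gS S ≤ W := LieSubalgebra.lieSpan_le.2 Submodule.subset_span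
  exact this hx

/-- The generators of `𝔤_S`: its root vectors and the images of a family in `𝔥`. -/
def gen {S : Set ι} {J : Type*} (y : J → CartanAlg K Y) : S ⊕ J → L.gS S :=
  Sum.elim (fun α => L.eS α.1 α.2) (fun j => L.hS S (y j))

theorem span_gen {S : Set ι} (hS : IsClosedSet D S) {J : Type*} (y : J → CartanAlg K Y)
    (hy : Submodule.span K (Set.range y) = ⊤) :
    Submodule.span K (Set.range (L.gen (S := S) y)) = ⊤ := by
  rw [eq_top_iff]
  rintro ⟨x, hx⟩ -
  have h1 := L.mem_span_of_mem_gS hS hx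
  have h2 : Submodule.span K (Set.range D.h ∪ D.e '' S) ≤
      (Submodule.span K (Set.range (L.gen (S := S) y))).map (L.gS S).toSubmodule.subtype := by
    rw [Submodule.span_le]
    rintro _ (⟨x, rfl⟩ | ⟨α, hα, rfl⟩)
    · have hx : x ∈ Submodule.span K (Set.range y) := by rw [hy]; trivial
      rw [SetLike.mem_coe]
      induction hx using Submodule.span_induction with
      | mem x hx =>
        obtain ⟨j, rfl⟩ := hx
        exact ⟨_, Submodule.subset_span ⟨Sum.inr j, rfl⟩, rfl⟩
      | zero => rw [map_zero]; exact zero_mem _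
      | add x y _ _ hx hy => rw [map_add]; exact add_mem hx hy
      | smul a x _ hx => rw [map_smul]; exact Submodule.smul_mem _ _ hx
    · exact ⟨_, Submodule.subset_span ⟨Sum.inl ⟨α, hα⟩, rfl⟩, rfl⟩
  obtain ⟨z, hz, hzx⟩ := h2 h1
  have : z = ⟨x, hx⟩ := Subtype.ext hzx
  rwa [← this]

theorem linearIndependent_gen {S : Set ι} {J : Type*} (y : J → CartanAlg K Y)
    (hy : LinearIndependent K y) : LinearIndependent K (L.gen (S := S) y) := by
  refine LinearIndependent.of_comp (L.gS S).toSubmodule.subtype ?_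
  have h1 : LinearIndependent K (fun α : S => Finsupp.single (α : ι) (1 : K)) :=
    (Finsupp.linearIndependent_single_one K ι).comp _ Subtype.val_injective
  have hcomp : ∀ i, ((L.gS S).toSubmodule.subtype ∘ L.gen y) i =
      LinearMap.coprod D.h (Finsupp.linearCombination K D.e) (Sum.elim
        (fun α : S => ((0 : CartanAlg K Y), Finsupp.single (α : ι) (1 : K)))
        (fun j => (y j, 0)) i) := by
    rintro (α | j)
    · simp only [Sum.elim_inl, LinearMap.coprod_apply, map_zero, zero_add,
        Finsupp.linearCombination_single, one_smul]
      rfl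
    · simp only [Sum.elim_inr, LinearMap.coprod_apply, map_zero, add_zero]
      rfl
  rw [funext hcomp]
  refine LinearIndependent.map' (f := LinearMap.coprod D.h (Finsupp.linearCombination K D.e)) ?_
    (LinearMap.ker_eq_bot.2 D.bijective.1)
  have h2 := (linearIndependent_inl_union_inr' hy h1).comp Sum.swap Sum.swap_leftInverse.injective
  have h3 : (Sum.elim (fun α : S => ((0 : CartanAlg K Y), Finsupp.single (α : ι) (1 : K)))
      (fun j => (y j, 0))) = Sum.elim (LinearMap.inl K (CartanAlg K Y) (ι →₀ K) ∘ y)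
      (LinearMap.inr K (CartanAlg K Y) (ι →₀ K) ∘ fun α : S => Finsupp.single (α : ι) (1 : K)) ∘
        Sum.swap := by
    funext i
    rcases i with α | j <;> rfl
  exact h3 ▸ h2

end StdLevi

/-! ### Freeness of the reduced enveloping algebra over subalgebras -/

namespace PBW

theorem mon_map {R I I' : Type*} [Monoid R] (x : I → R) (φ : I' → I) (l : List I') (f : I → ℕ) :
    mon x (l.map φ) f = mon (fun i => x (φ i)) l (fun i => f (φ i)) := by
  simp only [mon, List.map_map]
  rfl

theorem mon_append {R I : Type*} [Monoid R] (x : I → R) (l l' : List I) (f : I → ℕ) :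
    mon x (l ++ l') f = mon x l f * mon x l' f := by
  simp [mon]

end PBW

namespace StdLevi

open PBW

attribute [local instance] LieRing.ofAssociativeRing

variable {K ι X Y 𝔤 : Type*} [Field K] [Finite ι] [AddCommGroup X] [AddCommGroup Y]
  [LieRing 𝔤] [LieAlgebra K 𝔤] {D : ReductiveLie K ι X Y 𝔤} (L : StdLevi D)

theorem toUS_pow (p : ℕ) {S : Set ι} (α : ι) (hα : α ∈ S) :
    L.toUS p S (L.eS α hα) ^ p = algebraMap K _ (L.χ (D.e α) ^ p) := by
  have := RingQuot.mkAlgHom_rel K (URel.pow (L := L) (p := p) α hα)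
  rwa [map_pow, AlgHom.commutes] at this

theorem inclUS_toUS (p : ℕ) {S T : Set ι} (hST : S ⊆ T) (x : L.gS S) :
    L.inclUS p hST (L.toUS p S x) = L.toUS p T (LieSubalgebra.inclusion (L.gS_mono hST) x) := by
  rw [inclUS, toUS, RingQuot.liftAlgHom_mkAlgHom_apply, AlgHom.comp_apply,
    UniversalEnvelopingAlgebra.lift_ι_apply]
  rfl

theorem span_mon_US (p : ℕ) [NeZero p] {S : Set ι} (hS : IsClosedSet D S) {J : Type*}
    (y : J → CartanAlg K Y) (hy : Submodule.span K (Set.range y) = ⊤) (l : List (S ⊕ J))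
    (hl : l.Nodup) (hmem : ∀ i, i ∈ l) :
    Submodule.span K (Set.range fun f : TExp p (Set.range (Sum.inl : S → S ⊕ J)) =>
      mon (fun i => L.toUS p S (L.gen y i)) l f.1) = ⊤ := by
  refine span_truncated p (L.gen y) (L.span_gen hS y hy) l hl hmem _
    (Sum.elim (fun α => L.χ (D.e α) ^ p) (fun _ => 0)) _ ?_
  rintro _ ⟨α, rfl⟩
  exact L.toUS_pow p α.1 α.2

theorem linearIndependent_mon_US (p : ℕ) [Fact p.Prime] [CharP K p] {J : Type*}
    (y : Module.Basis J K (CartanAlg K Y)) (l : List ((Set.univ : Set ι) ⊕ J))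
    (hl : l.Nodup) (hmem : ∀ i, i ∈ l) :
    LinearIndependent K fun f : TExp p (Set.range (@Sum.inl (Set.univ : Set ι) J)) =>
      mon (fun i => L.toUS p Set.univ (L.gen y i)) l f.1 := by
  let b : Module.Basis ((Set.univ : Set ι) ⊕ J) K (L.gS Set.univ) :=
    Module.Basis.mk (L.linearIndependent_gen y y.linearIndependent)
      (L.span_gen isClosedSet_univ y y.span_eq).ge
  have hb : ∀ i, b i = L.gen y i := fun i => by simp [b]
  have := linearIndependent_truncated p b l hl hmem (Set.range Sum.inl)
    (Sum.elim (fun α => L.χ (D.e α) ^ p) (fun _ => 0)) ?_ (L.URel p Set.univ) ?_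
  · simp only [hb] at this
    exact this
  · rintro _ ⟨α, rfl⟩ z
    have h : ∀ n : ℕ, ((((LieAlgebra.ad K (L.gS Set.univ) (b (Sum.inl α))) ^ n) z :
        L.gS Set.univ) : 𝔤) = ((LieAlgebra.ad K 𝔤 (D.e α)) ^ n) z := by
      intro n
      induction n with
      | zero => rfl
      | succ n ih =>
        rw [pow_succ', Module.End.mul_apply, LieAlgebra.ad_apply, LieSubalgebra.coe_bracket, ih,
          pow_succ', Module.End.mul_apply, LieAlgebra.ad_apply, hb]
        rfl
    exact Subtype.ext ((h p).trans (D.ad_e_pow_char p α z))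
  · rintro _ _ ⟨α, hα⟩
    exact ⟨Sum.inl ⟨α, hα⟩, ⟨_, rfl⟩, by rw [hb]; rfl, rfl⟩

/-- A root vector as an element of `U_χ`. -/
abbrev eU (p : ℕ) (α : ι) : L.US p Set.univ := L.toUS p Set.univ (L.eS α (Set.mem_univ α))

/-- `U_χ` is a free right module over `U_S`, with a finite basis of products of root vectors. -/
theorem exists_free_US (p : ℕ) [Fact p.Prime] [CharP K p] [Module.Finite ℤ Y] {S : Set ι}
    (hS : IsClosedSet D S) : ∃ (n : ℕ) (E : Fin n → List ι),
      Function.Bijective fun c : Fin n → L.US p S =>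
        ∑ i, ((E i).map (L.eU p)).prod * L.inclUS p (Set.subset_univ S) (c i) := by
  classical
  have _ : NeZero p := ⟨(Fact.out : p.Prime).ne_zero⟩
  have _ := Fintype.ofFinite ι
  let y := Module.finBasis K (CartanAlg K Y)
  let J := Fin (Module.finrank K (CartanAlg K Y))
  let I := (Set.univ : Set ι) ⊕ J
  let T : Set I := Set.range Sum.inl
  let T' : Set (S ⊕ J) := Set.range Sum.inl
  let B := {α // α ∉ S} → Fin p
  let x : I → L.US p Set.univ := fun i => L.toUS p Set.univ (L.gen y i)
  let x' : S ⊕ J → L.US p S := fun i => L.toUS p S (L.gen y i)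
  let a : {α // α ∉ S} → I := fun α => Sum.inl ⟨α.1, trivial⟩
  let φ : S ⊕ J → I := Sum.map (fun α => ⟨α.1, trivial⟩) id
  let l₁ : List {α // α ∉ S} := Finset.univ.toList
  let l₂ : List (S ⊕ J) := Finset.univ.toList
  -- The root vectors outside `S` are placed first, so an ordered truncated monomial of `U_χ`
  -- factors as a product of these times a monomial coming from `U_S`.
  let l : List I := l₁.map a ++ l₂.map φ
  have ha : Function.Injective a := fun α β h => by
    have h' : (⟨α.1, trivial⟩ : (Set.univ : Set ι)) = ⟨β.1, trivial⟩ := Sum.inl.inj h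
    exact Subtype.ext (Subtype.mk.inj h')
  have hφ : Function.Injective φ := Sum.map_injective.2
    ⟨fun α β h => by simpa [Subtype.ext_iff] using h, Function.injective_id⟩
  have hl₂ : l₂.Nodup := Finset.nodup_toList _
  have hl₂m : ∀ i, i ∈ l₂ := fun i => by simp [l₂]
  have hl : l.Nodup := by
    refine List.Nodup.append ((Finset.nodup_toList _).map ha) (hl₂.map hφ) ?_
    intro i hi hi'
    obtain ⟨α, -, rfl⟩ := List.mem_map.1 hi
    obtain ⟨β | j, -, hβ⟩ := List.mem_map.1 hi'
    · have h' : (⟨β.1, trivial⟩ : (Set.univ : Set ι)) = ⟨α.1, trivial⟩ := Sum.inl.inj hβ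
      have : β.1 = α.1 := Subtype.mk.inj h'
      exact α.2 (this ▸ β.2)
    · simp [a, φ] at hβ
  have hlm : ∀ i, i ∈ l := by
    rintro (α | j)
    · by_cases h : α.1 ∈ S
      · exact List.mem_append_right _ (List.mem_map.2 ⟨Sum.inl ⟨α.1, h⟩, hl₂m _, rfl⟩)
      · exact List.mem_append_left _ (List.mem_map.2 ⟨⟨α.1, h⟩, by simp [l₁], rfl⟩)
    · exact List.mem_append_right _ (List.mem_map.2 ⟨Sum.inr j, hl₂m _, rfl⟩)
  let comb : B × TExp p T' → TExp p T := fun q =>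
    ⟨Sum.elim (fun α => if h : α.1 ∈ S then q.2.1 (Sum.inl ⟨α.1, h⟩) else q.1 ⟨α.1, h⟩)
      (fun j => q.2.1 (Sum.inr j)), by
      rintro _ ⟨α, rfl⟩
      simp only [Sum.elim_inl]
      split_ifs with h
      · exact q.2.2 _ ⟨_, rfl⟩
      · exact (q.1 _).2⟩
  have hcomb_a : ∀ q α, (comb q).1 (a α) = q.1 α := fun q α => by simp [comb, a, α.2]
  have hcomb_φ : ∀ q i, (comb q).1 (φ i) = q.2.1 i := by
    rintro q (α | j)
    · simp [comb, φ, α.2]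
    · simp [comb, φ]
  have hcomb : Function.Injective comb := by
    intro q q' h
    refine Prod.ext (funext fun α => Fin.ext ?_) (Subtype.ext (funext fun i => ?_))
    · rw [← hcomb_a, ← hcomb_a, h]
    · rw [← hcomb_φ, ← hcomb_φ, h]
  let E : B → L.US p Set.univ := fun g => mon (fun α => x (a α)) l₁ fun α => g α
  have hx : ∀ i, L.inclUS p (Set.subset_univ S) (x' i) = x (φ i) := by
    rintro (α | j)
    · exact L.inclUS_toUS p _ _
    · exact L.inclUS_toUS p _ _
  have hmon : ∀ q, mon x l (comb q).1 =
      E q.1 * L.inclUS p (Set.subset_univ S) (mon x' l₂ q.2.1) := by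
    intro q
    rw [mon_append, mon_map, mon_map, map_mon]
    simp only [hcomb_a, hcomb_φ, hx, E]
  have hli : LinearIndependent K fun q : B × TExp p T' =>
      E q.1 * L.inclUS p (Set.subset_univ S) (mon x' l₂ q.2.1) := by
    have := (L.linearIndependent_mon_US p y l hl hlm).comp comb hcomb
    convert this using 1
    funext q
    exact (hmon q).symm
  -- In `U_S` only the spanning property of the monomials is needed: independence of the products in
  -- `U_χ` then forces all coefficients to vanish.
  have hspan : ∀ u : L.US p S, ∃ f : TExp p T' →₀ K,
      Finsupp.linearCombination K (fun f : TExp p T' => mon x' l₂ f.1) f = u := by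
    intro u
    have := L.span_mon_US p hS y y.span_eq l₂ hl₂ hl₂m
    rw [← Finsupp.range_linearCombination, LinearMap.range_eq_top] at this
    exact this u
  let Φ : (B → L.US p S) →ₗ[K] L.US p Set.univ :=
    { toFun := fun c => ∑ g, E g * L.inclUS p (Set.subset_univ S) (c g)
      map_add' := fun c d => by simp [mul_add, Finset.sum_add_distrib]
      map_smul' := fun t c => by simp [Finset.smul_sum] }
  have hΦ : Function.Bijective Φ := by
    constructor
    · rw [← LinearMap.ker_eq_bot, LinearMap.ker_eq_bot']
      intro c hc
      choose f hf using fun g => hspan (c g)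
      let F : B × TExp p T' →₀ K := ∑ g, (f g).mapDomain (Prod.mk g)
      have hF : F = 0 := by
        refine (linearIndependent_iff.1 hli) F ?_
        rw [map_sum, ← hc]
        refine Finset.sum_congr rfl fun g _ => ?_
        rw [Finsupp.linearCombination_mapDomain, ← hf g, Finsupp.linearCombination_apply,
          Finsupp.linearCombination_apply, Finsupp.sum, Finsupp.sum, map_sum, Finset.mul_sum]
        refine Finset.sum_congr rfl fun i _ => ?_
        rw [map_smul, mul_smul_comm]
        rfl
      funext g
      have hfg : f g = 0 := by
        ext i
        have h1 : F (g, i) = f g i := by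
          rw [Finsupp.finsetSum_apply, Finset.sum_eq_single g]
          · exact Finsupp.mapDomain_apply (Prod.mk_right_injective g) _ _
          · intro g' _ hg'
            refine Finsupp.mapDomain_of_notMem_range _ _ ?_
            rintro ⟨j, hj⟩
            exact hg' (congrArg Prod.fst hj)
          · simp
        rw [← h1, hF]
        rfl
      rw [← hf g, hfg, map_zero]
      rfl
    · rw [← LinearMap.range_eq_top, eq_top_iff,
        ← L.span_mon_US p isClosedSet_univ y y.span_eq l hl hlm, Submodule.span_le]
      rintro _ ⟨f, rfl⟩
      let q : B × TExp p T' := ⟨fun α => ⟨f.1 (a α), f.2 _ ⟨_, rfl⟩⟩, ⟨fun i => f.1 (φ i), by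
        rintro _ ⟨α, rfl⟩
        exact f.2 _ ⟨_, rfl⟩⟩⟩
      have hq : comb q = f := by
        refine Subtype.ext (funext ?_)
        rintro (α | j)
        · simp only [comb, q, Sum.elim_inl, a, φ]
          split_ifs <;> rfl
        · rfl
      refine ⟨Pi.single q.1 (mon x' l₂ q.2.1), ?_⟩
      change ∑ g, E g * L.inclUS p (Set.subset_univ S)
        ((Pi.single q.1 (mon x' l₂ q.2.1) : B → L.US p S) g) = mon x l f.1
      rw [← hq, hmon, Finset.sum_eq_single q.1]
      · rw [Pi.single_eq_same]
      · intro g _ hg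
        rw [Pi.single_eq_of_ne hg, map_zero, mul_zero]
      · simp
  let ε := Fintype.equivFin B
  refine ⟨Fintype.card B, fun i => (l₁.map fun α => List.replicate (ε.symm i α) α.1).flatten, ?_⟩
  have hE : ∀ i, (((l₁.map fun α => List.replicate (ε.symm i α : ℕ) α.1).flatten).map
      (L.eU p)).prod = E (ε.symm i) := by
    intro i
    simp only [E]
    rw [mon_eq_word]
    simp only [List.map_flatten, List.map_map]
    congr 2
    refine List.map_congr_left fun α _ => ?_
    simp only [Function.comp_apply, List.map_replicate]
    rfl
  have := hΦ.comp (Equiv.arrowCongr ε.symm (Equiv.refl (L.US p S))).bijective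
  convert this using 1
  funext c
  simp only [hE]
  exact Fintype.sum_equiv ε.symm _
    (fun g => E g * L.inclUS p (Set.subset_univ S) (c (ε.symm.symm g))) (by simp)

end StdLevi

/-! ### The action of the reduced enveloping algebra and induced objects -/

namespace StdLevi

attribute [local instance] LieRing.ofAssociativeRing

variable {K ι X Y 𝔤 : Type*} [Field K] [Finite ι] [AddCommGroup X] [AddCommGroup Y]
  [LieRing 𝔤] [LieAlgebra K 𝔤] {D : ReductiveLie K ι X Y 𝔤} (L : StdLevi D)

/-- Since `U_S` is generated by `𝔤_S`, identities multiplicative and additive in `u` need checking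
only on scalars and on the Lie algebra. -/
theorem US_induction {p : ℕ} {S : Set ι} {C : L.US p S → Prop}
    (h_alg : ∀ c : K, C (algebraMap K _ c)) (h_gen : ∀ x, C (L.toUS p S x))
    (h_add : ∀ u v, C u → C v → C (u + v)) (h_mul : ∀ u v, C u → C v → C (u * v))
    (u : L.US p S) : C u := by
  obtain ⟨u, rfl⟩ := RingQuot.mkAlgHom_surjective K (L.URel p S) u
  have hu : u ∈ Algebra.adjoin K
      (Set.range (UniversalEnvelopingAlgebra.ι K : L.gS S →ₗ⁅K⁆ _)) := by
    rw [PBW.adjoin_range_ι]; trivial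
  induction hu using Algebra.adjoin_induction with
  | mem y hy =>
    obtain ⟨y, rfl⟩ := hy
    exact h_gen y
  | algebraMap a => rw [AlgHom.commutes]; exact h_alg a
  | add y z _ _ hy hz => rw [map_add]; exact h_add _ _ hy hz
  | mul y z _ _ hy hz => rw [map_mul]; exact h_mul _ _ hy hz

theorem toUS_add (p : ℕ) (S : Set ι) (x y : L.gS S) :
    L.toUS p S (x + y) = L.toUS p S x + L.toUS p S y := by
  rw [toUS, map_add, map_add]; rfl

theorem toUS_smul (p : ℕ) (S : Set ι) (c : K) (x : L.gS S) :
    L.toUS p S (c • x) = c • L.toUS p S x := by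
  rw [toUS, map_smul, map_smul]; rfl

theorem toUS_lie (p : ℕ) (S : Set ι) (x y : L.gS S) :
    L.toUS p S ⁅x, y⁆ = L.toUS p S x * L.toUS p S y - L.toUS p S y * L.toUS p S x := by
  rw [toUS, LieHom.map_lie, LieRing.of_associative_ring_bracket, map_sub, map_mul, map_mul]; rfl

end StdLevi

namespace CMod

variable {K : Type u} {ι X Y 𝔤 : Type*} [Field K] [Finite ι] [AddCommGroup X] [AddCommGroup Y]
  [LieRing 𝔤] [LieAlgebra K 𝔤] {D : ReductiveLie K ι X Y 𝔤}
  {p : ℕ} {L : StdLevi D} {S : Set ι} {A : Type u} [CommRing A] [Algebra K A]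
  {π : CartanAlg K Y →ₗ[K] A}

attribute [local instance] LieRing.ofAssociativeRing in
theorem act_toUS (M : CMod p L S A π) (x : L.gS S) : M.act (L.toUS p S x) = M.ρ x := by
  let _ : Algebra K (Module.End A M) :=
    ((algebraMap A (Module.End A M)).comp (algebraMap K A)).toAlgebra' fun c f => by
      ext m; simp
  exact (RingQuot.liftAlgHom_mkAlgHom_apply K _ _ _).trans
    (UniversalEnvelopingAlgebra.lift_ι_apply K _ x)

attribute [local instance] LieRing.ofAssociativeRing in
theorem act_algebraMap (M : CMod p L S A π) (c : K) (m : M) :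
    M.act (algebraMap K _ c) m = algebraMap K A c • m := by
  let _ : Algebra K (Module.End A M) :=
    ((algebraMap A (Module.End A M)).comp (algebraMap K A)).toAlgebra' fun c f => by
      ext m; simp
  have : M.act (algebraMap K _ c) = algebraMap K (Module.End A M) c := AlgHom.commutes _ c
  rw [this]
  rfl

theorem act_mul (M : CMod p L S A π) (u v : L.US p S) (m : M) :
    M.act (u * v) m = M.act u (M.act v m) := by
  rw [map_mul, Module.End.mul_apply]

theorem lin_act {M N : CMod p L S A π} (f : M ⟶ N) (u : L.US p S) (m : M) :
    lin f (M.act u m) = N.act u (lin f m) := by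
  induction u using L.US_induction generalizing m with
  | h_alg c => rw [act_algebraMap, act_algebraMap, map_smul]
  | h_gen x => rw [act_toUS, act_toUS, lin_ρ]
  | h_add u v hu hv => rw [map_add, map_add, LinearMap.add_apply, map_add, hu, hv]; rfl
  | h_mul u v hu hv => rw [act_mul, act_mul, hu, hv]

theorem res_act {T : Set ι} (hST : S ⊆ T) (M : CMod p L T A π) (u : L.US p S) (m : M) :
    (M.res hST).act u m = M.act (L.inclUS p hST u) m := by
  induction u using L.US_induction generalizing m with
  | h_alg c =>
    rw [AlgHom.commutes, act_algebraMap]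
    exact act_algebraMap (M.res hST) c m
  | h_gen x =>
    rw [act_toUS, L.inclUS_toUS, act_toUS]
    rfl
  | h_add u v hu hv =>
    rw [map_add, map_add, map_add]
    exact congrArg₂ (· + ·) (hu m) (hv m)
  | h_mul u v hu hv =>
    exact (act_mul (M.res hST) u v m).trans
      (((congrArg ((M.res hST).act u) (hv m)).trans (hu _)).trans (by rw [map_mul, act_mul]))

theorem indMap_tmul {T : Set ι} (hST : S ⊆ T) {M : CMod p L S A π} {G : CMod p L T A π}
    (i : M ⟶ G.res hST) (u : L.US p T) (m : M) :
    indMap hST i (u ⊗ₜ m) = G.act u (show G from lin i m) := rfl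

theorem lin_isoRes_act {T : Set ι} (hST : S ⊆ T) {M : CMod p L S A π} {G : CMod p L T A π}
    (i : M ⟶ G.res hST) (u : L.US p S) (m : M) :
    (show G from lin i (M.act u m)) = G.act (L.inclUS p hST u) (show G from lin i m) := by
  rw [lin_act]
  exact res_act hST G u _

/-- An object induced from a projective module over the coefficients is projective over the
coefficients. -/
theorem projective_of_isInduced [Fact p.Prime] [CharP K p] [Module.Finite ℤ Y]
    (hS : StdLevi.IsClosedSet D S) {M : CMod p L S A π} {G : CMod p L Set.univ A π}
    (h : IsInduced (Set.subset_univ S) M G) (hM : Module.Projective A M) :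
    Module.Projective A G := by
  obtain ⟨n, E, hE⟩ := L.exists_free_US p hS
  obtain ⟨i, hsurj, hker⟩ := h
  let EU : Fin n → L.US p Set.univ := fun j => ((E j).map (L.eU p)).prod
  let Φ : (Fin n → L.US p S) →+ L.US p Set.univ :=
    { toFun := fun c => ∑ j, EU j * L.inclUS p (Set.subset_univ S) (c j)
      map_zero' := by simp
      map_add' := fun c d => by simp [mul_add, Finset.sum_add_distrib] }
  let Ψ : (Fin n → L.US p S) ≃+ L.US p Set.univ := AddEquiv.ofBijective Φ hE
  have hΨ : ∀ c, Ψ c = ∑ j, EU j * L.inclUS p (Set.subset_univ S) (c j) := fun _ => rfl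
  have hΨmul : ∀ u b, Ψ.symm (u * L.inclUS p (Set.subset_univ S) b) =
      fun j => Ψ.symm u j * b := by
    intro u b
    rw [AddEquiv.symm_apply_eq, hΨ]
    conv_lhs => rw [← Ψ.apply_symm_apply u, hΨ]
    simp [Finset.sum_mul, mul_assoc]
  let i' : M →ₗ[A] G := lin i
  have hi' : ∀ u m, i' (M.act u m) = G.act (L.inclUS p (Set.subset_univ S) u) (i' m) :=
    lin_isoRes_act (Set.subset_univ S) i
  -- Freeness of `U_χ` over `U_S` suggests that, over `A`, the induced object is a sum of `n` copies
  -- of `M`, one for each basis element `EU j`.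
  let θ : (Fin n → M) →ₗ[A] G := ∑ j, (G.act (EU j)) ∘ₗ i' ∘ₗ LinearMap.proj j
  have hθ : ∀ f, θ f = ∑ j, G.act (EU j) (i' (f j)) := fun f => by
    simp [θ, LinearMap.sum_apply]
  have hθs : Function.Surjective θ := by
    rw [← LinearMap.range_eq_top, eq_top_iff]
    intro g _
    obtain ⟨t, rfl⟩ := hsurj g
    induction t with
    | zero => rw [map_zero]; exact zero_mem _
    | add s t hs ht => rw [map_add]; exact add_mem (hs trivial) (ht trivial)
    | tmul u m =>
      refine ⟨fun j => M.act (Ψ.symm u j) m, ?_⟩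
      rw [hθ, indMap_tmul]
      conv_rhs => rw [← Ψ.apply_symm_apply u, hΨ]
      rw [map_sum, LinearMap.sum_apply]
      refine Finset.sum_congr rfl fun j _ => ?_
      rw [hi', act_mul]
      rfl
  -- Candidate inverse of `θ`: expand `u` in the basis and let the coordinates act on `m`. It
  -- respects the tensor relations over `U_S` because the coordinates are right `U_S`-linear.
  let ψ : L.US p Set.univ ⊗[ℤ] M →ₗ[ℤ] (Fin n → M) :=
    TensorProduct.lift (LinearMap.mk₂ ℤ (fun u m j => M.act (Ψ.symm u j) m)
      (fun u v m => by funext j; simp)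
      (fun z u m => by
        funext j
        rw [map_zsmul, Pi.smul_apply, map_zsmul]
        rfl)
      (fun u m m' => by funext j; simp)
      (fun z u m => by funext j; simp))
  have hψ : ∀ u m, ψ (u ⊗ₜ m) = fun j => M.act (Ψ.symm u j) m := fun _ _ => rfl
  have hψker : LinearMap.ker (indMap (Set.subset_univ S) i) ≤ LinearMap.ker ψ := by
    rw [hker, Submodule.span_le]
    rintro _ ⟨u, b, m, rfl⟩
    rw [SetLike.mem_coe, LinearMap.mem_ker, map_sub, hψ, hψ, hΨmul, sub_eq_zero]
    funext j
    rw [act_mul]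
  have hθi : Function.Injective θ := by
    rw [injective_iff_map_eq_zero]
    intro f hf
    have h1 : (∑ j, EU j ⊗ₜ[ℤ] f j) ∈ LinearMap.ker ψ := by
      refine hψker ?_
      rw [LinearMap.mem_ker, map_sum, ← hf, hθ]
      rfl
    have h2 : ∀ j, Ψ.symm (EU j) = Pi.single j 1 := by
      intro j
      rw [AddEquiv.symm_apply_eq, hΨ, Finset.sum_eq_single j]
      · simp
      · intro k _ hk
        simp [Pi.single_eq_of_ne hk]
      · simp
    rw [LinearMap.mem_ker, map_sum] at h1
    funext k
    have h3 := congrFun h1 k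
    rw [Finset.sum_apply, Finset.sum_eq_single k] at h3
    · simpa [hψ, h2] using h3
    · intro j _ hj
      simp [hψ, h2, Pi.single_eq_of_ne hj.symm]
    · simp
  have _ : Module.Projective A (Fin n → M) := Module.Projective.of_equiv
    (DFinsupp.linearEquivFunOnFintype (R := A) (M := fun _ : Fin n => M))
  exact Module.Projective.of_equiv (LinearEquiv.ofBijective θ ⟨hθi, hθs⟩)

/-- The linear equivalence underlying an isomorphism. -/
def linIso {M N : CMod p L S A π} (e : M ≅ N) : M ≃ₗ[A] N :=
  LinearEquiv.ofLinearMap (lin e.hom) (lin e.inv)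
    (by rw [← lin_comp, e.inv_hom_id]; rfl) (by rw [← lin_comp, e.hom_inv_id]; rfl)

/-- Projectivity starts from a vector space tensored with `A`; the twist, the inflation and the
isomorphisms leave the `A`-module unchanged, and induction preserves projectivity since `R_I ∪ R⁺`
is closed. -/
theorem projective_of_isQI [Fact p.Prime] [CharP K p] [Module.Finite ℤ Y] {μ : X}
    {G : CMod p L Set.univ A π} (h : G.IsQI μ) : Module.Projective A G := by
  obtain ⟨N, N', ⟨Z, Q, f, -, -, φ, -⟩, ⟨⟨e⟩, -⟩, hind⟩ := h
  have h1 : Module.Projective A (Q.baseChange A) :=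
    inferInstanceAs (Module.Projective A (A ⊗[K] Q))
  have h2 : Module.Projective A N := Module.Projective.of_equiv φ
  have h3 : Module.Projective A N' := Module.Projective.of_equiv (linIso e).symm
  exact projective_of_isInduced L.isClosedSet_RP hind h3

theorem exact_of_shortExact [IsNoetherianRing A] {T : ShortComplex (CMod p L S A π)}
    (hT : T.ShortExact) : Function.Injective (lin T.f) ∧ Function.Exact (lin T.f) (lin T.g) ∧
      Function.Surjective (lin T.g) := by
  have := hT.mono_f
  have := hT.epi_g
  refine ⟨inj_of_mono _, fun m => ⟨fun hm => ?_, ?_⟩, surj_of_epi _⟩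
  -- Categorical exactness is turned into exactness of linear maps by testing it on the explicit
  -- kernel.
  · let k : ker T.g ⟶ T.X₂ := kerι T.g
    have hk : k ≫ T.g = 0 := kerι_comp T.g
    obtain ⟨l, hl⟩ := hT.exact.lift' k hk
    exact ⟨lin l ⟨m, hm⟩, congrArg (fun q : ker T.g ⟶ T.X₂ => lin q ⟨m, hm⟩) hl⟩
  · rintro ⟨m, rfl⟩
    exact congrArg (fun q => lin q m) T.zero

theorem projective_of_exact {M₁ M₂ M₃ : Type*} [AddCommGroup M₁] [AddCommGroup M₂]
    [AddCommGroup M₃] [Module A M₁] [Module A M₂] [Module A M₃] {f : M₁ →ₗ[A] M₂} {g : M₂ →ₗ[A] M₃}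
    (hf : Function.Injective f) (hfg : Function.Exact f g) (hg : Function.Surjective g)
    [Module.Projective A M₁] [Module.Projective A M₃] : Module.Projective A M₂ := by
  obtain ⟨s, hs⟩ := Module.projective_lifting_property g LinearMap.id hg
  have e := (hfg.splitSurjectiveEquiv hf ⟨s, hs⟩).1
  exact Module.Projective.of_equiv e.symm

theorem projective_of_hasQFiltration [IsNoetherianRing A] [Fact p.Prime] [CharP K p]
    [Module.Finite ℤ Y] {M : CMod p L Set.univ A π} (h : M.HasQFiltration) :
    Module.Projective A M := by
  induction h with
  | zero M hM =>
    have : Subsingleton M := ⟨fun a b => by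
      have h0 : 𝟙 M = 0 := (Limits.IsZero.iff_id_eq_zero M).1 hM
      have h1 : ∀ m : M, m = 0 := fun m => congrArg (fun q : M ⟶ M => lin q m) h0
      rw [h1 a, h1 b]⟩
    infer_instance
  | step T hT _ μ h₃ ih =>
    obtain ⟨hf, hfg, hg⟩ := exact_of_shortExact hT
    have := projective_of_isQI h₃
    exact projective_of_exact hf hfg hg

end CMod

/-! ### The grading of the reduced enveloping algebra -/

namespace StdLevi

attribute [local instance] LieRing.ofAssociativeRing

variable {K ι X Y 𝔤 : Type*} [Field K] [Finite ι] [AddCommGroup X] [AddCommGroup Y]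
  [LieRing 𝔤] [LieAlgebra K 𝔤] {D : ReductiveLie K ι X Y 𝔤} (L : StdLevi D)

theorem exists_hS (x : L.gS ∅) : ∃ y, x = L.hS ∅ y := by
  have h := L.mem_span_of_mem_gS isClosedSet_empty x.2
  rw [Set.image_empty, Set.union_empty] at h
  have h2 : Submodule.span K (Set.range D.h) ≤ LinearMap.range D.h :=
    Submodule.span_le.2 fun _ h => h
  obtain ⟨y, hy⟩ := h2 h
  exact ⟨y, Subtype.ext hy.symm⟩

/-- The coordinates of an element of the Lie algebra with respect to `𝔥` and the root vectors. -/
def coords (D : ReductiveLie K ι X Y 𝔤) : 𝔤 ≃ₗ[K] CartanAlg K Y × (ι →₀ K) :=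
  (LinearEquiv.ofBijective _ D.bijective).symm

theorem coords_h (x : CartanAlg K Y) : coords D (D.h x) = (x, 0) := by
  rw [coords, LinearEquiv.symm_apply_eq]
  simp

theorem coords_e (α : ι) : coords D (D.e α) = (0, Finsupp.single α 1) := by
  rw [coords, LinearEquiv.symm_apply_eq]
  simp

/-- The algebra homomorphism from `U(𝔥)` to the coefficients by which `𝔥` acts on a piece. -/
def evU (p : ℕ) {A : Type*} [CommRing A] [Algebra K A] (θ : CartanAlg K Y →ₗ[K] A) :
    L.US p ∅ →ₐ[K] A :=
  RingQuot.liftAlgHom K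
    ⟨UniversalEnvelopingAlgebra.lift K
      { θ ∘ₗ LinearMap.fst K _ _ ∘ₗ (coords D).toLinearMap ∘ₗ (L.gS ∅).toSubmodule.subtype with
        map_lie' := fun {x y} => by
          obtain ⟨x, rfl⟩ := L.exists_hS x
          obtain ⟨y, rfl⟩ := L.exists_hS y
          have h : ⁅L.hS ∅ x, L.hS ∅ y⁆ = 0 := Subtype.ext (D.lie_h_h x y)
          rw [h, LieRing.of_associative_ring_bracket, mul_comm, sub_self]
          exact map_zero (θ ∘ₗ LinearMap.fst K _ _ ∘ₗ (coords D).toLinearMap ∘ₗ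
            (L.gS ∅).toSubmodule.subtype) },
      by rintro _ _ ⟨α, hα⟩; exact hα.elim⟩

theorem evU_hS (p : ℕ) {A : Type*} [CommRing A] [Algebra K A] (θ : CartanAlg K Y →ₗ[K] A)
    (x : CartanAlg K Y) : L.evU p θ (L.toUS p ∅ (L.hS ∅ x)) = θ x := by
  refine (RingQuot.liftAlgHom_mkAlgHom_apply K _ _ _).trans
    ((UniversalEnvelopingAlgebra.lift_ι_apply K _ _).trans ?_)
  change θ (coords D (D.h x)).1 = θ x
  rw [coords_h]

/-- The linear map `𝔤 → U_χ[Wt]` which attaches its weight to each root vector. -/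
def coactLin (p : ℕ) : L.gS Set.univ →ₗ[K] AddMonoidAlgebra (L.US p Set.univ) L.Wt :=
  LinearMap.coprod
    { toFun := fun x => AddMonoidAlgebra.single 0 (L.toUS p Set.univ (L.hS Set.univ x))
      map_add' := fun x y => by
        have : L.hS Set.univ (x + y) = L.hS Set.univ x + L.hS Set.univ y :=
          Subtype.ext (map_add D.h x y)
        rw [this, toUS_add, AddMonoidAlgebra.single_add]
      map_smul' := fun c x => by
        have : L.hS Set.univ (c • x) = c • L.hS Set.univ x := Subtype.ext (map_smul D.h c x)
        rw [this, toUS_smul, RingHom.id_apply, AddMonoidAlgebra.smul_single] }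
    (Finsupp.linearCombination K fun α =>
      AddMonoidAlgebra.single (L.wt (D.P.root α)) (L.eU p α)) ∘ₗ
    (coords D).toLinearMap ∘ₗ (L.gS Set.univ).toSubmodule.subtype

theorem coactLin_h (p : ℕ) (x : CartanAlg K Y) : L.coactLin p (L.hS Set.univ x) =
    AddMonoidAlgebra.single 0 (L.toUS p Set.univ (L.hS Set.univ x)) := by
  change LinearMap.coprod _ _ (coords D (D.h x)) = _
  rw [coords_h, LinearMap.coprod_apply, map_zero, add_zero]
  rfl

theorem coactLin_e (p : ℕ) (α : ι) : L.coactLin p (L.eS α (Set.mem_univ α)) =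
    AddMonoidAlgebra.single (L.wt (D.P.root α)) (L.eU p α) := by
  change LinearMap.coprod _ _ (coords D (D.e α)) = _
  rw [coords_e, LinearMap.coprod_apply, map_zero, zero_add, Finsupp.linearCombination_single,
    one_smul]

theorem gS_univ_induction {C : L.gS Set.univ → Prop} (h_h : ∀ x, C (L.hS Set.univ x))
    (h_e : ∀ α, C (L.eS α (Set.mem_univ α))) (h_add : ∀ x y, C x → C y → C (x + y))
    (h_smul : ∀ (c : K) x, C x → C (c • x)) (x : L.gS Set.univ) : C x := by
  have hx : x ∈ Submodule.span K (Set.range (L.gen (S := Set.univ) id)) := by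
    rw [L.span_gen isClosedSet_univ id (by simp)]; trivial
  induction hx using Submodule.span_induction with
  | mem x hx =>
    obtain ⟨α | y, rfl⟩ := hx
    · exact h_e α
    · exact h_h y
  | zero => have := h_smul 0 _ (h_h 0); rwa [zero_smul] at this
  | add x y _ _ hx hy => exact h_add x y hx hy
  | smul c x _ hx => exact h_smul c x hx

theorem coactLin_lie_e_e (p : ℕ) (α β : ι) :
    L.coactLin p ⁅L.eS α (Set.mem_univ α), L.eS β (Set.mem_univ β)⁆ =
      AddMonoidAlgebra.single (L.wt (D.P.root α + D.P.root β))
        (L.toUS p Set.univ ⁅L.eS α (Set.mem_univ α), L.eS β (Set.mem_univ β)⁆) := by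
  have hz : L.toUS p Set.univ 0 = 0 := by rw [← zero_smul K (0 : L.gS Set.univ), toUS_smul, zero_smul]
  by_cases h0 : D.P.root α + D.P.root β = 0
  · have h : ⁅L.eS α (Set.mem_univ α), L.eS β (Set.mem_univ β)⁆ =
        L.hS Set.univ (1 ⊗ₜ D.P.coroot α) :=
      Subtype.ext (D.lie_e_neg α β (eq_neg_of_add_eq_zero_right h0))
    rw [h, coactLin_h, h0, map_zero]
  · by_cases hr : D.P.root α + D.P.root β ∈ Set.range D.P.root
    · obtain ⟨γ, hγ⟩ := hr
      have h : ∃ c : K, ⁅L.eS α (Set.mem_univ α), L.eS β (Set.mem_univ β)⁆ =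
          c • L.eS γ (Set.mem_univ γ) := by
        rcases D.lie_e_e α β γ hγ.symm with h | h
        · exact ⟨((D.P.chainBotCoeff α β + 1 : ℕ) : K), Subtype.ext (h.trans
            (Nat.cast_smul_eq_nsmul K _ _).symm)⟩
        · exact ⟨-((D.P.chainBotCoeff α β + 1 : ℕ) : K), Subtype.ext (h.trans (by
            rw [← Nat.cast_smul_eq_nsmul K, ← neg_smul]; rfl))⟩
      obtain ⟨c, h⟩ := h
      rw [h, map_smul, coactLin_e, toUS_smul, AddMonoidAlgebra.smul_single, hγ]
    · have h : ⁅L.eS α (Set.mem_univ α), L.eS β (Set.mem_univ β)⁆ = 0 :=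
        Subtype.ext (D.lie_e_e_zero α β h0 hr)
      rw [h, map_zero, hz, AddMonoidAlgebra.single_zero]

theorem coactLin_lie (p : ℕ) (x y : L.gS Set.univ) : L.coactLin p ⁅x, y⁆ =
    L.coactLin p x * L.coactLin p y - L.coactLin p y * L.coactLin p x := by
  have hhe : ∀ x α, L.coactLin p ⁅L.hS Set.univ x, L.eS α (Set.mem_univ α)⁆ =
      L.coactLin p (L.hS Set.univ x) * L.coactLin p (L.eS α (Set.mem_univ α)) -
        L.coactLin p (L.eS α (Set.mem_univ α)) * L.coactLin p (L.hS Set.univ x) := by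
    intro x α
    have h : ⁅L.hS Set.univ x, L.eS α (Set.mem_univ α)⁆ =
        D.diff (D.P.root α) x • L.eS α (Set.mem_univ α) := Subtype.ext (D.lie_h_e_eq_diff x α)
    rw [coactLin_e, coactLin_h, AddMonoidAlgebra.single_mul_single,
      AddMonoidAlgebra.single_mul_single, zero_add, add_zero, ← AddMonoidAlgebra.single_sub,
      eU, ← toUS_lie, h, toUS_smul, map_smul, coactLin_e, AddMonoidAlgebra.smul_single]
  induction x using L.gS_univ_induction with
  | h_add x x' hx hx' => rw [add_lie, map_add, map_add, hx, hx', add_mul, mul_add]; abel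
  | h_smul c x hx => rw [smul_lie, map_smul, map_smul, hx, smul_mul_assoc, mul_smul_comm, smul_sub]
  | h_h x =>
    induction y using L.gS_univ_induction with
    | h_add x x' hx hx' => rw [lie_add, map_add, map_add, hx, hx', add_mul, mul_add]; abel
    | h_smul c x hx =>
      rw [lie_smul, map_smul, map_smul, hx, smul_mul_assoc, mul_smul_comm, smul_sub]
    | h_h y =>
      have h : ⁅L.hS Set.univ x, L.hS Set.univ y⁆ = 0 := Subtype.ext (D.lie_h_h x y)
      rw [coactLin_h, coactLin_h, AddMonoidAlgebra.single_mul_single,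
        AddMonoidAlgebra.single_mul_single, ← AddMonoidAlgebra.single_sub, ← toUS_lie, h,
        map_zero, add_zero, ← zero_smul K (0 : L.gS Set.univ), toUS_smul, zero_smul,
        AddMonoidAlgebra.single_zero]
    | h_e α => exact hhe x α
  | h_e α =>
    induction y using L.gS_univ_induction with
    | h_add x x' hx hx' => rw [lie_add, map_add, map_add, hx, hx', add_mul, mul_add]; abel
    | h_smul c x hx =>
      rw [lie_smul, map_smul, map_smul, hx, smul_mul_assoc, mul_smul_comm, smul_sub]
    | h_h y => rw [← lie_skew, map_neg, hhe, neg_sub]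
    | h_e β =>
      rw [coactLin_lie_e_e, coactLin_e, coactLin_e, AddMonoidAlgebra.single_mul_single,
        AddMonoidAlgebra.single_mul_single, map_add, add_comm (L.wt (D.P.root β)),
        ← AddMonoidAlgebra.single_sub, toUS_lie]

/-- A nonzero value of `χ` forces `-α ∈ I`, so `α` dies modulo `ℤI`, and the differential of `pα` is
zero in characteristic `p`. Hence the relation `e_α ^ p = χ(e_α) ^ p` is homogeneous and the weight
grading passes to `U_χ`. -/
theorem nsmul_wt_eq_zero (p : ℕ) [CharP K p] {α : ι} (h : L.χ (D.e α) ≠ 0) :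
    p • L.wt (D.P.root α) = 0 := by
  have hα : D.P.root α ∈ L.ZI := by
    have hneg : ¬ D.b.IsPos α := fun hp => h (L.χ_pos α hp)
    let _ := D.P.indexNeg
    have hpos : D.b.IsPos (-α) := (RootPairing.Base.IsPos.or_neg D.b α).resolve_left hneg
    have hr : D.P.root (-α) = -D.P.root α := by simp
    have hr' : D.P.root α = -D.P.root (-α) := by rw [hr, neg_neg]
    by_cases hI : -α ∈ L.I
    · rw [hr']
      exact neg_mem (AddSubgroup.subset_closure ⟨-α, hI, rfl⟩)
    · exact absurd (L.χ_neg_not_mem (-α) α hpos hr' hI) h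
  rw [← map_nsmul]
  refine Subtype.ext (Prod.ext ?_ ?_)
  · exact (QuotientAddGroup.eq_zero_iff _).2 (nsmul_mem hα p)
  · change D.diff (p • D.P.root α) = 0
    rw [map_nsmul, ← Nat.cast_smul_eq_nsmul K, CharP.cast_eq_zero, zero_smul]

/-- The coaction `U_χ → U_χ[Wt]` given by the grading. -/
def coact (p : ℕ) [Fact p.Prime] [CharP K p] :
    L.US p Set.univ →ₐ[K] AddMonoidAlgebra (L.US p Set.univ) L.Wt :=
  RingQuot.liftAlgHom K
    ⟨UniversalEnvelopingAlgebra.lift K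
      { L.coactLin p with map_lie' := fun {x y} => L.coactLin_lie p x y }, by
      rintro _ _ ⟨α, hα⟩
      rw [map_pow, UniversalEnvelopingAlgebra.lift_ι_apply, AlgHom.commutes]
      change L.coactLin p (L.eS α (Set.mem_univ α)) ^ p = _
      rw [coactLin_e, AddMonoidAlgebra.single_pow, eU, toUS_pow]
      by_cases h : L.χ (D.e α) = 0
      · rw [h, zero_pow (Fact.out : p.Prime).ne_zero, map_zero, map_zero,
          AddMonoidAlgebra.single_zero]
      · rw [L.nsmul_wt_eq_zero p h]
        rfl⟩

theorem coact_toUS (p : ℕ) [Fact p.Prime] [CharP K p] (x : L.gS Set.univ) :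
    L.coact p (L.toUS p Set.univ x) = L.coactLin p x :=
  (RingQuot.liftAlgHom_mkAlgHom_apply K _ _ _).trans
    (UniversalEnvelopingAlgebra.lift_ι_apply K _ x)

/-- Homogeneous elements of `U_χ`. -/
def IsHomog {p : ℕ} [Fact p.Prime] [CharP K p] (v : L.Wt) (u : L.US p Set.univ) : Prop :=
  L.coact p u = AddMonoidAlgebra.single v u

variable {L} {p : ℕ} [Fact p.Prime] [CharP K p]

theorem isHomog_one : L.IsHomog 0 (1 : L.US p Set.univ) := map_one _

theorem IsHomog.mul {v v' : L.Wt} {u u' : L.US p Set.univ} (h : L.IsHomog v u)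
    (h' : L.IsHomog v' u') : L.IsHomog (v + v') (u * u') := by
  rw [IsHomog, map_mul, h, h', AddMonoidAlgebra.single_mul_single]

theorem isHomog_e (α : ι) : L.IsHomog (L.wt (D.P.root α)) (L.eU p α) := by
  rw [IsHomog, coact_toUS, coactLin_e]

theorem isHomog_list (l : List ι) :
    L.IsHomog (L.wt (l.map D.P.root).sum) (l.map (L.eU p)).prod := by
  induction l with
  | nil => simpa using isHomog_one
  | cons α l ih =>
    rw [List.map_cons, List.map_cons, List.sum_cons, List.prod_cons, map_add]
    exact (isHomog_e α).mul ih

theorem isHomog_incl (u : L.US p ∅) : L.IsHomog 0 (L.inclUS p (Set.subset_univ ∅) u) := by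
  induction u using L.US_induction with
  | h_alg c =>
    rw [IsHomog, AlgHom.commutes, AlgHom.commutes]
    rfl
  | h_gen x =>
    obtain ⟨y, rfl⟩ := L.exists_hS x
    rw [L.inclUS_toUS]
    exact (L.coact_toUS p _).trans (L.coactLin_h p y)
  | h_add u v hu hv => rw [IsHomog, map_add, map_add, hu, hv, AddMonoidAlgebra.single_add]
  | h_mul u v hu hv => rw [map_mul]; simpa using hu.mul hv

/-- Each root vector passed by an element of `𝔥` adds the differential of its root; this computes
the weights on the induced objects. -/
theorem h_mul_list (x : CartanAlg K Y) (l : List ι) :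
    L.toUS p Set.univ (L.hS Set.univ x) * (l.map (L.eU p)).prod =
      (l.map (L.eU p)).prod * (L.toUS p Set.univ (L.hS Set.univ x) +
        algebraMap K _ (D.diff (l.map D.P.root).sum x)) := by
  induction l with
  | nil => simp
  | cons α l ih =>
    have h : ⁅L.hS Set.univ x, L.eS α (Set.mem_univ α)⁆ =
        D.diff (D.P.root α) x • L.eS α (Set.mem_univ α) := Subtype.ext (D.lie_h_e_eq_diff x α)
    have h2 : L.toUS p Set.univ (L.hS Set.univ x) * L.eU p α =
        L.eU p α * L.toUS p Set.univ (L.hS Set.univ x) + D.diff (D.P.root α) x • L.eU p α := by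
      rw [← toUS_smul, ← h, toUS_lie, eU]
      abel
    rw [List.map_cons, List.map_cons, List.sum_cons, List.prod_cons, ← mul_assoc, h2, add_mul,
      mul_assoc, ih, map_add, LinearMap.add_apply, map_add, mul_assoc, smul_mul_assoc,
      Algebra.smul_def, Algebra.commutes]
    simp only [mul_add, mul_assoc]
    abel

end StdLevi

/-! ### Coordinates over the enveloping algebra of the torus -/

namespace StdLevi

variable {K ι X Y 𝔤 : Type*} [Field K] [Finite ι] [AddCommGroup X] [AddCommGroup Y]
  [LieRing 𝔤] [LieAlgebra K 𝔤] {D : ReductiveLie K ι X Y 𝔤}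

/-- A basis of `U_χ` as a right module over `U(𝔥)` which consists of products of root vectors. -/
structure FreeBasis (L : StdLevi D) (p : ℕ) where
  n : ℕ
  words : Fin n → List ι
  bijective : Function.Bijective fun c : Fin n → L.US p ∅ =>
    ∑ i, ((words i).map (L.eU p)).prod * L.inclUS p (Set.subset_univ ∅) (c i)

theorem nonempty_freeBasis (L : StdLevi D) (p : ℕ) [Fact p.Prime] [CharP K p] [Module.Finite ℤ Y] :
    Nonempty (L.FreeBasis p) := by
  obtain ⟨n, E, hE⟩ := L.exists_free_US p isClosedSet_empty
  exact ⟨⟨n, E, hE⟩⟩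

namespace FreeBasis

variable {L : StdLevi D} {p : ℕ} (B : L.FreeBasis p)

/-- The elements of the basis. -/
def E (i : Fin B.n) : L.US p Set.univ := ((B.words i).map (L.eU p)).prod

/-- The weights of the elements of the basis. -/
def deg (i : Fin B.n) : L.Wt := L.wt ((B.words i).map D.P.root).sum

/-- The inclusion of `U(𝔥)`. -/
abbrev incl (_B : L.FreeBasis p) : L.US p ∅ →ₐ[K] L.US p Set.univ :=
  L.inclUS p (Set.subset_univ ∅)

/-- The coordinates with respect to the basis. -/
def coord : L.US p Set.univ ≃+ (Fin B.n → L.US p ∅) :=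
  (AddEquiv.ofBijective
    ({ toFun := fun c => ∑ i, B.E i * B.incl (c i)
       map_zero' := by simp
       map_add' := fun c d => by simp [mul_add, Finset.sum_add_distrib] } :
      (Fin B.n → L.US p ∅) →+ L.US p Set.univ) B.bijective).symm

theorem sum_coord (u : L.US p Set.univ) : ∑ i, B.E i * B.incl (B.coord u i) = u :=
  B.coord.symm_apply_apply u

theorem coord_eq {u : L.US p Set.univ} {c : Fin B.n → L.US p ∅}
    (h : ∑ i, B.E i * B.incl (c i) = u) : B.coord u = c :=
  (AddEquiv.symm_apply_eq _).2 h.symm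

theorem coord_mul_incl (u : L.US p Set.univ) (b : L.US p ∅) :
    B.coord (u * B.incl b) = fun i => B.coord u i * b := by
  refine B.coord_eq ?_
  conv_rhs => rw [← B.sum_coord u]
  simp [Finset.sum_mul, mul_assoc]

theorem coord_E (i : Fin B.n) : B.coord (B.E i) = Pi.single i 1 := by
  refine B.coord_eq ?_
  rw [Finset.sum_eq_single i]
  · simp
  · intro k _ hk
    simp [Pi.single_eq_of_ne hk]
  · simp

theorem coord_mul (u v : L.US p Set.univ) (i : Fin B.n) :
    B.coord (u * v) i = ∑ k, B.coord (u * B.E k) i * B.coord v k := by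
  conv_lhs => rw [← B.sum_coord v, Finset.mul_sum, map_sum, Finset.sum_apply]
  refine Finset.sum_congr rfl fun k _ => ?_
  rw [← mul_assoc, coord_mul_incl]

theorem coord_E_mul_incl (i : Fin B.n) (b : L.US p ∅) :
    B.coord (B.E i * B.incl b) = Pi.single i b := by
  rw [coord_mul_incl, coord_E]
  funext k
  by_cases h : k = i
  · subst h; simp
  · simp [Pi.single_eq_of_ne h]

/-- `U(𝔥)` has degree zero, so each term of the basis expansion is homogeneous of degree `deg i`.
Comparing components in the coaction leaves only terms of degree `v`, and coordinates are unique. -/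
theorem coord_eq_zero_of_isHomog [Fact p.Prime] [CharP K p] {v : L.Wt} {u : L.US p Set.univ}
    (h : L.IsHomog v u) {i : Fin B.n} (hi : B.deg i ≠ v) : B.coord u i = 0 := by
  classical
  have h1 : L.coact p u = ∑ i, AddMonoidAlgebra.single (B.deg i)
      (B.E i * B.incl (B.coord u i)) := by
    conv_lhs => rw [← B.sum_coord u, map_sum]
    refine Finset.sum_congr rfl fun i _ => ?_
    have h2 : L.IsHomog (B.deg i + 0) (B.E i * B.incl (B.coord u i)) :=
      (isHomog_list (B.words i)).mul (isHomog_incl _)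
    rw [add_zero] at h2
    exact h2
  rw [h] at h1
  have h3 : u = ∑ i, B.E i * B.incl (if B.deg i = v then B.coord u i else 0) := by
    have h4 := congrArg (fun f : AddMonoidAlgebra (L.US p Set.univ) L.Wt => f.coeff v) h1
    simp only [AddMonoidAlgebra.coeff_sum, AddMonoidAlgebra.coeff_single, Finsupp.single_eq_same,
      Finsupp.finsetSum_apply] at h4
    conv_lhs => rw [h4]
    refine Finset.sum_congr rfl fun i _ => ?_
    split_ifs with hiv
    · rw [hiv, Finsupp.single_eq_same]
    · rw [Finsupp.single_eq_of_ne (Ne.symm hiv), map_zero, mul_zero]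
  rw [B.coord_eq h3.symm]
  exact if_neg hi

theorem coord_h_mul [Fact p.Prime] [CharP K p] (x : CartanAlg K Y) (i : Fin B.n) :
    B.coord (L.toUS p Set.univ (L.hS Set.univ x) * B.E i) =
      Pi.single i (L.toUS p ∅ (L.hS ∅ x) + algebraMap K _ ((B.deg i).1.2 x)) := by
  rw [← coord_E_mul_incl, map_add, L.inclUS_toUS, AlgHom.commutes, E, h_mul_list]
  rfl

/-- Left multiplication in coordinates. -/
def mat : L.US p Set.univ →+* Matrix (Fin B.n) (Fin B.n) (L.US p ∅) where
  toFun u := Matrix.of fun i j => B.coord (u * B.E j) i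
  map_one' := by
    ext i j
    simp [coord_E, Matrix.one_apply, Pi.single_apply]
  map_zero' := by
    ext i j
    simp
  map_mul' u v := by
    ext i j
    rw [Matrix.mul_apply, Matrix.of_apply, mul_assoc, coord_mul]
    rfl
  map_add' u v := by
    ext i j
    simp [add_mul]

theorem mat_algebraMap (c : K) :
    B.mat (algebraMap K _ c) = Matrix.diagonal fun _ => algebraMap K _ c := by
  ext i j
  have : algebraMap K (L.US p Set.univ) c * B.E j = B.E j * B.incl (algebraMap K _ c) := by
    rw [AlgHom.commutes, Algebra.commutes]
  change B.coord (algebraMap K (L.US p Set.univ) c * B.E j) i = _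
  rw [this, coord_E_mul_incl, Matrix.diagonal_apply, Pi.single_apply]

/-- The matrices by which `U_χ` acts on an object induced from a character of `𝔥`. -/
def matA {A : Type*} [CommRing A] [Algebra K A] (θ : CartanAlg K Y →ₗ[K] A) :
    L.US p Set.univ →+* Matrix (Fin B.n) (Fin B.n) A :=
  (L.evU p θ).toRingHom.mapMatrix.comp B.mat

theorem matA_algebraMap {A : Type*} [CommRing A] [Algebra K A] (θ : CartanAlg K Y →ₗ[K] A)
    (c : K) : B.matA θ (algebraMap K _ c) = Matrix.diagonal fun _ => algebraMap K A c := by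
  ext i j
  change L.evU p θ (B.mat (algebraMap K _ c) i j) = _
  rw [mat_algebraMap, Matrix.diagonal_apply, Matrix.diagonal_apply]
  split_ifs
  · rw [AlgHom.commutes]
  · rw [map_zero]

end FreeBasis

end StdLevi

/-! ### Free objects -/

namespace CMod

open StdLevi

variable {K : Type u} {ι X Y 𝔤 : Type*} [Field K] [Finite ι] [AddCommGroup X] [AddCommGroup Y]
  [LieRing 𝔤] [LieAlgebra K 𝔤] {D : ReductiveLie K ι X Y 𝔤}
  {p : ℕ} {L : StdLevi D} {A : Type u} [CommRing A] [Algebra K A]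
  (π : CartanAlg K Y →ₗ[K] A) (B : L.FreeBasis p)

/-- The linear form by which `𝔥` acts on the piece of weight `w`. -/
def wtForm (w : L.Wt) : CartanAlg K Y →ₗ[K] A := π + (Algebra.linearMap K A) ∘ₗ w.1.2

theorem wtForm_apply (w : L.Wt) (x) : wtForm π w x = π x + algebraMap K A (w.1.2 x) := rfl

/-- On a single piece `𝔥` acts by scalars, so `U(𝔥)` acts through the corresponding algebra
homomorphism to `A`. -/
theorem act_incl {π} {S : Set ι} (M : CMod p L S A π) {w : L.Wt} {m : M} (hm : m ∈ M.piece w)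
    (u : L.US p ∅) : M.act (L.inclUS p (Set.empty_subset S) u) m = L.evU p (wtForm π w) u • m := by
  induction u using L.US_induction generalizing m with
  | h_alg c => rw [AlgHom.commutes, AlgHom.commutes, act_algebraMap]
  | h_gen x =>
    obtain ⟨y, rfl⟩ := L.exists_hS x
    rw [L.inclUS_toUS, act_toUS, evU_hS, wtForm_apply]
    exact M.h_act w m hm y
  | h_add u v hu hv => rw [map_add, map_add, map_add, LinearMap.add_apply, hu hm, hv hm, add_smul]
  | h_mul u v hu hv =>
    rw [map_mul (L.inclUS p _), map_mul (L.evU p _), act_mul, hv hm, map_smul, hu hm, smul_smul,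
      mul_comm]

/-- The action of `U_χ` on the direct sum of the objects induced from the weights `w j`. -/
def freeAct {m : ℕ} (w : Fin m → L.Wt) :
    L.US p Set.univ →+* Module.End A (Fin m → Fin B.n → A) where
  toFun u := LinearMap.pi fun j => (B.matA (wtForm π (w j)) u).mulVecLin ∘ₗ LinearMap.proj j
  map_one' := by
    refine LinearMap.ext fun f => funext fun j => ?_
    simp
  map_zero' := by
    refine LinearMap.ext fun f => funext fun j => ?_
    simp
  map_add' u v := by
    refine LinearMap.ext fun f => funext fun j => ?_
    simp
  map_mul' u v := by
    refine LinearMap.ext fun f => funext fun j => ?_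
    simp

theorem freeAct_apply {m : ℕ} (w : Fin m → L.Wt) (u : L.US p Set.univ) (f : Fin m → Fin B.n → A)
    (j : Fin m) (i : Fin B.n) : freeAct π B w u f j i =
      ∑ k, L.evU p (wtForm π (w j)) (B.coord (u * B.E k) i) * f j k := rfl

theorem freeAct_algebraMap {m : ℕ} (w : Fin m → L.Wt) (c : K) (f : Fin m → Fin B.n → A) :
    freeAct π B w (algebraMap K _ c) f = algebraMap K A c • f := by
  funext j i
  change (B.matA (wtForm π (w j)) (algebraMap K _ c)).mulVec (f j) i = _
  rw [FreeBasis.matA_algebraMap, Matrix.mulVec_diagonal]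
  rfl

/-- The pieces of a free object. -/
def freePiece (A : Type u) [CommRing A] (B : L.FreeBasis p) {m : ℕ} (w : Fin m → L.Wt) (v : L.Wt) :
    Submodule A (Fin m → Fin B.n → A) where
  carrier := {f | ∀ j i, w j + B.deg i ≠ v → f j i = 0}
  zero_mem' := fun _ _ _ => rfl
  add_mem' hf hg j i h := by simp [hf j i h, hg j i h]
  smul_mem' a f hf j i h := by simp [hf j i h]

variable [Fact p.Prime] [CharP K p]

/-- The object freely generated by vectors of weights `w j`. -/
def freeObj {m : ℕ} (w : Fin m → L.Wt) : CMod p L Set.univ A π where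
  carrier := Fin m → Fin B.n → A
  ρ :=
    { toFun := fun x => freeAct π B w (L.toUS p Set.univ x)
      map_add' := fun x y => by rw [L.toUS_add, map_add]
      map_smul' := fun c x => by
        refine LinearMap.ext fun f => ?_
        rw [L.toUS_smul, Algebra.smul_def, map_mul, Module.End.mul_apply, freeAct_algebraMap]
        rfl }
  ρ_lie x y := by
    change freeAct π B w (L.toUS p Set.univ ⁅x, y⁆) = _
    rw [L.toUS_lie, map_sub, map_mul, map_mul]
    rfl
  ρ_pow α hα m := by
    change (freeAct π B w (L.toUS p Set.univ (L.eS α hα)) ^ p) m = _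
    rw [← map_pow, L.toUS_pow, freeAct_algebraMap]
  finite := inferInstance
  piece := freePiece A B w
  piece_indep := by
    classical
    refine WGrading.indep_of_proj _ (fun v =>
      { toFun := fun f j i => if w j + B.deg i = v then f j i else 0
        map_add' := fun f g => by funext j i; simp only [Pi.add_apply]; split_ifs <;> simp
        map_smul' := fun a f => by
          funext j i; simp only [Pi.smul_apply, RingHom.id_apply]; split_ifs <;> simp }) ?_ ?_
    · intro v f hf
      funext j i
      change (if w j + B.deg i = v then f j i else 0) = f j i
      split_ifs with h
      · rfl
      · exact (hf j i h).symm
    · intro v v' hv f hf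
      funext j i
      change (if w j + B.deg i = v' then f j i else 0) = 0
      split_ifs with h
      · exact hf j i (by rw [h]; exact hv.symm)
      · rfl
  piece_span := by
    classical
    rw [eq_top_iff]
    intro f _
    have hf : f = ∑ j, ∑ i, Pi.single j (Pi.single i (f j i)) := by
      funext j i
      simp only [Finset.sum_apply]
      rw [Finset.sum_eq_single j, Finset.sum_eq_single i]
      · simp
      · intro i' _ hi'; simp [Pi.single_eq_of_ne hi'.symm]
      · simp
      · intro j' _ hj'; simp [Pi.single_eq_of_ne hj'.symm]
      · simp
    rw [hf]
    refine Submodule.sum_mem _ fun j _ => Submodule.sum_mem _ fun i _ =>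
      Submodule.mem_iSup_of_mem (w j + B.deg i) ?_
    intro j' i' h
    by_cases hj : j' = j
    · subst hj
      by_cases hi : i' = i
      · subst hi; exact absurd rfl h
      · simp [Pi.single_eq_of_ne hi]
    · simp [Pi.single_eq_of_ne hj]
  h_act v f hf x := by
    funext j i
    change freeAct π B w (L.toUS p Set.univ (L.hS Set.univ x)) f j i = _
    rw [freeAct_apply, Finset.sum_eq_single i]
    · rw [FreeBasis.coord_h_mul, Pi.single_eq_same, map_add, evU_hS, AlgHom.commutes, wtForm_apply]
      by_cases h : w j + B.deg i = v
      · rw [← h, add_assoc, ← map_add]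
        rfl
      · rw [hf j i h, mul_zero]
        change _ = (π x + algebraMap K A (v.1.2 x)) * f j i
        rw [hf j i h, mul_zero]
    · intro k _ hk
      rw [FreeBasis.coord_h_mul, Pi.single_eq_of_ne hk.symm, map_zero, zero_mul]
    · simp
  e_act α hα v f hf := by
    intro j i h
    change freeAct π B w (L.eU p α) f j i = 0
    rw [freeAct_apply]
    refine Finset.sum_eq_zero fun k _ => ?_
    by_cases hk : w j + B.deg k = v
    -- The matrix entry from index `k` to index `i` vanishes unless `deg i = wt(α) + deg k`, so a
    -- root vector moves the pieces as required.
    · have hh : L.IsHomog (L.wt (D.P.root α) + B.deg k) (L.eU p α * B.E k) :=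
        (isHomog_e α).mul (isHomog_list (B.words k))
      rw [B.coord_eq_zero_of_isHomog hh, map_zero, zero_mul]
      intro hi
      apply h
      rw [hi, ← hk]
      abel
    · rw [hf j k hk, mul_zero]

theorem act_freeObj {m : ℕ} (w : Fin m → L.Wt) (u : L.US p Set.univ) (f : Fin m → Fin B.n → A) :
    (freeObj π B w).act u f = freeAct π B w u f := by
  induction u using L.US_induction generalizing f with
  | h_alg c =>
    rw [freeAct_algebraMap]
    exact act_algebraMap (freeObj π B w) c f
  | h_gen x =>
    rw [act_toUS]
    rfl
  | h_add u v hu hv =>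
    rw [map_add, map_add]
    exact congrArg₂ (· + ·) (hu f) (hv f)
  | h_mul u v hu hv =>
    rw [map_mul, map_mul]
    exact (congrArg ((freeObj π B w).act u) (hv f)).trans (hu _)

/-- The object `P` is freely generated by the vectors `v j` of weight `w j`. -/
structure IsFreeOn {π : CartanAlg K Y →ₗ[K] A} (B : L.FreeBasis p) (P : CMod p L Set.univ A π)
    {m : ℕ} (w : Fin m → L.Wt) (v : Fin m → P) where
  mem : ∀ j, v j ∈ P.piece (w j)
  basis : Module.Basis (Fin m × Fin B.n) A P
  basis_apply : ∀ j i, basis (j, i) = P.act (B.E i) (v j)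

theorem exists_isFreeOn {m : ℕ} (w : Fin m → L.Wt) :
    ∃ (P : CMod p L Set.univ A π) (v : Fin m → P), Nonempty (IsFreeOn B P w v) := by
  classical
  let v : Fin m → freeObj π B w := fun j =>
    (Pi.single j fun i => L.evU p (wtForm π (w j)) (B.coord 1 i) : Fin m → Fin B.n → A)
  have hv : ∀ j u, (freeObj π B w).act u (v j) =
      (Pi.single j fun i => L.evU p (wtForm π (w j)) (B.coord u i) : Fin m → Fin B.n → A) := by
    intro j u
    refine (act_freeObj π B w u _).trans ?_
    funext j' i
    rw [freeAct_apply]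
    by_cases h : j' = j
    · subst h
      simp only [Pi.single_eq_same]
      conv_rhs => rw [← mul_one u, B.coord_mul, map_sum]
      exact Finset.sum_congr rfl fun k _ => (map_mul _ _ _).symm
    · simp [Pi.single_eq_of_ne h]
  let b : Module.Basis (Fin m × Fin B.n) A (Fin m → Fin B.n → A) :=
    (Pi.basis fun _ : Fin m => Pi.basisFun A (Fin B.n)).reindex (Equiv.sigmaEquivProd _ _)
  refine ⟨freeObj π B w, v, ⟨⟨?_, b, ?_⟩⟩⟩
  · intro j j' i h
    by_cases hj : j' = j
    · subst hj
      simp only [v, Pi.single_eq_same]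
      rw [B.coord_eq_zero_of_isHomog isHomog_one, map_zero]
      intro h0
      exact h (by rw [h0, add_zero])
    · simp [v, Pi.single_eq_of_ne hj]
  · intro j i
    rw [hv, FreeBasis.coord_E]
    have : b (j, i) = Pi.single j (Pi.single i 1) := by
      simp [b, Pi.basis_apply]
    refine this.trans ?_
    congr 1
    funext i'
    by_cases h : i' = i
    · subst h; simp
    · simp [Pi.single_eq_of_ne h]

end CMod

/-! ### Morphisms from free objects and their base change -/

namespace CMod

open StdLevi

variable {K : Type u} {ι X Y 𝔤 : Type*} [Field K] [Finite ι] [AddCommGroup X] [AddCommGroup Y]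
  [LieRing 𝔤] [LieAlgebra K 𝔤] {D : ReductiveLie K ι X Y 𝔤}
  {p : ℕ} {L : StdLevi D} {S : Set ι} {A : Type u} [CommRing A] [Algebra K A]
  {π : CartanAlg K Y →ₗ[K] A}

section Pieces

theorem act_list_mem (M : CMod p L Set.univ A π) (l : List ι) {w : L.Wt} {m : M}
    (hm : m ∈ M.piece w) :
    M.act (l.map (L.eU p)).prod m ∈ M.piece (w + L.wt (l.map D.P.root).sum) := by
  induction l with
  | nil => simpa using hm
  | cons α l ih =>
    have h := M.e_act α (Set.mem_univ α) _ _ ih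
    rw [List.map_cons, List.map_cons, List.prod_cons, List.sum_cons, act_mul, eU, act_toUS, map_add,
      add_comm (L.wt _), ← add_assoc]
    exact h

/-- A linear map compatible with weights on a homogeneous spanning set commutes with the projections
onto the pieces. -/
theorem map_piece_of_span {M N : CMod p L S A π} (f : M →ₗ[A] N) {I : Type*} (b : I → M)
    (hb : Submodule.span A (Set.range b) = ⊤) (v : I → L.Wt) (hv : ∀ i, b i ∈ M.piece (v i))
    (hf : ∀ i, f (b i) ∈ N.piece (v i)) (w : L.Wt) (m : M) (hm : m ∈ M.piece w) :
    f m ∈ N.piece w := by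
  have key : ∀ m, f (M.proj w m) = N.proj w (f m) := by
    intro m
    have hm : m ∈ Submodule.span A (Set.range b) := by rw [hb]; trivial
    induction hm using Submodule.span_induction with
    | mem x hx =>
      obtain ⟨i, rfl⟩ := hx
      by_cases h : v i = w
      · rw [M.proj_same w _ (h ▸ hv i), N.proj_same w _ (h ▸ hf i)]
      · rw [M.proj_ne _ w h _ (hv i), N.proj_ne _ w h _ (hf i), map_zero]
    | zero => simp
    | add x y _ _ hx hy => simp only [map_add, hx, hy]
    | smul a x _ hx => simp only [map_smul, hx]
  rw [← M.proj_same w m hm, key]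
  exact N.proj_mem _ _

theorem exists_homogeneous_generators (M : CMod p L S A π) :
    ∃ (m : ℕ) (w : Fin m → L.Wt) (g : Fin m → M), (∀ j, g j ∈ M.piece (w j)) ∧
      Submodule.span A (Set.range g) = ⊤ := by
  classical
  obtain ⟨s, hs⟩ := M.finite.fg_top
  choose t ht using M.proj_sum
  let T := s.sigma t
  let ε := T.equivFin
  refine ⟨T.card, fun j => (ε.symm j).1.2, fun j => M.proj (ε.symm j).1.2 (ε.symm j).1.1,
    fun j => M.proj_mem _ _, ?_⟩
  rw [eq_top_iff, ← hs, Submodule.span_le]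
  intro x hx
  rw [ht x]
  refine Submodule.sum_mem _ fun w hw => Submodule.subset_span ⟨ε ⟨⟨x, w⟩, ?_⟩, ?_⟩
  · exact Finset.mem_sigma.2 ⟨hx, hw⟩
  · simp

theorem projective_piece (M : CMod p L S A π) [Module.Projective A M] (w : L.Wt) :
    Module.Projective A (M.piece w) :=
  Module.Projective.of_split (M.piece w).subtype ((M.proj w).codRestrict _ fun m => M.proj_mem w m)
    (LinearMap.ext fun m => Subtype.ext (M.proj_same w m m.2))

end Pieces

section Free

variable {B : L.FreeBasis p} {P : CMod p L Set.univ A π} {m : ℕ} {w : Fin m → L.Wt} {v : Fin m → P}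
  (F : IsFreeOn B P w v)

theorem act_eq_sum (B : L.FreeBasis p) (M : CMod p L Set.univ A π) {w : L.Wt} {x : M}
    (hx : x ∈ M.piece w) (u : L.US p Set.univ) :
    M.act u x = ∑ k, L.evU p (wtForm π w) (B.coord u k) • M.act (B.E k) x := by
  conv_lhs => rw [← B.sum_coord u, map_sum, LinearMap.sum_apply]
  refine Finset.sum_congr rfl fun k _ => ?_
  rw [act_mul, ← map_smul]
  exact congrArg _ (act_incl M hx _)

/-- The morphism from a free object with given values on the generators. -/
def IsFreeOn.desc (N : CMod p L Set.univ A π) (n : ∀ j, N.piece (w j)) : P ⟶ N :=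
  have key : ∀ j u, F.basis.constr A (fun q => N.act (B.E q.2) (n q.1)) (P.act u (v j)) =
      N.act u (n j) := fun j u => by
    rw [act_eq_sum B P (F.mem j), act_eq_sum B N (n j).2, map_sum]
    refine Finset.sum_congr rfl fun k _ => ?_
    rw [map_smul, ← F.basis_apply, Module.Basis.constr_basis]
  mkHom (F.basis.constr A fun q => N.act (B.E q.2) (n q.1))
    (fun x y => by
      have h : F.basis.constr A (fun q => N.act (B.E q.2) (n q.1)) ∘ₗ P.ρ x =
          N.ρ x ∘ₗ F.basis.constr A (fun q => N.act (B.E q.2) (n q.1)) := by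
        refine F.basis.ext fun q => ?_
        obtain ⟨j, i⟩ := q
        rw [LinearMap.comp_apply, LinearMap.comp_apply, Module.Basis.constr_basis, F.basis_apply,
          ← act_toUS, ← act_toUS, ← act_mul, ← act_mul, key]
      exact DFunLike.congr_fun h y)
    (map_piece_of_span _ F.basis F.basis.span_eq (fun q => w q.1 + B.deg q.2)
      (fun q => by
        obtain ⟨j, i⟩ := q
        rw [F.basis_apply]
        exact act_list_mem P _ (F.mem j))
      (fun q => by
        rw [Module.Basis.constr_basis]
        exact act_list_mem N _ (n q.1).2))

theorem IsFreeOn.desc_gen (N : CMod p L Set.univ A π) (n : ∀ j, N.piece (w j)) (j : Fin m) :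
    lin (F.desc N n) (v j) = n j := by
  change F.basis.constr A (fun q => N.act (B.E q.2) (n q.1)) (v j) = n j
  have h1 : v j = P.act 1 (v j) := by rw [map_one]; rfl
  have h2 : (n j : N) = N.act 1 (n j) := by rw [map_one]; rfl
  rw [h1, h2, act_eq_sum B P (F.mem j), act_eq_sum B N (n j).2, map_sum]
  refine Finset.sum_congr rfl fun k _ => ?_
  rw [map_smul, ← F.basis_apply, Module.Basis.constr_basis]

include F in
theorem IsFreeOn.hom_ext {N : CMod p L Set.univ A π} {f g : P ⟶ N}
    (h : ∀ j, lin f (v j) = lin g (v j)) : f = g := by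
  have : lin f = lin g := F.basis.ext fun q => by
    obtain ⟨j, i⟩ := q
    rw [F.basis_apply, lin_act, lin_act, h]
  exact CMod.hom_ext fun y => DFunLike.congr_fun this y

/-- Morphisms from a free object are given by their values on the generators. -/
def IsFreeOn.homEquiv (N : CMod p L Set.univ A π) : (P ⟶ N) ≃ₗ[A] ∀ j, N.piece (w j) where
  toFun f j := ⟨lin f (v j), lin_piece f _ _ (F.mem j)⟩
  map_add' _ _ := rfl
  map_smul' _ _ := rfl
  invFun := F.desc N
  left_inv _ := F.hom_ext fun j => F.desc_gen N _ j
  right_inv n := funext fun j => Subtype.ext (F.desc_gen N n j)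

include F in
-- Values on generators can be lifted arbitrarily and then projected to the prescribed pieces,
-- because morphisms commute with these projections.
theorem IsFreeOn.projective : Projective P where
  factors {E Z} f e _ := by
    have hs := surj_of_epi e
    choose y hy using fun j => hs (lin f (v j))
    refine ⟨F.desc E fun j => ⟨E.proj (w j) (y j), E.proj_mem _ _⟩, F.hom_ext fun j => ?_⟩
    rw [lin_comp, LinearMap.comp_apply, F.desc_gen, lin_proj, hy,
      proj_same _ _ _ (lin_piece f _ _ (F.mem j))]

include F in
theorem IsFreeOn.free : Module.Free A P := Module.Free.of_basis F.basis

include F in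
theorem IsFreeOn.projective_hom (N : CMod p L Set.univ A π) [Module.Projective A N] :
    Module.Projective A (P ⟶ N) := by
  have := fun j => projective_piece N (w j)
  have : Module.Projective A (∀ j, N.piece (w j)) := Module.Projective.of_equiv
    (DFinsupp.linearEquivFunOnFintype (R := A) (M := fun j => N.piece (w j)))
  exact Module.Projective.of_equiv (F.homEquiv N).symm

include F in
theorem IsFreeOn.finite_hom [IsNoetherianRing A] (N : CMod p L Set.univ A π) :
    Module.Finite A (P ⟶ N) :=
  Module.Finite.equiv (F.homEquiv N).symm

variable (A' : Type u) [CommRing A'] [Algebra K A'] [Algebra A A'] [IsScalarTower K A A']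

theorem act_baseChange (M : CMod p L S A π) (u : L.US p S) (a : A') (x : M) :
    (M.baseChange A').act u (a ⊗ₜ[A] x : A' ⊗[A] M) = (a ⊗ₜ[A] (M.act u x) : A' ⊗[A] M) := by
  induction u using L.US_induction generalizing x with
  | h_alg c =>
    refine (act_algebraMap (M.baseChange A') c _).trans ?_
    rw [act_algebraMap, TensorProduct.tmul_smul, ← algebraMap_smul A',
      ← IsScalarTower.algebraMap_apply]
    rfl
  | h_gen y =>
    rw [act_toUS, act_toUS]
    rfl
  | h_add u v hu hv =>
    rw [map_add, map_add, LinearMap.add_apply, TensorProduct.tmul_add]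
    exact congrArg₂ (· + ·) (hu x) (hv x)
  | h_mul u v hu hv =>
    rw [map_mul, act_mul]
    exact (congrArg ((M.baseChange A').act u) (hv x)).trans (hu _)

/-- Free objects remain free under extension of scalars. -/
def IsFreeOn.baseChange : IsFreeOn B (P.baseChange A') w
    (fun j => (1 ⊗ₜ[A] v j : A' ⊗[A] P)) where
  mem j := Submodule.tmul_mem_baseChange_of_mem 1 (F.mem j)
  basis := Module.Basis.baseChange A' F.basis
  basis_apply j i := by
    refine (Module.Basis.baseChange_apply A' F.basis (j, i)).trans ?_
    rw [F.basis_apply]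
    exact (act_baseChange A' P _ 1 _).symm

end Free

section Kappa

variable (A' : Type u) [CommRing A'] [Algebra K A'] [Algebra A A'] [IsScalarTower K A A']

/-- The canonical map `A' ⊗ Hom(M, N) → Hom(M ⊗ A', N ⊗ A')`. -/
def homBaseChange (M N : CMod p L S A π) :
    A' ⊗[A] (M ⟶ N) →ₗ[A'] (M.baseChange A' ⟶ N.baseChange A') :=
  letI : Module A (M.baseChange A' ⟶ N.baseChange A') := Module.compHom _ (algebraMap A A')
  haveI : IsScalarTower A A' (M.baseChange A' ⟶ N.baseChange A') :=
    IsScalarTower.of_algebraMap_smul fun _ _ => rfl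
  LinearMap.liftBaseChange A'
    { toFun := baseChangeMap A'
      map_add' := fun f g => CMod.hom_ext fun x =>
        DFunLike.congr_fun (LinearMap.baseChange_add (A := A') (lin f) (lin g)) x
      map_smul' := fun a f => CMod.hom_ext fun x => by
        refine (DFunLike.congr_fun (LinearMap.baseChange_smul (A := A') a (lin f)) x).trans ?_
        exact (algebraMap_smul A' a _).symm }

theorem homBaseChange_tmul (M N : CMod p L S A π) (a : A') (f : M ⟶ N) :
    homBaseChange A' M N (a ⊗ₜ f) = a • baseChangeMap A' f := rfl

/-- Extension of scalars commutes with taking a piece. -/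
def pieceBaseChange (N : CMod p L S A π) (w : L.Wt) :
    A' ⊗[A] N.piece w ≃ₗ[A'] (N.baseChange A').piece w :=
  LinearEquiv.ofInjective ((N.piece w).subtype.baseChange A') (by
    -- A piece is a direct summand of `N`, so its inclusion stays injective under base change
    -- without any flatness of `A'`.
    let r : N →ₗ[A] N.piece w := (N.proj w).codRestrict _ fun m => N.proj_mem w m
    have h : r ∘ₗ (N.piece w).subtype = LinearMap.id :=
      LinearMap.ext fun m => Subtype.ext (N.proj_same w m m.2)
    refine Function.LeftInverse.injective (g := r.baseChange A') fun x => ?_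
    rw [← LinearMap.comp_apply, ← LinearMap.baseChange_comp, h, LinearMap.baseChange_id]
    rfl)

variable {A'} {B : L.FreeBasis p} {P : CMod p L Set.univ A π} {m : ℕ} {w : Fin m → L.Wt}
  {v : Fin m → P} (F : IsFreeOn B P w v)

include F in
-- Evaluation at the generators identifies both sides with the product of the pieces `N_{w j} ⊗ A'`;
-- finiteness of the set of generators lets the tensor product commute with the product.
theorem IsFreeOn.bijective_homBaseChange (N : CMod p L Set.univ A π) :
    Function.Bijective (homBaseChange A' P N) := by
  let T : A' ⊗[A] (P ⟶ N) ≃ₗ[A'] ∀ j, (N.baseChange A').piece (w j) :=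
    (F.homEquiv N).baseChange A A' _ _ ≪≫ₗ TensorProduct.piRight A A' A' _ ≪≫ₗ
      LinearEquiv.piCongrRight fun j => pieceBaseChange A' N (w j)
  have h : ∀ x, (F.baseChange A').homEquiv (N.baseChange A') (homBaseChange A' P N x) = T x := by
    intro x
    induction x with
    | zero => simp
    | add x y hx hy => rw [map_add, map_add, hx, hy, map_add]
    | tmul a f =>
      funext j
      refine Subtype.ext ?_
      rw [homBaseChange_tmul, map_smul]
      change a • ((1 : A') ⊗ₜ[A] lin f (v j)) = a ⊗ₜ[A] lin f (v j)
      rw [TensorProduct.smul_tmul', smul_eq_mul, mul_one]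
  have h2 : (homBaseChange A' P N : _ → _) =
      ((F.baseChange A').homEquiv (N.baseChange A')).symm ∘ T := by
    funext x
    rw [Function.comp_apply, ← h, LinearEquiv.symm_apply_apply]
  rw [h2]
  exact (LinearEquiv.bijective _).comp T.bijective

end Kappa

section Cover

variable [Fact p.Prime] [CharP K p]

/-- Every object is a quotient of a free object. -/
theorem exists_free_cover (B : L.FreeBasis p) (M : CMod p L Set.univ A π) :
    ∃ (P : CMod p L Set.univ A π) (m : ℕ) (w : Fin m → L.Wt) (v : Fin m → P) (f : P ⟶ M),
      Nonempty (IsFreeOn B P w v) ∧ Function.Surjective (lin f) := by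
  obtain ⟨m, w, g, hg, hs⟩ := exists_homogeneous_generators M
  obtain ⟨P, v, ⟨F⟩⟩ := exists_isFreeOn π B w
  refine ⟨P, m, w, v, F.desc M fun j => ⟨g j, hg j⟩, ⟨F⟩, ?_⟩
  rw [← LinearMap.range_eq_top, eq_top_iff, ← hs, Submodule.span_le]
  rintro _ ⟨j, rfl⟩
  exact ⟨v j, F.desc_gen M _ j⟩

end Cover

end CMod

/-! ### A criterion for split injectivity modulo maximal ideals -/

section SplitInjective

variable {R : Type u} [CommRing R] {M N : Type u} [AddCommGroup M] [Module R M]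
  [AddCommGroup N] [Module R N]

open TensorProduct in
-- For a maximal ideal, `R ⧸ 𝔪` is the residue field of the localization, and tensoring with it in
-- one or two steps agrees. This brings the hypothesis into the form of the criterion over local
-- rings.
theorem lTensor_residueField_injective_of_quotient (𝔪 : Ideal R) [𝔪.IsMaximal] (l : M →ₗ[R] N)
    (h : Function.Injective (l.lTensor (R ⧸ 𝔪))) :
    Function.Injective ((l.baseChange (Localization.AtPrime 𝔪)).lTensor
      (IsLocalRing.ResidueField (Localization.AtPrime 𝔪))) := by
  let S := Localization.AtPrime 𝔪
  let k := IsLocalRing.ResidueField S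
  let e : (R ⧸ 𝔪) ≃ₗ[R] k := LinearEquiv.ofBijective
    (Algebra.linearMap (R ⧸ 𝔪) 𝔪.ResidueField |>.restrictScalars R)
    𝔪.bijective_algebraMap_quotient_residueField
  have h1 : Function.Injective (l.lTensor k) := by
    have h2 : ∀ x, l.lTensor k x = e.rTensor N (l.lTensor (R ⧸ 𝔪) (e.symm.rTensor M x)) := by
      intro x
      induction x with
      | zero => simp
      | add x y hx hy => simp only [map_add, hx, hy]
      | tmul a m => simp
    intro x y hxy
    rw [h2, h2] at hxy
    exact (e.symm.rTensor M).injective (h ((e.rTensor N).injective hxy))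
  let eM := AlgebraTensorModule.cancelBaseChange R S k k M
  let eN := AlgebraTensorModule.cancelBaseChange R S k k N
  have h2 : ∀ x, eN ((l.baseChange S).lTensor k x) = l.lTensor k (eM x) := by
    intro x
    induction x with
    | zero => simp
    | add x y hx hy => simp only [map_add, hx, hy]
    | tmul a m =>
      induction m with
      | zero => simp
      | add x y hx hy => simp only [TensorProduct.tmul_add, map_add, hx, hy]
      | tmul b m => simp [eM, eN]
  intro x y hxy
  exact eM.injective (h1 (by rw [← h2, ← h2, hxy]))

/-- A linear map from a finite module to a finite projective module that is injective modulo all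
maximal ideals is split injective. -/
theorem exists_leftInverse_of_lTensor_quotient_injective [IsNoetherianRing R] [Module.Finite R M]
    [Module.Finite R N] [Module.Projective R N] (l : M →ₗ[R] N)
    (h : ∀ 𝔪 : Ideal R, 𝔪.IsMaximal → Function.Injective (l.lTensor (R ⧸ 𝔪))) :
    ∃ r : N →ₗ[R] M, r ∘ₗ l = LinearMap.id := by
  have hfree : ∀ (𝔪 : Ideal R) [𝔪.IsMaximal],
      Module.Free (Localization.AtPrime 𝔪) (Localization.AtPrime 𝔪 ⊗[R] N) := fun 𝔪 _ =>
    Module.free_of_flat_of_isLocalRing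
  have hloc := fun (𝔪 : Ideal R) (h𝔪 : 𝔪.IsMaximal) =>
    lTensor_residueField_injective_of_quotient 𝔪 l (h 𝔪 h𝔪)
  have hinj : Function.Injective l := by
    rw [injective_iff_map_eq_zero]
    intro x hx
    by_contra hx0
    -- The annihilator of a nonzero kernel element lies in a maximal ideal `𝔪`. Split injectivity at
    -- `𝔪` kills the image of `x` in the localization, so some element outside `𝔪` annihilates `x`,
    -- a contradiction.
    have hne : LinearMap.ker (LinearMap.toSpanSingleton R M x) ≠ ⊤ := by
      intro htop
      have : (1 : R) ∈ LinearMap.ker (LinearMap.toSpanSingleton R M x) := by rw [htop]; trivial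
      exact hx0 (by simpa using this)
    obtain ⟨𝔪, h𝔪, hle⟩ := Ideal.exists_le_maximal _ hne
    have := hfree 𝔪
    obtain ⟨r, hr⟩ := (IsLocalRing.split_injective_iff_lTensor_residueField_injective _).2
      (hloc 𝔪 h𝔪)
    have h0 : TensorProduct.mk R (Localization.AtPrime 𝔪) M 1 x = 0 := by
      rw [TensorProduct.mk_apply, ← LinearMap.id_apply (R := Localization.AtPrime 𝔪)
        ((1 : Localization.AtPrime 𝔪) ⊗ₜ[R] x), ← hr, LinearMap.comp_apply,
        LinearMap.baseChange_tmul, hx, TensorProduct.tmul_zero, map_zero]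
    rw [IsLocalizedModule.eq_zero_iff 𝔪.primeCompl] at h0
    obtain ⟨s, hs⟩ := h0
    exact s.2 (hle hs)
  have := Module.finitePresentation_of_finite R (N ⧸ LinearMap.range l)
  -- The cokernel is free at every maximal ideal by the residue field criterion. Being finitely
  -- presented, it is projective, and then the short exact sequence splits.
  have hproj : Module.Projective R (N ⧸ LinearMap.range l) := by
    refine Module.projective_of_localization_maximal'
      (fun 𝔪 _ => Localization.AtPrime 𝔪)
      (fun 𝔪 _ => Localization.AtPrime 𝔪 ⊗[R] (N ⧸ LinearMap.range l))
      (fun 𝔪 _ => TensorProduct.mk R (Localization.AtPrime 𝔪) _ 1) fun 𝔪 h𝔪 => ?_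
    have := hfree 𝔪
    have := Module.free_of_lTensor_residueField_injective
      (f := l.baseChange (Localization.AtPrime 𝔪))
      (g := (LinearMap.range l).mkQ.baseChange (Localization.AtPrime 𝔪))
      (LinearMap.lTensor_surjective _ (Submodule.mkQ_surjective _))
      (lTensor_exact _ (LinearMap.exact_map_mkQ_range l) (Submodule.mkQ_surjective _))
      (hloc 𝔪 h𝔪)
    infer_instance
  obtain ⟨s, hs⟩ := Module.projective_lifting_property (LinearMap.range l).mkQ LinearMap.id
    (Submodule.mkQ_surjective _)
  have htfae := (LinearMap.exact_map_mkQ_range l).split_tfae'.out 0 1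
  exact (htfae.1 ⟨hinj, s, hs⟩).2

end SplitInjective

/-! ### Contractions from exactness modulo maximal ideals -/

section Contraction

variable {R : Type u} [CommRing R] [IsNoetherianRing R] {C₀ C₁ C₂ : Type u}
  [AddCommGroup C₀] [Module R C₀] [AddCommGroup C₁] [Module R C₁] [AddCommGroup C₂] [Module R C₂]
  [Module.Finite R C₁] [Module.Finite R C₂]
  [Module.Projective R C₁] [Module.Projective R C₂]

/-- A complex `C₀ → C₁ → C₂` of finite projective modules that is exact modulo all maximal ideals is
contractible at `C₁`. -/
theorem exists_contraction (d₀ : C₀ →ₗ[R] C₁) (d₁ : C₁ →ₗ[R] C₂) (hd : d₁ ∘ₗ d₀ = 0)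
    (h : ∀ 𝔪 : Ideal R, 𝔪.IsMaximal →
      ∀ x, d₁.lTensor (R ⧸ 𝔪) x = 0 → ∃ y, d₀.lTensor (R ⧸ 𝔪) y = x) :
    ∃ (h₁ : C₁ →ₗ[R] C₀) (h₂ : C₂ →ₗ[R] C₁), ∀ x, d₀ (h₁ x) + h₂ (d₁ x) = x := by
  let q := (LinearMap.range d₀).mkQ
  have hq : q ∘ₗ d₀ = 0 := LinearMap.range_mkQ_comp d₀
  let l : (C₁ ⧸ LinearMap.range d₀) →ₗ[R] C₂ := (LinearMap.range d₀).liftQ d₁ (by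
    rintro _ ⟨x, rfl⟩
    exact DFunLike.congr_fun hd x)
  have hl : l ∘ₗ q = d₁ := Submodule.liftQ_mkQ _ _ _
  -- By right exactness of the tensor product, exactness at `C₁` modulo `𝔪` says precisely that the
  -- map from `C₁ / im d₀` to `C₂` stays injective modulo `𝔪`.
  obtain ⟨r, hr⟩ := exists_leftInverse_of_lTensor_quotient_injective l (fun 𝔪 h𝔪 => by
    rw [injective_iff_map_eq_zero]
    intro t ht
    obtain ⟨s, rfl⟩ := LinearMap.lTensor_surjective (R ⧸ 𝔪)
      (Submodule.mkQ_surjective (LinearMap.range d₀)) t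
    rw [← LinearMap.comp_apply, ← LinearMap.lTensor_comp, hl] at ht
    obtain ⟨y, rfl⟩ := h 𝔪 h𝔪 s ht
    rw [← LinearMap.comp_apply, ← LinearMap.lTensor_comp, hq, LinearMap.lTensor_zero,
      LinearMap.zero_apply])
  have : Module.Projective R (C₁ ⧸ LinearMap.range d₀) := Module.Projective.of_split l r hr
  -- The quotient `C₁ / im d₀` is projective as a summand of `C₂`. So `im d₀` is a summand of `C₁`,
  -- hence projective, and `C₀ → im d₀` splits too.
  obtain ⟨σ, hσ⟩ := Module.projective_lifting_property q LinearMap.id (Submodule.mkQ_surjective _)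
  have hmem : ∀ x, x - σ (q x) ∈ LinearMap.range d₀ := fun x => by
    rw [← Submodule.Quotient.mk_eq_zero]
    change q (x - σ (q x)) = 0
    rw [map_sub, sub_eq_zero]
    exact (DFunLike.congr_fun hσ (q x)).symm
  let c : C₁ →ₗ[R] LinearMap.range d₀ :=
    (LinearMap.id - σ ∘ₗ q).codRestrict _ hmem
  have : Module.Projective R (LinearMap.range d₀) :=
    Module.Projective.of_split (LinearMap.range d₀).subtype c (LinearMap.ext fun x => Subtype.ext (by
      have : q x = 0 := (Submodule.Quotient.mk_eq_zero _).2 x.2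
      simp [c, this]))
  obtain ⟨τ, hτ⟩ := Module.projective_lifting_property d₀.rangeRestrict LinearMap.id
    d₀.surjective_rangeRestrict
  refine ⟨τ ∘ₗ c, σ ∘ₗ r, fun x => ?_⟩
  have h1 : d₀ (τ (c x)) = x - σ (q x) := congrArg Subtype.val (DFunLike.congr_fun hτ (c x))
  have h2 : r (d₁ x) = q x := by
    rw [← hl]
    exact DFunLike.congr_fun hr (q x)
  rw [LinearMap.comp_apply, LinearMap.comp_apply, h1, h2, sub_add_cancel]

end Contraction

/-! ### Dimension shifting for extension groups -/

section ExtShift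

open Abelian

variable {C : Type*} [Category C] [CategoryTheory.Abelian C] [HasExt C]
  {T : ShortComplex C} (hT : T.ShortExact) [Projective T.X₂] (N : C)

include hT in
-- In the long exact sequence `Ext¹` of the projective middle term vanishes, so the group in
-- question is the cokernel of the restriction `Hom(T.X₂, N) → Hom(T.X₁, N)`.
theorem subsingleton_ext_one_iff :
    Subsingleton (Ext T.X₃ N 1) ↔ ∀ φ : T.X₁ ⟶ N, ∃ ψ : T.X₂ ⟶ N, T.f ≫ ψ = φ := by
  constructor
  · intro _ φ
    obtain ⟨x, hx⟩ := Ext.contravariant_sequence_exact₁ hT N (Ext.mk₀ φ) (add_zero 1)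
      (Subsingleton.elim _ _)
    obtain ⟨ψ, rfl⟩ := Ext.homEquiv₀.symm.surjective x
    refine ⟨ψ, Ext.homEquiv₀.symm.injective ?_⟩
    simpa using hx
  · intro h
    refine subsingleton_of_forall_eq 0 fun x => ?_
    obtain ⟨y, rfl⟩ := Ext.contravariant_sequence_exact₃ hT N x (Ext.eq_zero_of_projective _)
      (add_zero 1)
    obtain ⟨φ, rfl⟩ := Ext.homEquiv₀.symm.surjective y
    obtain ⟨ψ, rfl⟩ := h φ
    have : Ext.homEquiv₀.symm (T.f ≫ ψ) = (Ext.mk₀ T.f).comp (Ext.mk₀ ψ) (zero_add 0) := by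
      simp
    rw [this]
    exact hT.extClass_comp_assoc _

include hT in
theorem subsingleton_ext_succ_iff (n : ℕ) :
    Subsingleton (Ext T.X₃ N (n + 2)) ↔ Subsingleton (Ext T.X₁ N (n + 1)) := by
  constructor
  · intro _
    refine subsingleton_of_forall_eq 0 fun x => ?_
    obtain ⟨y, rfl⟩ := Ext.contravariant_sequence_exact₁ hT N x (n₁ := n + 2) (by omega)
      (Subsingleton.elim _ _)
    rw [Ext.eq_zero_of_projective y, Ext.comp_zero]
  · intro _
    refine subsingleton_of_forall_eq 0 fun x => ?_
    obtain ⟨y, rfl⟩ := Ext.contravariant_sequence_exact₃ hT N x (Ext.eq_zero_of_projective _)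
      (n₀ := n + 1) (by omega)
    rw [Subsingleton.elim y 0, Ext.comp_zero]

end ExtShift

/-! ### Resolutions under extension of scalars -/

namespace CMod

open StdLevi

variable {K : Type u} {ι X Y 𝔤 : Type*} [Field K] [Finite ι] [AddCommGroup X] [AddCommGroup Y]
  [LieRing 𝔤] [LieAlgebra K 𝔤] {D : ReductiveLie K ι X Y 𝔤}
  {p : ℕ} {L : StdLevi D} {S : Set ι} {A : Type u} [CommRing A] [Algebra K A]
  {π : CartanAlg K Y →ₗ[K] A}

theorem shortExact_of_lin [IsNoetherianRing A] (T : ShortComplex (CMod p L S A π))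
    (hf : Function.Injective (lin T.f)) (he : Function.Exact (lin T.f) (lin T.g))
    (hg : Function.Surjective (lin T.g)) : T.ShortExact where
  exact := by
    rw [T.exact_iff_of_forks (kerIsLimit T.g) (cokerIsColimit T.f)]
    ext m
    exact (Submodule.Quotient.mk_eq_zero _).2 ((he _).1 m.2)
  mono_f := mono_of_inj _ hf
  epi_g := epi_of_surj _ hg

theorem exact_kerι_lin [IsNoetherianRing A] {P M : CMod p L S A π} (f : P ⟶ M) :
    Function.Exact (lin (kerι f)) (lin f) := fun y =>
  ⟨fun hy => ⟨⟨y, hy⟩, rfl⟩, by rintro ⟨x, rfl⟩; exact x.2⟩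

/-- Precomposition as a linear map. -/
def precomp {M M' : CMod p L S A π} (f : M ⟶ M') (N : CMod p L S A π) :
    (M' ⟶ N) →ₗ[A] (M ⟶ N) where
  toFun g := f ≫ g
  map_add' _ _ := rfl
  map_smul' _ _ := rfl

section BaseChangeMap

variable (A' : Type u) [CommRing A'] [Algebra K A'] [Algebra A A'] [IsScalarTower K A A']

theorem baseChangeMap_comp {M N Q : CMod p L S A π} (f : M ⟶ N) (g : N ⟶ Q) :
    baseChangeMap A' (f ≫ g) = baseChangeMap A' f ≫ baseChangeMap A' g :=
  CMod.hom_ext fun x => DFunLike.congr_fun (LinearMap.baseChange_comp (A := A') (lin f) (lin g)) x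

theorem baseChangeMap_zero (M N : CMod p L S A π) : baseChangeMap A' (0 : M ⟶ N) = 0 :=
  CMod.hom_ext fun x => DFunLike.congr_fun (LinearMap.baseChange_zero (A := A')) x

theorem surjective_lin_baseChangeMap {P M : CMod p L S A π} (f : P ⟶ M)
    (hf : Function.Surjective (lin f)) :
    Function.Surjective (lin (baseChangeMap A' f)) :=
  LinearMap.lTensor_surjective A' hf

theorem homBaseChange_precomp {P Q : CMod p L S A π} (f : P ⟶ Q) (N : CMod p L S A π)
    (x : A' ⊗[A] (Q ⟶ N)) :
    homBaseChange A' P N ((precomp f N).lTensor A' x) =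
      baseChangeMap A' f ≫ homBaseChange A' Q N x := by
  induction x with
  | zero => simp
  | add x y hx hy => rw [map_add, map_add, hx, hy, map_add, Preadditive.comp_add]
  | tmul a g =>
    rw [LinearMap.lTensor_tmul, homBaseChange_tmul, homBaseChange_tmul, Linear.comp_smul,
      ← baseChangeMap_comp]
    rfl

end BaseChangeMap

section KernelBaseChange

variable [IsNoetherianRing A] {P M : CMod p L S A π} (f : P ⟶ M)
  (hf : Function.Surjective (lin f)) [Module.Projective A M]

include hf in
-- The surjection onto `M` splits over `A`, though usually not in the category. This suffices for
-- the kernel to be `A`-projective when `P` is, and for the sequence to stay exact under base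
-- change.
theorem exists_retraction_kerι : ∃ r : P →ₗ[A] ker f, r ∘ₗ lin (kerι f) = LinearMap.id := by
  obtain ⟨s, hs⟩ := Module.projective_lifting_property (lin f) LinearMap.id hf
  have htfae := (exact_kerι_lin f).split_tfae'.out 0 1
  exact (htfae.1 ⟨Subtype.val_injective, s, hs⟩).2

include hf in
theorem projective_ker [Module.Projective A P] : Module.Projective A (ker f) :=
  have ⟨r, hr⟩ := exists_retraction_kerι f hf
  Module.Projective.of_split (lin (kerι f)) r hr

variable (A' : Type u) [CommRing A'] [Algebra K A'] [Algebra A A'] [IsScalarTower K A A']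

/-- The short complex `ker f ⊗ A' → P ⊗ A' → M ⊗ A'`. -/
abbrev kerBaseChange : ShortComplex (CMod p L S A' (bcπ A' π)) :=
  ShortComplex.mk (baseChangeMap A' (kerι f)) (baseChangeMap A' f)
    (by rw [← baseChangeMap_comp, kerι_comp, baseChangeMap_zero])

include hf in
theorem shortExact_kerBaseChange [IsNoetherianRing A'] : (kerBaseChange f A').ShortExact := by
  refine shortExact_of_lin _ ?_ (lTensor_exact A' (exact_kerι_lin f) hf)
    (surjective_lin_baseChangeMap A' f hf)
  obtain ⟨r, hr⟩ := exists_retraction_kerι f hf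
  refine Function.LeftInverse.injective (g := r.baseChange A') fun x => ?_
  refine (DFunLike.congr_fun (LinearMap.baseChange_comp (A := A') (lin (kerι f)) r) x).symm.trans ?_
  rw [hr, LinearMap.baseChange_id]
  rfl

end KernelBaseChange

section Resolution

variable [IsNoetherianRing A] {P₀ P₁ P₂ M N : CMod p L Set.univ A π}
  (f₀ : P₀ ⟶ M) (f₁ : P₁ ⟶ ker f₀) (f₂ : P₂ ⟶ ker f₁)
  (hf₀ : Function.Surjective (lin f₀)) (hf₁ : Function.Surjective (lin f₁))
  (hf₂ : Function.Surjective (lin f₂)) [Module.Projective A M] [Module.Projective A (ker f₀)]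
  (A' : Type u) [CommRing A'] [IsNoetherianRing A'] [Algebra K A'] [Algebra A A']
  [IsScalarTower K A A'] [Projective (P₀.baseChange A')]

include hf₀ hf₁ hf₂ in
/-- The first extension group computed from the first steps of a projective resolution. -/
theorem extVanishes_one_iff (N' : CMod p L Set.univ A' (bcπ A' π)) :
    (M.baseChange A').ExtVanishes N' 1 ↔
      ∀ g : P₁.baseChange A' ⟶ N', baseChangeMap A' (f₂ ≫ kerι f₁) ≫ g = 0 →
        ∃ ψ : P₀.baseChange A' ⟶ N', baseChangeMap A' (f₁ ≫ kerι f₀) ≫ ψ = g := by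
  have := HasExt.standard (CMod p L Set.univ A' (bcπ A' π))
  have hT₀ := shortExact_kerBaseChange f₀ hf₀ A'
  have hT₁ := shortExact_kerBaseChange f₁ hf₁ A'
  have h₁ : Epi (baseChangeMap A' f₁) := epi_of_surj _ (surjective_lin_baseChangeMap A' f₁ hf₁)
  have h₂ : Epi (baseChangeMap A' f₂) := epi_of_surj _ (surjective_lin_baseChangeMap A' f₂ hf₂)
  have : Projective (kerBaseChange f₀ A').X₂ := ‹Projective (P₀.baseChange A')›
  refine (subsingleton_ext_one_iff hT₀ N').trans ⟨fun h g hg => ?_, fun h φ => ?_⟩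
  · rw [baseChangeMap_comp, Category.assoc, ← Limits.comp_zero (f := baseChangeMap A' f₂),
      cancel_epi] at hg
    -- Vanishing on the image of `P₂`, the cocycle `g` factors through the base change of `ker f₀`,
    -- and `Ext¹ = 0` extends this factor to `P₀`.
    obtain ⟨ψ, hψ⟩ := h (hT₁.exact.desc g hg)
    refine ⟨ψ, ?_⟩
    rw [baseChangeMap_comp, Category.assoc]
    refine (congrArg (baseChangeMap A' f₁ ≫ ·) hψ).trans ?_
    exact hT₁.exact.g_desc g hg
  · obtain ⟨ψ, hψ⟩ := h (baseChangeMap A' f₁ ≫ φ) (by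
      rw [baseChangeMap_comp, Category.assoc, ← Category.assoc (baseChangeMap A' (kerι f₁)),
        ← baseChangeMap_comp, kerι_comp, baseChangeMap_zero, Limits.zero_comp, Limits.comp_zero])
    refine ⟨ψ, ?_⟩
    rw [baseChangeMap_comp, Category.assoc, cancel_epi] at hψ
    exact hψ

include hf₀ hf₁ hf₂ in
-- Transports the criterion along the base change isomorphisms for `Hom(Pᵢ, N)`, so that a single
-- complex over `A` governs `Ext¹` over all `A'`.
theorem extVanishes_one_iff_exact (h₀ : Function.Bijective (homBaseChange A' P₀ N))
    (h₁ : Function.Bijective (homBaseChange A' P₁ N))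
    (h₂ : Function.Bijective (homBaseChange A' P₂ N)) :
    (M.baseChange A').ExtVanishes (N.baseChange A') 1 ↔
      ∀ x, (precomp (f₂ ≫ kerι f₁) N).lTensor A' x = 0 →
        ∃ y, (precomp (f₁ ≫ kerι f₀) N).lTensor A' y = x := by
  rw [extVanishes_one_iff f₀ f₁ f₂ hf₀ hf₁ hf₂]
  constructor
  · intro h x hx
    obtain ⟨ψ, hψ⟩ := h (homBaseChange A' P₁ N x) (by
      rw [← homBaseChange_precomp, hx, map_zero])
    obtain ⟨y, rfl⟩ := h₀.2 ψ
    exact ⟨y, h₁.1 (by rw [homBaseChange_precomp, hψ])⟩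
  · intro h g hg
    obtain ⟨x, rfl⟩ := h₁.2 g
    obtain ⟨y, rfl⟩ := h x (h₂.1 (by rw [homBaseChange_precomp, hg, map_zero]))
    exact ⟨homBaseChange A' P₀ N y, (homBaseChange_precomp A' _ N y).symm⟩

end Resolution

end CMod

/-! ### Vanishing and base change -/

namespace CMod

open StdLevi

variable {K : Type u} {ι X Y 𝔤 : Type*} [Field K] [Finite ι] [AddCommGroup X] [AddCommGroup Y]
  [LieRing 𝔤] [LieAlgebra K 𝔤] {D : ReductiveLie K ι X Y 𝔤}
  {p : ℕ} {L : StdLevi D} {A : Type u} [CommRing A] [Algebra K A]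
  {π : CartanAlg K Y →ₗ[K] A} [IsNoetherianRing A] [Fact p.Prime] [CharP K p]
  [Module.Finite ℤ Y]

/-- For a presentation `P₁ → P₀ → M → 0`, a splitting of the image of `Hom(P₀, N)` in `Hom(P₁, N)`
makes `Hom(M, N)` a direct summand of `Hom(P₀, N)`. -/
theorem exists_retraction_precomp {P₀ P₁ M N : CMod p L Set.univ A π} (f₀ : P₀ ⟶ M)
    (hf₀ : Function.Surjective (lin f₀)) (f₁ : P₁ ⟶ ker f₀) (hf₁ : Function.Surjective (lin f₁))
    (h₁ : (P₁ ⟶ N) →ₗ[A] (P₀ ⟶ N))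
    (hh : ∀ x : P₀ ⟶ N, (f₁ ≫ kerι f₀) ≫ h₁ ((f₁ ≫ kerι f₀) ≫ x) = (f₁ ≫ kerι f₀) ≫ x) :
    ∃ s : (P₀ ⟶ N) →ₗ[A] (M ⟶ N), s ∘ₗ precomp f₀ N = LinearMap.id ∧
      ∀ x : P₀ ⟶ N, precomp f₀ N (s x) + h₁ (precomp (f₁ ≫ kerι f₀) N x) = x := by
  have := epi_of_surj f₀ hf₀
  have := epi_of_surj f₁ hf₁
  have hT := shortExact_of_lin (ShortComplex.mk (kerι f₀) f₀ (kerι_comp f₀))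
    Subtype.val_injective (exact_kerι_lin f₀) hf₀
  have hz : (f₁ ≫ kerι f₀) ≫ f₀ = 0 := by rw [Category.assoc, kerι_comp, Limits.comp_zero]
  -- Writing `d` for precomposition with `P₁ → P₀`, the relation `d h₁ d = d` shows that `x - h₁ (d
  -- x)` is killed by `d`. It therefore factors through `M`, which defines the projection onto
  -- `Hom(M, N)`.
  have hmem : ∀ x : P₀ ⟶ N, x - h₁ ((f₁ ≫ kerι f₀) ≫ x) ∈ LinearMap.range (precomp f₀ N) := by
    intro x
    have h0 : kerι f₀ ≫ (x - h₁ ((f₁ ≫ kerι f₀) ≫ x)) = 0 := by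
      rw [← cancel_epi f₁, Limits.comp_zero, ← Category.assoc, Preadditive.comp_sub, hh, sub_self]
    exact ⟨hT.exact.desc _ h0, hT.exact.g_desc _ h0⟩
  have hinj : Function.Injective (precomp f₀ N) := fun x y hxy => (cancel_epi f₀).1 hxy
  let e := LinearEquiv.ofInjective (precomp f₀ N) hinj
  let q : (P₀ ⟶ N) →ₗ[A] LinearMap.range (precomp f₀ N) :=
    (LinearMap.id - h₁ ∘ₗ precomp (f₁ ≫ kerι f₀) N).codRestrict _ hmem
  have hq : ∀ x, precomp f₀ N (e.symm (q x)) = x - h₁ ((f₁ ≫ kerι f₀) ≫ x) := fun x =>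
    congrArg Subtype.val (e.apply_symm_apply (q x))
  refine ⟨e.symm.toLinearMap ∘ₗ q, LinearMap.ext fun g => hinj ?_, fun x => ?_⟩
  · refine (hq _).trans ?_
    change precomp f₀ N g - h₁ ((f₁ ≫ kerι f₀) ≫ f₀ ≫ g) = _
    rw [← Category.assoc, hz, Limits.zero_comp, map_zero, sub_zero]
    rfl
  · refine (congrArg (· + _) (hq x)).trans ?_
    exact sub_add_cancel _ _

/-- The case of first extension groups, together with base change for morphisms. -/
theorem hom_of_extVanishes_one (M N : CMod p L Set.univ A π)
    [Module.Projective A M] [Module.Projective A N]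
    (h : ∀ 𝔪 : Ideal A, 𝔪.IsMaximal →
      (M.baseChange (A ⧸ 𝔪)).ExtVanishes (N.baseChange (A ⧸ 𝔪)) 1) :
    Module.Projective A (M ⟶ N) ∧
    ∀ (A' : Type u) [CommRing A'] [IsNoetherianRing A'] [Algebra K A'] [Algebra A A']
      [IsScalarTower K A A'], (M.baseChange A').ExtVanishes (N.baseChange A') 1 ∧
        Function.Bijective (homBaseChange A' M N) := by
  obtain ⟨B⟩ := nonempty_freeBasis L p
  obtain ⟨P₀, _, _, _, f₀, ⟨F₀⟩, hf₀⟩ := exists_free_cover B M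
  obtain ⟨P₁, _, _, _, f₁, ⟨F₁⟩, hf₁⟩ := exists_free_cover B (ker f₀)
  obtain ⟨P₂, _, _, _, f₂, ⟨F₂⟩, hf₂⟩ := exists_free_cover B (ker f₁)
  have := F₀.free
  have := projective_ker f₀ hf₀
  have := F₀.projective_hom N
  have := F₁.projective_hom N
  have := F₂.projective_hom N
  have := F₁.finite_hom N
  have := F₂.finite_hom N
  have key : ∀ (A' : Type u) [CommRing A'] [IsNoetherianRing A'] [Algebra K A'] [Algebra A A']
      [IsScalarTower K A A'], (M.baseChange A').ExtVanishes (N.baseChange A') 1 ↔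
        ∀ x, (precomp (f₂ ≫ kerι f₁) N).lTensor A' x = 0 →
          ∃ y, (precomp (f₁ ≫ kerι f₀) N).lTensor A' y = x := fun A' _ _ _ _ _ => by
    have := (F₀.baseChange A').projective
    exact extVanishes_one_iff_exact f₀ f₁ f₂ hf₀ hf₁ hf₂ A' (F₀.bijective_homBaseChange N)
      (F₁.bijective_homBaseChange N) (F₂.bijective_homBaseChange N)
  have hδ : (f₂ ≫ kerι f₁) ≫ f₁ ≫ kerι f₀ = 0 := by
    rw [Category.assoc, ← Category.assoc (kerι f₁), kerι_comp, Limits.zero_comp, Limits.comp_zero]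
  have hd : precomp (f₂ ≫ kerι f₁) N ∘ₗ precomp (f₁ ≫ kerι f₀) N = 0 := LinearMap.ext fun x => by
    change (f₂ ≫ kerι f₁) ≫ (f₁ ≫ kerι f₀) ≫ x = 0
    rw [← Category.assoc, hδ, Limits.zero_comp]
  obtain ⟨h₁, h₂, hc⟩ := exists_contraction (precomp (f₁ ≫ kerι f₀) N) (precomp (f₂ ≫ kerι f₁) N)
    hd fun 𝔪 h𝔪 => (key (A ⧸ 𝔪)).1 (h 𝔪 h𝔪)
  -- On the image of `C₀` the term with `h₂` disappears since consecutive differentials compose to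
  -- zero; the contraction becomes the splitting relation required here.
  obtain ⟨s, hs, hs'⟩ := exists_retraction_precomp f₀ hf₀ f₁ hf₁ h₁ fun x => by
    have h0 := hc (precomp (f₁ ≫ kerι f₀) N x)
    rw [← LinearMap.comp_apply (precomp (f₂ ≫ kerι f₁) N), hd, LinearMap.zero_apply, map_zero,
      add_zero] at h0
    exact h0
  refine ⟨Module.Projective.of_split _ s hs, fun A' _ _ _ _ _ => ⟨(key A').2 fun x hx =>
    ⟨h₁.lTensor A' x, ?_⟩, ?_, fun g => ?_⟩⟩
  · have h0 : ∀ x, (precomp (f₁ ≫ kerι f₀) N).lTensor A' (h₁.lTensor A' x) +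
        h₂.lTensor A' ((precomp (f₂ ≫ kerι f₁) N).lTensor A' x) = x := fun x => by
      induction x with
      | zero => simp
      | add x y hx hy =>
        rw [map_add, map_add, map_add, map_add, add_add_add_comm, hx, hy]
      | tmul a g =>
        simp only [LinearMap.lTensor_tmul]
        rw [← TensorProduct.tmul_add, hc]
    simpa [hx] using h0 x
  -- The retraction `s` persists after tensoring, so `Hom(M, N) ⊗ A'` embeds into `Hom(P₀, N) ⊗ A'`,
  -- where the canonical map is bijective.
  · rw [injective_iff_map_eq_zero]
    intro x hx
    have h0 : (precomp f₀ N).lTensor A' x = 0 := (F₀.bijective_homBaseChange (A' := A') N).1 (by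
      rw [homBaseChange_precomp, hx, Limits.comp_zero, map_zero])
    have h3 := congrArg (s.lTensor A') h0
    rwa [← LinearMap.comp_apply, ← LinearMap.lTensor_comp, hs, LinearMap.lTensor_id, map_zero] at h3
  -- Composing `g` with the cover gives a cocycle `y` in `Hom(P₀, N) ⊗ A'`. The splitting identity
  -- tensored with `A'` shows that `y` comes from `s y`, which is the desired preimage of `g`.
  · obtain ⟨y, hy⟩ := (F₀.bijective_homBaseChange (A' := A') N).2 (baseChangeMap A' f₀ ≫ g)
    have hy0 : (precomp (f₁ ≫ kerι f₀) N).lTensor A' y = 0 :=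
      (F₁.bijective_homBaseChange (A' := A') N).1 (by
        rw [homBaseChange_precomp, hy, ← Category.assoc, ← baseChangeMap_comp, Category.assoc,
          kerι_comp, Limits.comp_zero, baseChangeMap_zero, Limits.zero_comp, map_zero])
    have h0 : ∀ x, (precomp f₀ N).lTensor A' (s.lTensor A' x) +
        h₁.lTensor A' ((precomp (f₁ ≫ kerι f₀) N).lTensor A' x) = x := fun x => by
      induction x with
      | zero => simp
      | add x y hx hy =>
        rw [map_add, map_add, map_add, map_add, add_add_add_comm, hx, hy]
      | tmul a g =>
        simp only [LinearMap.lTensor_tmul]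
        rw [← TensorProduct.tmul_add, hs']
    have hy1 := h0 y
    rw [hy0, map_zero, add_zero] at hy1
    have := epi_of_surj _ (surjective_lin_baseChangeMap A' f₀ hf₀)
    refine ⟨s.lTensor A' y, (cancel_epi (baseChangeMap A' f₀)).1 ?_⟩
    rw [← homBaseChange_precomp, hy1, hy]

/-- Replacing `M` by the kernel of a free cover lowers the degree by one, simultaneously over each
`A ⧸ 𝔪` and over `A'`. Thus vanishing in a given degree base changes using that degree alone. -/
theorem extVanishes_baseChange (N : CMod p L Set.univ A π) [Module.Projective A N] (i : ℕ)
    (M : CMod p L Set.univ A π) [Module.Projective A M]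
    (h : ∀ 𝔪 : Ideal A, 𝔪.IsMaximal →
      (M.baseChange (A ⧸ 𝔪)).ExtVanishes (N.baseChange (A ⧸ 𝔪)) (i + 1))
    (A' : Type u) [CommRing A'] [IsNoetherianRing A'] [Algebra K A'] [Algebra A A']
    [IsScalarTower K A A'] : (M.baseChange A').ExtVanishes (N.baseChange A') (i + 1) := by
  induction i generalizing M with
  | zero => exact ((hom_of_extVanishes_one M N h).2 A').1
  | succ i ih =>
    obtain ⟨B⟩ := nonempty_freeBasis L p
    obtain ⟨P, _, _, _, f, ⟨F⟩, hf⟩ := exists_free_cover B M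
    have := F.free
    have := projective_ker f hf
    have key : ∀ (A' : Type u) [CommRing A'] [IsNoetherianRing A'] [Algebra K A'] [Algebra A A']
        [IsScalarTower K A A'], (M.baseChange A').ExtVanishes (N.baseChange A') (i + 2) ↔
          ((ker f).baseChange A').ExtVanishes (N.baseChange A') (i + 1) := fun A' _ _ _ _ _ => by
      have := HasExt.standard (CMod p L Set.univ A' (bcπ A' π))
      have : Projective (kerBaseChange f A').X₂ := (F.baseChange A').projective
      exact subsingleton_ext_succ_iff (shortExact_kerBaseChange f hf A') _ i
    exact (key A').2 (ih (ker f) fun 𝔪 h𝔪 => (key (A ⧸ 𝔪)).1 (h 𝔪 h𝔪))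

end CMod

end

theorem mainTheorem11 {p : ℕ} [Fact p.Prime] {K : Type u} [Field K] [IsAlgClosed K] [CharP K p]
    {ι X Y 𝔤 : Type*} [Finite ι] [AddCommGroup X] [Module.Finite ℤ X] [AddCommGroup Y]
    [Module.Finite ℤ Y] [LieRing 𝔤] [LieAlgebra K 𝔤]
    (D : ReductiveLie K ι X Y 𝔤) (hsc : D.SimplyConnectedDerived) (hgood : D.IsGoodPrime p)
    (hform : D.HasInvariantForm) (L : StdLevi D)
    {A : Type u} [CommRing A] [IsNoetherianRing A] [Algebra K A]
    (π : CartanAlg K Y →ₗ[K] A) (hπ : ∀ α ∈ L.RI, π (1 ⊗ₜ D.P.coroot α) = 0)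
    (M N : CMod p L Set.univ A π) (hM : M.HasQFiltration) (hN : Module.Projective A N)
    (hExt : ∀ (𝔪 : Ideal A), 𝔪.IsMaximal → ∀ i : ℕ, 0 < i →
      (M.baseChange (A ⧸ 𝔪)).ExtVanishes (N.baseChange (A ⧸ 𝔪)) i) :
    Module.Projective A (M ⟶ N) ∧
    (∀ (A' : Type u) [CommRing A'] [IsNoetherianRing A'] [Algebra K A'] [Algebra A A']
      [IsScalarTower K A A'], ∀ i : ℕ, 0 < i →
      (M.baseChange A').ExtVanishes (N.baseChange A') i) ∧
    (∀ (A' : Type u) [CommRing A'] [IsNoetherianRing A'] [Algebra K A'] [Algebra A A']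
      [IsScalarTower K A A'],
      ∃ Ψ : A' ⊗[A] (M ⟶ N) ≃ₗ[A'] (M.baseChange A' ⟶ N.baseChange A'),
        ∀ (a : A') (f : M ⟶ N), Ψ (a ⊗ₜ f) = a • CMod.baseChangeMap A' f) := by
  -- From here on only projectivity of `M` over `A` matters.
  have := CMod.projective_of_hasQFiltration hM
  obtain ⟨h₁, h₂⟩ := CMod.hom_of_extVanishes_one M N fun 𝔪 h𝔪 => hExt 𝔪 h𝔪 1 one_pos
  refine ⟨h₁, fun A' _ _ _ _ _ i hi => ?_, fun A' _ _ _ _ _ =>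
    ⟨LinearEquiv.ofBijective (CMod.homBaseChange A' M N) (h₂ A').2, fun _ _ => rfl⟩⟩
  obtain ⟨i, rfl⟩ := Nat.exists_eq_succ_of_ne_zero hi.ne'
  exact CMod.extVanishes_baseChange N i M (fun 𝔪 h𝔪 => hExt 𝔪 h𝔪 (i + 1) hi) A'
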